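/- Let $d\in\mathbb N_0$, let $A\in\mathbb R^{d\times d}$ be regular, $\bm x\in\mathbb R^d$, and let $L=A\mathbb N_0^d-\bm x$. Let $\mathbb 1_L=\sum_{\bm z\in L}\delta_{\bm z}$ (a tempered distribution), let $\hat{\mathbb 1}_L$ be its Fourier transform, with $\hat f(\bm\xi)=\int f(\bm z)e^{-2\pi i\bm z\cdot\bm\xi}\,d\bm z$, and let $L^*=\operatorname{sing\,supp}\hat{\mathbb 1}_L$. Put $$G_\nu(\bm z)=\int_{-1}^1|t|^{-\nu}e^{-\pi|\bm z|^2/t^2}\frac{dt}{|t|}\quad(\bm z\neq\bm 0),\qquad G_\nu(\bm 0)=-\frac2\nu .$$ Then $$L^*\subseteq\{\bm y\in\mathbb R^d: A^T\bm y\text{ has at least one integer component}\}.$$ Moreover, for every $\bm y\in\mathbb R^d$, in particular for every $\bm y\in L^*$, the following hold. 1. The series $Z_{L,\nu}(\bm y)=\sum_{\bm z\in L\setminus\{\bm 0\}}e^{-2\pi i\bm y\cdot\bm z}|\bm z|^{-\nu}$, which converges absolutely for $\operatorname{Re}\nu>d$, extends to a meromorphic function of $\nu\in\mathbb C$. It is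 holomorphic outside $(d-\mathbb N_0)\setminus(-2\mathbb N_0)$ and has at most simple poles at the points of this set. 2. For every $\lambda>0$, the series $\sum_{\bm z\in L}e^{-2\pi i\bm y\cdot\bm z}G_\nu(\bm z/\lambda)$ converges absolutely for every $\nu\in\mathbb C\setminus\{0\}$ (and for $\nu=0$ after omitting $\bm z=\bm 0$), and for all $\nu\in\mathbb C\setminus(d-\mathbb N_0)$ $$Z_{L,\nu}(\bm y)=\frac{\pi^{\nu/2}}{\lambda^\nu\Gamma(\nu/2)}\Big(\sum_{\bm z\in L}e^{-2\pi i\bm y\cdot\bm z}G_\nu(\bm z/\lambda)+\lambda^d\big(\hat{\mathbb 1}_L\ast G_{d-\nu}(\lambda\,\cdot)\big)(\bm y)\Big).$$ The convolution in 2. is understood as follows. For $k\in\mathbb N_0$ let $\mathcal S^k$ be the space of $k$ times continuously differentiable functions with superalgebraic decay of all derivatives up to order $k$. If $\hat{\mathbb 1}_L$ has order at most $k$, that is, if it is continuous for the seminorms of $\mathcal S^k$, and if $\operatorname{Re}\nu>d+k$, then $G_{d-\nu}(\lambda\,\cdot)\in\mathcal S^k$, and the convolution at $\bm y$ is the value of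 the continuous extension of $\hat{\mathbb 1}_L$ to $\mathcal S^k$ at the function $\bm z\mapsto G_{d-\nu}(\lambda(\bm y-\bm z))$. For all other $\nu$ it is the meromorphic continuation in $\nu$ of this function, whose existence is part of the claim. -/

import Mathlib

open scoped SchwartzMap FourierTransform Matrix ContDiff Topology

noncomputable section

/-- Euclidean space of dimension `d`. -/
abbrev Euc (d : ℕ) : Type := EuclideanSpace ℝ (Fin d)

/-- The corner `A ℕ₀^d - x`. -/
def corner {d : ℕ} (A : Matrix (Fin d) (Fin d) ℝ) (x : Euc d) : Set (Euc d) :=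
  Set.range fun n : Fin d → ℕ => WithLp.toLp 2 (A *ᵥ fun i => (n i : ℝ)) - x

/-- The plane wave `exp(-2 π i y · z)`. -/
def planeWave {d : ℕ} (y z : Euc d) : ℂ :=
  Complex.exp (-2 * Real.pi * Complex.I * (inner ℝ y z : ℝ))

/-- The general term of the set zeta function; the sum runs over the points `z ≠ 0` of the set. -/
def zetaTerm {d : ℕ} (ν : ℂ) (y z : Euc d) : ℂ :=
  planeWave y z / (‖z‖ : ℂ) ^ ν

/-- The Crandall function: `G_ν(z) = ∫_{-1}^{1} |t|^{-ν} exp(-π |z|² / t²) dt / |t|` for `z ≠ 0`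
and `G_ν(0) = -2 / ν`. -/
def crandallG {d : ℕ} (ν : ℂ) (z : Euc d) : ℂ :=
  open Classical in
  if z = 0 then -2 / ν
  else ∫ t in (-1 : ℝ)..1,
    ((|t| : ℝ) : ℂ) ^ (-ν) * Complex.exp (-Real.pi * (‖z‖ : ℂ) ^ 2 / (t : ℂ) ^ 2) / ((|t| : ℝ) : ℂ)

/-- The generalized Dirac comb `∑_{z ∈ L} δ_z`, as a sum in the space of tempered distributions
(it converges whenever `L` is uniformly discrete, see `summable_delta_corner` for corners). -/
def diracComb {d : ℕ} (L : Set (Euc d)) : 𝓢'(Euc d, ℂ) :=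
  ∑' z : L, TemperedDistribution.delta (z : Euc d)

/-- Inverse powers of the norm are summable over a corner. -/
theorem summable_corner_inv_pow {d : ℕ} (A : Matrix (Fin d) (Fin d) ℝ) (hA : A.det ≠ 0)
    (x : Euc d) : ∃ N : ℕ, Summable fun z : corner A x => ‖(z : Euc d)‖⁻¹ ^ N := by
  classical
  let e : (Fin d → ℝ) ≃ₗ[ℝ] Euc d :=
    (A.toLinearEquiv' (A.invertibleOfIsUnitDet (isUnit_iff_ne_zero.2 hA))).trans
      (WithLp.linearEquiv 2 ℝ (Fin d → ℝ)).symm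
  have he : ∀ v, e v = WithLp.toLp 2 (A *ᵥ v) := fun v => rfl
  let b : Module.Basis (Fin d) ℝ (Euc d) := (Pi.basisFun ℝ (Fin d)).map e
  let S : Submodule ℤ (Euc d) := Submodule.span ℤ (Set.range b)
  have hmem : ∀ w : corner A x, (w : Euc d) + x ∈ S := by
    rintro ⟨_, n, rfl⟩
    have h1 : WithLp.toLp 2 (A *ᵥ fun i => (n i : ℝ)) = ∑ i, (n i : ℤ) • b i := by
      rw [← he, ← (Pi.basisFun ℝ (Fin d)).sum_repr (fun i => (n i : ℝ)), map_sum]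
      refine Finset.sum_congr rfl fun i _ => ?_
      simp [b, ← Nat.cast_smul_eq_nsmul ℝ]
    simp only [sub_add_cancel, h1]
    exact Submodule.sum_mem _ fun i _ => S.smul_mem _ (Submodule.subset_span ⟨i, rfl⟩)
  refine ⟨Module.finrank ℤ S + 1, ?_⟩
  have h := (ZLattice.summable_norm_sub_inv_pow S (Module.finrank ℤ S + 1)
    (Nat.lt_succ_self _) x)
  have hinj : Function.Injective fun w : corner A x => (⟨(w : Euc d) + x, hmem w⟩ : S) := by
    intro v w hvw
    exact Subtype.ext (add_right_cancel (congrArg Subtype.val hvw))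
  exact (h.comp_injective hinj).congr fun w => by simp

/-- The generalized Dirac comb of a corner converges in the space of tempered distributions. -/
theorem summable_delta_corner {d : ℕ} (A : Matrix (Fin d) (Fin d) ℝ) (hA : A.det ≠ 0)
    (x : Euc d) :
    Summable fun z : corner A x => TemperedDistribution.delta (z : Euc d) := by
  classical
  obtain ⟨N, hN⟩ := summable_corner_inv_pow A hA x
  let h : corner A x → ℝ := fun z => ‖(z : Euc d)‖⁻¹ ^ N + if (z : Euc d) = 0 then 1 else 0
  have hh : Summable h := by
    refine hN.add (summable_of_hasFiniteSupport ?_)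
    refine Set.Finite.subset (Set.Finite.preimage Subtype.val_injective.injOn
      (Set.finite_singleton (0 : Euc d))) ?_
    intro z hz
    by_contra hne
    exact hz (if_neg hne)
  have hb : ∀ (φ : 𝓢(Euc d, ℂ)) (z : corner A x), ‖φ z‖ ≤
      (2 * ({(0, 0), (N, 0)} : Finset (ℕ × ℕ)).sup (schwartzSeminormFamily ℂ (Euc d) ℂ) φ)
        * h z := by
    intro φ z
    set p := ({(0, 0), (N, 0)} : Finset (ℕ × ℕ)).sup (schwartzSeminormFamily ℂ (Euc d) ℂ)
    have h0 : ‖φ z‖ ≤ p φ := (SchwartzMap.norm_le_seminorm ℂ φ z).trans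
      (Finset.le_sup (f := schwartzSeminormFamily ℂ (Euc d) ℂ)
        (show ((0, 0) : ℕ × ℕ) ∈ ({(0, 0), (N, 0)} : Finset (ℕ × ℕ)) by simp) φ)
    have h1 : ‖(z : Euc d)‖ ^ N * ‖φ z‖ ≤ p φ := (SchwartzMap.norm_pow_mul_le_seminorm ℂ φ N z).trans
      (Finset.le_sup (f := schwartzSeminormFamily ℂ (Euc d) ℂ)
        (show ((N, 0) : ℕ × ℕ) ∈ ({(0, 0), (N, 0)} : Finset (ℕ × ℕ)) by simp) φ)
    have hp : 0 ≤ p φ := (norm_nonneg _).trans h0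
    by_cases hz : (z : Euc d) = 0
    · have : 1 ≤ h z := by
        simp only [h, if_pos hz]
        linarith [show 0 ≤ ‖(z : Euc d)‖⁻¹ ^ N by positivity]
      nlinarith
    · have hpos : 0 < ‖(z : Euc d)‖ ^ N := pow_pos (norm_pos_iff.2 hz) N
      have h2 : ‖φ z‖ ≤ p φ * ‖(z : Euc d)‖⁻¹ ^ N := by
        rw [inv_pow, ← div_eq_mul_inv, le_div_iff₀ hpos, mul_comm]
        exact h1
      simp only [h, if_neg hz, add_zero]
      nlinarith [show 0 ≤ p φ * ‖(z : Euc d)‖⁻¹ ^ N by positivity]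
  have hs : ∀ φ : 𝓢(Euc d, ℂ), Summable fun z : corner A x => φ z := fun φ =>
    Summable.of_norm_bounded (hh.mul_left _) (hb φ)
  let T : 𝓢(Euc d, ℂ) →L[ℂ] ℂ := SchwartzMap.mkCLMtoNormedSpace
    (fun φ => ∑' z : corner A x, φ z)
    (fun φ ψ => (hs φ).tsum_add (hs ψ))
    (fun a φ => tsum_mul_left)
    ⟨{(0, 0), (N, 0)}, 2 * ∑' z, h z,
      mul_nonneg zero_le_two (tsum_nonneg fun z => by
        simp only [h]; split_ifs <;> positivity),
      fun φ => by
        refine (tsum_of_norm_bounded ((hh.mul_left _).hasSum) (hb φ)).trans (le_of_eq ?_)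
        rw [tsum_mul_left]
        ring⟩
  refine ⟨ContinuousLinearMap.toPointwiseConvergenceCLM _ _ _ _ T, ?_⟩
  refine PointwiseConvergenceCLM.tendsto_iff_forall_tendsto.2 fun φ => ?_
  have := (hs φ).hasSum
  refine Filter.Tendsto.congr (fun s => ?_) this
  exact (map_sum (PointwiseConvergenceCLM.evalCLM (RingHom.id ℂ) ℂ φ)
    (fun z : corner A x => TemperedDistribution.delta (z : Euc d)) s).symm

/-- The form factor of `L`: the Fourier transform of its generalized Dirac comb. -/
def formFactor {d : ℕ} (L : Set (Euc d)) : 𝓢'(Euc d, ℂ) := 𝓕 (diracComb L)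

/-- The singular support: `y` lies outside of it iff, on some open neighbourhood `U` of `y`, the
distribution is given by integration against a function that is smooth on `U`. -/
def singularSupport {d : ℕ} (u : 𝓢'(Euc d, ℂ)) : Set (Euc d) :=
  {y | ∃ U : Set (Euc d), IsOpen U ∧ y ∈ U ∧ ∃ f : Euc d → ℂ, ContDiffOn ℝ ∞ f U ∧
    ∀ φ : 𝓢(Euc d, ℂ), HasCompactSupport φ → tsupport φ ⊆ U → u φ = ∫ z, f z * φ z}ᶜ

/-- `u` has order at most `k`: it is continuous for the seminorms
`sup_z |z|^m |D^n φ(z)|` with `n ≤ k` (and `m` arbitrary). Every tempered distribution satisfies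
this for some `k`. -/
def HasOrderLE {d : ℕ} (u : 𝓢'(Euc d, ℂ)) (k : ℕ) : Prop :=
  ∃ (m : ℕ) (C : ℝ), ∀ φ : 𝓢(Euc d, ℂ),
    ‖u φ‖ ≤ C * ((Finset.Iic (m, k)).sup (schwartzSeminormFamily ℂ (Euc d) ℂ)) φ

/-- The space `𝓢^k` of `k` times continuously differentiable functions with superalgebraic decay
of all derivatives up to order `k`. -/
def MemSk {d : ℕ} (k : ℕ) (g : Euc d → ℂ) : Prop :=
  ContDiff ℝ k g ∧
    ∀ m n : ℕ, n ≤ k → ∃ C : ℝ, ∀ z, ‖z‖ ^ m * ‖iteratedFDeriv ℝ n g z‖ ≤ C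

/-- Convergence of a sequence of Schwartz functions to `g` in the topology of `𝓢^k`. -/
def TendstoSk {d : ℕ} (k : ℕ) (φ : ℕ → 𝓢(Euc d, ℂ)) (g : Euc d → ℂ) : Prop :=
  ∀ m n : ℕ, n ≤ k → ∀ ε : ℝ, 0 < ε → ∀ᶠ j in Filter.atTop, ∀ z,
    ‖z‖ ^ m * ‖iteratedFDeriv ℝ n (fun w => φ j w - g w) z‖ ≤ ε

/-- For `u` of order at most `k` and `g ∈ 𝓢^k`: the convolution `(u ∗ g)(y)` has the value `c`.
Here `(u ∗ g)(y) = u(g(y - ·))`, where `u` is extended by continuity from Schwartz functions to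
`𝓢^k`; since `u` has order at most `k`, the limit does not depend on the approximating sequence. -/
def HasConvolutionAt {d : ℕ} (k : ℕ) (u : 𝓢'(Euc d, ℂ)) (g : Euc d → ℂ) (y : Euc d) (c : ℂ) :
    Prop :=
  HasOrderLE u k ∧ MemSk k g ∧ ∃ φ : ℕ → 𝓢(Euc d, ℂ),
    TendstoSk k φ (fun z => g (y - z)) ∧ Filter.Tendsto (fun j => u (φ j)) Filter.atTop (𝓝 c)

/-- `C` is the meromorphic continuation to the whole plane of
`ν ↦ (u ∗ G_{d-ν}(l ·))(y)`, which is defined for `Re ν > d + k` if `u` has order at most `k`. -/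
def IsContinuedConvolution {d : ℕ} (u : 𝓢'(Euc d, ℂ)) (l : ℝ) (y : Euc d) (C : ℂ → ℂ) : Prop :=
  MeromorphicOn C Set.univ ∧
    ∀ k : ℕ, HasOrderLE u k → ∀ ν : ℂ, (d : ℝ) + k < ν.re →
      HasConvolutionAt k u (fun z => crandallG (d - ν) (l • z)) y (C ν)

/-- The set `d - ℕ₀` in the complex plane. -/
def hadamardPoles (d : ℕ) : Set ℂ := {ν | ∃ n : ℕ, ν = (d : ℂ) - n}

/-- The set `(d - ℕ₀) \ (-2 ℕ₀)` in the complex plane. -/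
def zetaPoles (d : ℕ) : Set ℂ := hadamardPoles d \ {ν | ∃ m : ℕ, ν = -2 * (m : ℂ)}

end

/-! Singular support. Formally the form factor is `exp(2πi ξ·x)` times the product over `i` of the
geometric sums `(1 - exp(-2πi (Aᵀξ)_i))⁻¹`, which is smooth as long as no component of `Aᵀξ` is an
integer. The geometric series does not converge on the unit circle, so it is Abel-regularized by
factors `q ^ n i`. Against test functions supported away from the hyperplanes, dominated convergence
as `q → 1⁻` identifies the distribution with that function (`singularSupport_formFactor_corner`).

Continuation. As in Riemann's treatment of zeta, `Γℝ(ν) Z(ν)` is the Mellin transform at `ν/2` of a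
Gaussian sum over the nonzero points. Instead of a theta transformation formula, an asymptotic
expansion of the Gaussian sum at `0+` is used (`exists_expansion_cornerTheta`). A Gaussian is a
superposition of plane waves along `ℝ^d + iη`; if `Aᵀη = (1, …, 1)`, these waves decay geometrically
along the corner, and the sum over `n` becomes a product of geometric factors under the integral
(`cornerTheta_sq_eq_integral`). After scaling by `t = √τ`, each factor times `t` has an expansion in
powers of `t` with polynomially bounded coefficients. The powers `τ^((k-d)/2)` give at most simple
poles at `ν = d - k`, and the zeros of `1/Γℝ` at `-2ℕ₀` cancel those lying there.

Crandall representation. In each term the Mellin integral is split into two parts. The upper part is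
`G_ν(z/λ)` (`crandallG_eq_mellin`). For the lower part, `G_{d-ν}(λ(y - ·))` is a mixture over `t ∈
(0, 1]` of dilated Gaussians, whose Fourier transform at `z` is `λ^(-d)` times the plane wave times
the lower part (`fourier_dilationMixture_gaussian`). Cutting off the weight near `t = 0` gives
Schwartz approximations in `𝓢^k`, so the convolution equals the sum of these transforms when `Re ν >
d + k` (`hasConvolutionAt_formFactor_corner`). Elsewhere the continued convolution is obtained by
solving the claimed formula for it, which yields a meromorphic function with the right values. -/

open MeasureTheory Filter

/-! ### Enumeration of the corner and convergence of sums over it. -/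

/-- The point `A n - x` of the corner. -/
noncomputable def cornerPt {d : ℕ} (A : Matrix (Fin d) (Fin d) ℝ) (x : Euc d) (n : Fin d → ℕ) :
    Euc d :=
  WithLp.toLp 2 (A *ᵥ fun i => (n i : ℝ)) - x

theorem cornerPt_injective {d : ℕ} {A : Matrix (Fin d) (Fin d) ℝ} (hA : A.det ≠ 0)
    (x : Euc d) : Function.Injective (cornerPt A x) := by
  intro n m h
  have h1 := sub_left_injective h
  have h2 : A *ᵥ (fun i => (n i : ℝ)) = A *ᵥ fun i => (m i : ℝ) :=
    (WithLp.toLp_injective 2) h1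
  have h3 := Matrix.mulVec_injective_iff_isUnit.2
    ((Matrix.isUnit_iff_isUnit_det A).2 (isUnit_iff_ne_zero.2 hA)) h2
  funext i
  exact_mod_cast congrFun h3 i

/-- The corner is enumerated by `ℕ₀^d`. -/
noncomputable def cornerEquiv {d : ℕ} {A : Matrix (Fin d) (Fin d) ℝ} (hA : A.det ≠ 0)
    (x : Euc d) : (Fin d → ℕ) ≃ corner A x :=
  Equiv.ofInjective (cornerPt A x) (cornerPt_injective hA x)

theorem cornerEquiv_coe {d : ℕ} {A : Matrix (Fin d) (Fin d) ℝ} (hA : A.det ≠ 0)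
    (x : Euc d) (n : Fin d → ℕ) : (cornerEquiv hA x n : Euc d) = cornerPt A x n := rfl

instance countable_corner {d : ℕ} (A : Matrix (Fin d) (Fin d) ℝ) (x : Euc d) :
    Countable (corner A x) := (Set.countable_range _).to_subtype

/-- Translation by `x` embeds the corner in the lattice spanned by the columns of `A`, which has
rank `d`. The sharp threshold `d < r` is what yields absolute convergence of the zeta series for `Re
ν > d`. -/
theorem summable_corner_rpow {d : ℕ} {A : Matrix (Fin d) (Fin d) ℝ} (hA : A.det ≠ 0)
    (x : Euc d) {r : ℝ} (hr : (d : ℝ) < r) :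
    Summable fun z : corner A x => ‖(z : Euc d)‖ ^ (-r) := by
  classical
  let e : (Fin d → ℝ) ≃ₗ[ℝ] Euc d :=
    (A.toLinearEquiv' (A.invertibleOfIsUnitDet (isUnit_iff_ne_zero.2 hA))).trans
      (WithLp.linearEquiv 2 ℝ (Fin d → ℝ)).symm
  have he : ∀ v, e v = WithLp.toLp 2 (A *ᵥ v) := fun v => rfl
  let b : Module.Basis (Fin d) ℝ (Euc d) := (Pi.basisFun ℝ (Fin d)).map e
  let S : Submodule ℤ (Euc d) := Submodule.span ℤ (Set.range b)
  have hmem : ∀ w : corner A x, (w : Euc d) + x ∈ S := by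
    rintro ⟨_, n, rfl⟩
    have h1 : WithLp.toLp 2 (A *ᵥ fun i => (n i : ℝ)) = ∑ i, (n i : ℤ) • b i := by
      rw [← he, ← (Pi.basisFun ℝ (Fin d)).sum_repr (fun i => (n i : ℝ)), map_sum]
      refine Finset.sum_congr rfl fun i _ => ?_
      simp [b, ← Nat.cast_smul_eq_nsmul ℝ]
    simp only [sub_add_cancel, h1]
    exact Submodule.sum_mem _ fun i _ => S.smul_mem _ (Submodule.subset_span ⟨i, rfl⟩)
  have hrank : Module.finrank ℤ S = d := by
    rw [ZLattice.rank ℝ S]; simp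
  have h := ZLattice.summable_norm_sub_rpow S (-r) (by rw [hrank]; linarith) x
  have hinj : Function.Injective fun w : corner A x => (⟨(w : Euc d) + x, hmem w⟩ : S) := by
    intro v w hvw
    exact Subtype.ext (add_right_cancel (congrArg Subtype.val hvw))
  exact (h.comp_injective hinj).congr fun w => by simp

/-- A function on the corner bounded by an inverse power of the norm off the origin is summable. -/
theorem summable_corner_of_le {d : ℕ} {A : Matrix (Fin d) (Fin d) ℝ} (hA : A.det ≠ 0)
    (x : Euc d) {r C : ℝ} (hr : (d : ℝ) < r) {E : Type*} [NormedAddCommGroup E] [CompleteSpace E]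
    {f : corner A x → E}
    (hf : ∀ z : corner A x, (z : Euc d) ≠ 0 → ‖f z‖ ≤ C * ‖(z : Euc d)‖ ^ (-r)) :
    Summable f := by
  refine Summable.of_norm_bounded_eventually ((summable_corner_rpow hA x hr).mul_left C) ?_
  refine Set.Finite.subset (Set.Finite.preimage Subtype.val_injective.injOn
      (Set.finite_singleton (0 : Euc d))) ?_
  intro z hz
  by_contra h
  exact hz (hf z h)

/-- A convergent series of nonnegative terms bounds each of them, so nonzero points cannot come
arbitrarily close to the origin. The gap forces exponential decay of the punctured Gaussian sum. -/
theorem exists_norm_lower_bound_corner {d : ℕ} {A : Matrix (Fin d) (Fin d) ℝ} (hA : A.det ≠ 0)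
    (x : Euc d) : ∃ ρ : ℝ, 0 < ρ ∧ ∀ z : corner A x, (z : Euc d) ≠ 0 → ρ ≤ ‖(z : Euc d)‖ := by
  have hs := summable_corner_rpow hA x (lt_add_one (d : ℝ))
  set B := ∑' z : corner A x, ‖(z : Euc d)‖ ^ (-((d : ℝ) + 1)) with hB
  have hB0 : 0 ≤ B := tsum_nonneg fun z => by positivity
  refine ⟨(B + 1) ^ (-((d : ℝ) + 1)⁻¹), by positivity, fun z hz => ?_⟩
  have h1 : ‖(z : Euc d)‖ ^ (-((d : ℝ) + 1)) ≤ B + 1 :=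
    (hs.le_tsum z fun _ _ => by positivity).trans (by linarith)
  have hz0 : 0 < ‖(z : Euc d)‖ := norm_pos_iff.2 hz
  have hd : (0 : ℝ) < d + 1 := by positivity
  have h2 := Real.rpow_le_rpow_of_nonpos (by positivity) h1
    (show -((d : ℝ) + 1)⁻¹ ≤ 0 by simpa using hd.le)
  rwa [← Real.rpow_mul hz0.le, neg_mul_neg, mul_inv_cancel₀ hd.ne', Real.rpow_one] at h2

theorem exists_exp_neg_mul_sq_le (c r : ℝ) (hc : 0 < c) (hr : 0 ≤ r) :
    ∃ C : ℝ, 0 ≤ C ∧ ∀ s : ℝ, 0 < s → Real.exp (-c * s ^ 2) ≤ C * s ^ (-r) := by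
  obtain ⟨k, hk⟩ := exists_nat_ge r
  have key : ∀ s : ℝ, 0 < s → Real.exp (-c * s ^ 2) * s ^ (2 * k) ≤ k.factorial / c ^ k := by
    intro s hs
    have h := Real.pow_div_factorial_le_exp (x := c * s ^ 2) (by positivity) k
    rw [neg_mul, Real.exp_neg, inv_mul_eq_div, div_le_div_iff₀ (Real.exp_pos _) (by positivity)]
    rw [div_le_iff₀ (by positivity)] at h
    calc s ^ (2 * k) * c ^ k = (c * s ^ 2) ^ k := by rw [mul_pow, pow_mul]; ring
      _ ≤ _ := by linarith
  -- The first summand serves `s ≥ 1`, where `s ^ r ≤ s ^ (2k)`; the summand `1` serves `s ≤ 1`.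
  refine ⟨k.factorial / c ^ k + 1, by positivity, fun s hs => ?_⟩
  rw [Real.rpow_neg hs.le, ← div_eq_mul_inv, le_div_iff₀ (by positivity)]
  have he : 0 < Real.exp (-c * s ^ 2) := Real.exp_pos _
  have he1 : Real.exp (-c * s ^ 2) ≤ 1 := Real.exp_le_one_iff.2 (by nlinarith [sq_nonneg s])
  rcases le_total s 1 with h1 | h1
  · have : s ^ r ≤ 1 := Real.rpow_le_one hs.le h1 hr
    have : (0 : ℝ) ≤ k.factorial / c ^ k := by positivity
    nlinarith
  · have h2 : s ^ r ≤ s ^ (2 * k) := by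
      rw [← Real.rpow_natCast]
      refine Real.rpow_le_rpow_of_exponent_le h1 ?_
      push_cast; linarith
    calc _ ≤ Real.exp (-c * s ^ 2) * s ^ (2 * k) := by gcongr
      _ ≤ _ := by linarith [key s hs]

theorem summable_corner_gaussian {d : ℕ} {A : Matrix (Fin d) (Fin d) ℝ} (hA : A.det ≠ 0)
    (x : Euc d) {c : ℝ} (hc : 0 < c) :
    Summable fun z : corner A x => Real.exp (-c * ‖(z : Euc d)‖ ^ 2) := by
  obtain ⟨C, -, hC⟩ := exists_exp_neg_mul_sq_le c (d + 1) hc (by positivity)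
  refine summable_corner_of_le hA x (lt_add_one (d : ℝ)) (C := C) fun z hz => ?_
  rw [Real.norm_of_nonneg (Real.exp_pos _).le]
  exact hC _ (norm_pos_iff.2 hz)

theorem hasSum_diracComb_corner {d : ℕ} {A : Matrix (Fin d) (Fin d) ℝ} (hA : A.det ≠ 0)
    (x : Euc d) (φ : 𝓢(Euc d, ℂ)) :
    HasSum (fun z : corner A x => φ z) (diracComb (corner A x) φ) := by
  have h := (summable_delta_corner A hA x).hasSum
  exact h.map (PointwiseConvergenceCLM.evalCLM (RingHom.id ℂ) ℂ φ)
    (ContinuousLinearMap.continuous _)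

theorem hasSum_formFactor_corner {d : ℕ} {A : Matrix (Fin d) (Fin d) ℝ} (hA : A.det ≠ 0)
    (x : Euc d) (φ : 𝓢(Euc d, ℂ)) :
    HasSum (fun z : corner A x => 𝓕 (φ : Euc d → ℂ) z) (formFactor (corner A x) φ) := by
  have h := hasSum_diracComb_corner hA x (𝓕 φ)
  simp only [SchwartzMap.fourier_coe] at h
  exact h

/-! ### The singular support of the form factor, by Abel summation. -/

/-- The geometric series in several variables. -/
theorem hasSum_pi_geometric {d : ℕ} (r : Fin d → ℂ) (hr : ∀ i, ‖r i‖ < 1) :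
    (Summable fun n : Fin d → ℕ => ‖∏ i, r i ^ n i‖) ∧
      HasSum (fun n : Fin d → ℕ => ∏ i, r i ^ n i) (∏ i, (1 - r i)⁻¹) := by
  induction d with
  | zero =>
    refine ⟨Summable.of_finite, ?_⟩
    simp
  | succ d ih =>
    obtain ⟨h1, h2⟩ := ih (fun i => r i.succ) fun i => hr i.succ
    have g1 : Summable fun m : ℕ => ‖r 0 ^ m‖ := by
      simpa using summable_geometric_of_lt_one (norm_nonneg _) (hr 0)
    have g2 := hasSum_geometric_of_norm_lt_one (hr 0)
    have hs : Summable fun p : ℕ × (Fin d → ℕ) => ‖r 0 ^ p.1 * ∏ i, r i.succ ^ p.2 i‖ :=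
      Summable.mul_norm (f := fun m : ℕ => r 0 ^ m)
        (g := fun n : Fin d → ℕ => ∏ i, r i.succ ^ n i) g1 h1
    have hm := g2.mul h2 hs.of_norm
    let e := (Fin.consEquiv fun _ : Fin (d + 1) => ℕ)
    constructor
    · rw [← e.summable_iff]
      refine hs.congr fun p => ?_
      simp [e, Fin.prod_univ_succ, Fin.consEquiv]
    · rw [← e.hasSum_iff, Fin.prod_univ_succ]
      refine hm.congr_fun fun p => ?_
      simp [e, Fin.prod_univ_succ, Fin.consEquiv]

theorem inner_cornerPt {d : ℕ} (A : Matrix (Fin d) (Fin d) ℝ) (x y : Euc d) (n : Fin d → ℕ) :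
    inner ℝ y (cornerPt A x n) = ∑ i, (Aᵀ *ᵥ y.ofLp) i * n i - inner ℝ y x := by
  rw [cornerPt, inner_sub_right]
  congr 1
  rw [EuclideanSpace.inner_eq_star_dotProduct]
  simp only [star_trivial]
  rw [dotProduct_comm, Matrix.dotProduct_mulVec, ← Matrix.mulVec_transpose]
  rfl

theorem norm_planeWave {d : ℕ} (y z : Euc d) : ‖planeWave y z‖ = 1 := by
  rw [planeWave, show -2 * (Real.pi : ℂ) * Complex.I * (inner ℝ y z : ℝ) =
    ((-2 * Real.pi * inner ℝ y z : ℝ) : ℂ) * Complex.I by push_cast; ring]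
  exact Complex.norm_exp_ofReal_mul_I _

/-- The phase `exp (-2 π i (Aᵀ y)_j)`. -/
noncomputable def cornerPhase {d : ℕ} (A : Matrix (Fin d) (Fin d) ℝ) (y : Euc d) (i : Fin d) : ℂ :=
  Complex.exp (-2 * Real.pi * Complex.I * ((Aᵀ *ᵥ y.ofLp) i : ℝ))

theorem norm_cornerPhase {d : ℕ} (A : Matrix (Fin d) (Fin d) ℝ) (y : Euc d) (i : Fin d) :
    ‖cornerPhase A y i‖ = 1 := by
  rw [cornerPhase, show -2 * (Real.pi : ℂ) * Complex.I * ((Aᵀ *ᵥ y.ofLp) i : ℝ) =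
    ((-2 * Real.pi * (Aᵀ *ᵥ y.ofLp) i : ℝ) : ℂ) * Complex.I by push_cast; ring]
  exact Complex.norm_exp_ofReal_mul_I _

theorem planeWave_cornerPt {d : ℕ} (A : Matrix (Fin d) (Fin d) ℝ) (x y : Euc d)
    (n : Fin d → ℕ) :
    planeWave y (cornerPt A x n) = planeWave y (-x) * ∏ i, cornerPhase A y i ^ n i := by
  simp only [planeWave, cornerPhase, ← Complex.exp_nat_mul, ← Complex.exp_sum, ← Complex.exp_add,
    inner_cornerPt, inner_neg_right]
  congr 1
  push_cast
  rw [mul_sub, Finset.mul_sum, mul_neg, neg_add_eq_sub]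
  congr 1
  exact Finset.sum_congr rfl fun i _ => by ring

theorem continuous_transpose_mulVec {d : ℕ} (A : Matrix (Fin d) (Fin d) ℝ) (i : Fin d) :
    Continuous fun y : Euc d => (Aᵀ *ᵥ y.ofLp) i := by
  simp only [Matrix.mulVec, dotProduct]
  fun_prop

theorem contDiff_cornerPhase {d : ℕ} (A : Matrix (Fin d) (Fin d) ℝ) (i : Fin d) :
    ContDiff ℝ ∞ fun y : Euc d => cornerPhase A y i := by
  have h : ContDiff ℝ ∞ fun y : Euc d => (Aᵀ *ᵥ y.ofLp) i := by
    simp only [Matrix.mulVec, dotProduct]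
    fun_prop
  unfold cornerPhase
  exact (contDiff_const.mul (Complex.ofRealCLM.contDiff.comp h)).cexp

theorem contDiff_planeWave {d : ℕ} (z : Euc d) :
    ContDiff ℝ ∞ fun y : Euc d => planeWave y z := by
  have h : ContDiff ℝ ∞ fun y : Euc d => (inner ℝ y z : ℝ) := contDiff_id.inner ℝ contDiff_const
  unfold planeWave
  exact (contDiff_const.mul (Complex.ofRealCLM.contDiff.comp h)).cexp

theorem cornerPhase_ne_one {d : ℕ} {A : Matrix (Fin d) (Fin d) ℝ} {y : Euc d} {i : Fin d}
    (h : ∀ n : ℤ, (Aᵀ *ᵥ y.ofLp) i ≠ n) : cornerPhase A y i ≠ 1 := by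
  intro h1
  obtain ⟨n, hn⟩ := Complex.exp_eq_one_iff.1 h1
  refine h (-n) ?_
  have h2 : (2 * (Real.pi : ℂ) * Complex.I) ≠ 0 := Complex.two_pi_I_ne_zero
  have h3 : (((Aᵀ *ᵥ y.ofLp) i : ℝ) : ℂ) = -n := by
    apply mul_left_cancel₀ h2
    linear_combination -hn
  exact_mod_cast h3

/-- The points `q e` and `e` are `1 - q` apart, and `1 - q ≤ ‖1 - q e‖`. This makes the regularized
factors `(1 - q e)⁻¹` bounded by `2 ‖1 - e‖⁻¹` uniformly in `q`, which supplies the dominating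
function for `q → 1`. -/
theorem norm_one_sub_le_two_mul {q : ℝ} (hq0 : 0 ≤ q) (hq1 : q ≤ 1) {e : ℂ} (he : ‖e‖ = 1) :
    ‖1 - e‖ ≤ 2 * ‖1 - q * e‖ := by
  have h1 : ‖1 - e‖ ≤ ‖1 - q * e‖ + ‖q * e - e‖ := by
    simpa using norm_add_le (1 - q * e) (q * e - e)
  have h2 : ‖q * e - e‖ = 1 - q := by
    rw [show q * e - e = ((q - 1 : ℝ) : ℂ) * e by push_cast; ring, norm_mul, he, mul_one,
      Complex.norm_real, Real.norm_of_nonpos (by linarith)]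
    ring
  have h3 : 1 - q ≤ ‖1 - q * e‖ := by
    have := norm_sub_norm_le (1 : ℂ) (q * e)
    rwa [norm_one, norm_mul, he, mul_one, Complex.norm_real, Real.norm_of_nonneg hq0] at this
  linarith

theorem fourier_eq_integral_planeWave {d : ℕ} (f : Euc d → ℂ) (z : Euc d) :
    𝓕 f z = ∫ v, planeWave v z * f v := by
  rw [Real.fourier_eq']
  refine integral_congr_ae (ae_of_all _ fun v => ?_)
  simp only [planeWave, smul_eq_mul]
  congr 2
  push_cast
  ring

/-- The form factor of the corner after Abel summation with parameter `q < 1`. -/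
theorem hasSum_abel_fourier_corner {d : ℕ} (A : Matrix (Fin d) (Fin d) ℝ) (x : Euc d)
    (φ : 𝓢(Euc d, ℂ)) {q : ℝ} (hq0 : 0 ≤ q) (hq1 : q < 1) :
    HasSum (fun n : Fin d → ℕ => (∏ i, (q : ℂ) ^ n i) * 𝓕 (φ : Euc d → ℂ) (cornerPt A x n))
      (∫ v, (∏ i, (1 - q * cornerPhase A v i)⁻¹) * (planeWave v (-x) * φ v)) := by
  have hg : ∀ v : Euc d, _ := fun v => hasSum_pi_geometric (fun i => q * cornerPhase A v i)
    (fun i => by rw [norm_mul, norm_cornerPhase, mul_one, Complex.norm_real,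
      Real.norm_of_nonneg hq0]; exact hq1)
  have hq := (hasSum_pi_geometric (fun _ : Fin d => (q : ℂ))
    (fun i => by rwa [Complex.norm_real, Real.norm_of_nonneg hq0])).1
  let F : (Fin d → ℕ) → Euc d → ℂ := fun n v =>
    (∏ i, (q * cornerPhase A v i) ^ n i) * (planeWave v (-x) * φ v)
  -- All phases are unimodular, so the norms split into a convergent geometric series in `q` times
  -- `‖φ v‖`; this justifies exchanging sum and integral.
  have hFn : ∀ n v, ‖F n v‖ = ‖∏ i, (q : ℂ) ^ n i‖ * ‖φ v‖ := by
    intro n v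
    simp only [F, norm_mul, norm_planeWave, one_mul, norm_prod, norm_pow, norm_cornerPhase,
      mul_one]
  have hcont : ∀ n, Continuous (F n) := by
    intro n
    refine (continuous_finsetProd _ fun i _ => ?_).mul
      ((contDiff_planeWave (-x)).continuous.mul φ.continuous)
    exact (continuous_const.mul (contDiff_cornerPhase A i).continuous).pow _
  have hFi : ∀ n, Integrable (F n) := fun n =>
    (φ.integrable.norm.const_mul ‖∏ i, (q : ℂ) ^ n i‖).mono'
      (hcont n).aestronglyMeasurable (ae_of_all _ fun v => (hFn n v).le)
  have key := hasSum_integral_of_summable_integral_norm hFi (by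
    simp only [hFn, integral_const_mul]
    exact hq.mul_right _)
  convert! key using 1
  · funext n
    rw [fourier_eq_integral_planeWave, ← integral_const_mul]
    refine integral_congr_ae (ae_of_all _ fun v => ?_)
    simp only [F, planeWave_cornerPt, mul_pow, Finset.prod_mul_distrib]
    ring
  · refine integral_congr_ae (ae_of_all _ fun v => ?_)
    exact (((hg v).2.mul_right _).tsum_eq).symm

theorem singularSupport_formFactor_corner {d : ℕ} {A : Matrix (Fin d) (Fin d) ℝ}
    (hA : A.det ≠ 0) (x : Euc d) :
    singularSupport (formFactor (corner A x)) ⊆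
      {y : Euc d | ∃ (i : Fin d) (n : ℤ), (Aᵀ *ᵥ y.ofLp) i = n} := by
  rw [singularSupport, Set.compl_subset_comm]
  intro y hy
  let U : Set (Euc d) := {y : Euc d | ∃ (i : Fin d) (n : ℤ), (Aᵀ *ᵥ y.ofLp) i = n}ᶜ
  have hU : U = ⋂ i : Fin d, (fun y : Euc d => (Aᵀ *ᵥ y.ofLp) i) ⁻¹'
      (Set.range ((↑) : ℤ → ℝ))ᶜ := by
    ext v
    simp [U, eq_comm]
  have hUo : IsOpen U := by
    rw [hU]
    exact isOpen_iInter_of_finite fun i =>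
      (Int.isClosedEmbedding_coe_real.isClosed_range.isOpen_compl).preimage
        (continuous_transpose_mulVec A i)
  have hne : ∀ v ∈ U, ∀ i, (1 - cornerPhase A v i) ≠ 0 := by
    intro v hv i
    refine sub_ne_zero.2 (cornerPhase_ne_one fun n hn => hv ⟨i, n, hn⟩).symm
  let f : Euc d → ℂ := fun v => (∏ i, (1 - cornerPhase A v i)⁻¹) * planeWave v (-x)
  have hf : ContDiffOn ℝ ∞ f U := by
    refine (contDiffOn_prod fun i _ => ?_).mul (contDiff_planeWave (-x)).contDiffOn
    exact (contDiff_const.sub (contDiff_cornerPhase A i)).contDiffOn.inv fun v hv => hne v hv i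
  refine ⟨U, hUo, hy, f, hf, fun φ hφ hφU => ?_⟩
  have hφ0 : ∀ v ∉ U, φ v = 0 := fun v hv => image_eq_zero_of_notMem_tsupport fun h => hv (hφU h)
  -- `f` need not be continuous off `U`, but `φ` vanishes near every point there, so the product is
  -- continuous everywhere.
  have hint : Integrable fun v => f v * φ v := by
    refine Continuous.integrable_of_hasCompactSupport ?_ hφ.mul_left
    refine continuous_of_tsupport fun v hv => ?_
    have hv' : v ∈ U := hφU (closure_mono (Function.support_mul_subset_right _ _) hv)
    exact (hf.continuousOn.continuousAt (hUo.mem_nhds hv')).mul φ.continuous.continuousAt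
  have hsum := (cornerEquiv hA x).hasSum_iff.2 (hasSum_formFactor_corner hA x φ)
  have hq : ∀ᶠ q : ℝ in 𝓝[<] 1, 0 ≤ q ∧ q < 1 := by
    filter_upwards [Ioo_mem_nhdsLT (zero_lt_one' ℝ)] with q hq using ⟨hq.1.le, hq.2⟩
  have hlim : Tendsto (fun q : ℝ => (q : ℂ)) (𝓝[<] 1) (𝓝 1) := by
    have : Tendsto (fun q : ℝ => (q : ℂ)) (𝓝 1) (𝓝 ((1 : ℝ) : ℂ)) :=
      Complex.continuous_ofReal.tendsto 1
    exact_mod_cast this.mono_left nhdsWithin_le_nhds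
  -- On the summation side the Abel factors have modulus at most `1`, and the samples of `𝓕 φ` over
  -- the corner dominate.
  have hL : Tendsto (fun q : ℝ => ∑' n : Fin d → ℕ,
      (∏ i, (q : ℂ) ^ n i) * 𝓕 (φ : Euc d → ℂ) (cornerPt A x n)) (𝓝[<] 1)
      (𝓝 (∑' n : Fin d → ℕ, 𝓕 (φ : Euc d → ℂ) (cornerPt A x n))) := by
    refine tendsto_tsum_of_dominated_convergence hsum.summable.norm (fun n => ?_) ?_
    · have : Tendsto (fun q : ℝ => ∏ i, (q : ℂ) ^ n i) (𝓝[<] 1) (𝓝 (∏ i, (1 : ℂ) ^ n i)) :=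
        tendsto_finsetProd _ fun i _ => hlim.pow _
      simpa using this.mul_const (𝓕 (φ : Euc d → ℂ) (cornerPt A x n))
    · filter_upwards [hq] with q hq n
      rw [norm_mul]
      refine mul_le_of_le_one_left (norm_nonneg _) ?_
      rw [norm_prod]
      refine Finset.prod_le_one (fun _ _ => norm_nonneg _) fun i _ => ?_
      rw [norm_pow, Complex.norm_real, Real.norm_of_nonneg hq.1]
      exact pow_le_one₀ hq.1 hq.2.le
  -- On the integral side, `norm_one_sub_le_two_mul` costs a factor `2` for each of the `d`
  -- geometric factors.
  have hR : Tendsto (fun q : ℝ => ∫ v, (∏ i, (1 - q * cornerPhase A v i)⁻¹) *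
      (planeWave v (-x) * φ v)) (𝓝[<] 1) (𝓝 (∫ v, f v * φ v)) := by
    refine tendsto_integral_filter_of_dominated_convergence (fun v => 2 ^ d * ‖f v * φ v‖) ?_ ?_
      (hint.norm.const_mul _) (ae_of_all _ fun v => ?_)
    · filter_upwards [hq] with q hq
      refine Continuous.aestronglyMeasurable ?_
      refine (continuous_finsetProd _ fun i _ => ?_).mul
        ((contDiff_planeWave (-x)).continuous.mul φ.continuous)
      refine (continuous_const.sub
        (continuous_const.mul (contDiff_cornerPhase A i).continuous)).inv₀ fun v h => ?_
      have h1 : ‖(1 : ℂ)‖ = ‖(q : ℂ) * cornerPhase A v i‖ := congrArg norm (sub_eq_zero.1 h)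
      rw [norm_one, norm_mul, norm_cornerPhase, mul_one, Complex.norm_real,
        Real.norm_of_nonneg hq.1] at h1
      linarith [hq.2]
    · filter_upwards [hq] with q hq
      refine ae_of_all _ fun v => ?_
      by_cases hv : v ∈ U
      · simp only [f, norm_mul, norm_planeWave, mul_one, norm_prod, ← mul_assoc]
        refine mul_le_mul_of_nonneg_right ?_ (norm_nonneg _)
        have : (2 : ℝ) ^ d = ∏ _i : Fin d, 2 := by simp
        rw [this, ← Finset.prod_mul_distrib]
        refine Finset.prod_le_prod (fun _ _ => norm_nonneg _) fun i _ => ?_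
        rw [norm_inv, norm_inv, ← div_eq_mul_inv]
        have h1 := norm_pos_iff.2 (hne v hv i)
        have h2 := norm_one_sub_le_two_mul hq.1 hq.2.le (norm_cornerPhase A v i)
        rw [inv_le_comm₀ (by linarith) (by positivity), inv_div]
        linarith
      · simp [hφ0 v hv]
    · by_cases hv : v ∈ U
      · simp only [f, mul_assoc]
        refine Tendsto.mul_const _ (tendsto_finsetProd _ fun i _ => ?_)
        refine Tendsto.inv₀ ?_ (hne v hv i)
        simpa using (tendsto_const_nhds (x := (1 : ℂ))).sub (hlim.mul_const (cornerPhase A v i))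
      · simp [hφ0 v hv]
  have heq : ∀ᶠ q : ℝ in 𝓝[<] 1, ∑' n : Fin d → ℕ,
      (∏ i, (q : ℂ) ^ n i) * 𝓕 (φ : Euc d → ℂ) (cornerPt A x n) =
      ∫ v, (∏ i, (1 - q * cornerPhase A v i)⁻¹) * (planeWave v (-x) * φ v) := by
    filter_upwards [hq] with q hq using (hasSum_abel_fourier_corner A x φ hq.1 hq.2).tsum_eq
  rw [← hsum.tsum_eq]
  exact tendsto_nhds_unique (hL.congr' heq) hR

/-! ### Asymptotic expansions with polynomially bounded remainders. -/

/-- Real functions of at most polynomial growth. -/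
def PolyBounded {V : Type*} [NormedAddCommGroup V] (Q : V → ℝ) : Prop :=
  ∃ (C : ℝ) (m : ℕ), 0 ≤ C ∧ ∀ v, |Q v| ≤ C * (1 + ‖v‖) ^ m

namespace PolyBounded

variable {V : Type*} [NormedAddCommGroup V] {Q R : V → ℝ}

theorem const (c : ℝ) : PolyBounded fun _ : V => c :=
  ⟨|c|, 0, abs_nonneg c, fun v => by simp⟩

theorem mono (hR : PolyBounded R) (h : ∀ v, |Q v| ≤ R v) : PolyBounded Q := by
  obtain ⟨C, m, hC, hb⟩ := hR
  exact ⟨C, m, hC, fun v => (h v).trans ((le_abs_self _).trans (hb v))⟩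

theorem add (hQ : PolyBounded Q) (hR : PolyBounded R) : PolyBounded fun v => Q v + R v := by
  obtain ⟨C, m, hC, hb⟩ := hQ
  obtain ⟨D, n, hD, hc⟩ := hR
  refine ⟨C + D, m + n, by positivity, fun v => (abs_add_le _ _).trans ?_⟩
  have h1 : (1 : ℝ) ≤ 1 + ‖v‖ := by linarith [norm_nonneg v]
  have h2 := pow_le_pow_right₀ h1 (Nat.le_add_right m n)
  have h3 := pow_le_pow_right₀ h1 (Nat.le_add_left n m)
  have h4 := mul_le_mul_of_nonneg_left h2 hC
  have h5 := mul_le_mul_of_nonneg_left h3 hD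
  linarith [hb v, hc v]

theorem mul (hQ : PolyBounded Q) (hR : PolyBounded R) : PolyBounded fun v => Q v * R v := by
  obtain ⟨C, m, hC, hb⟩ := hQ
  obtain ⟨D, n, hD, hc⟩ := hR
  refine ⟨C * D, m + n, by positivity, fun v => ?_⟩
  rw [abs_mul, pow_add, mul_mul_mul_comm]
  exact mul_le_mul (hb v) (hc v) (abs_nonneg _) (by positivity)

theorem pow (hQ : PolyBounded Q) (k : ℕ) : PolyBounded fun v => Q v ^ k := by
  induction k with
  | zero => simpa using const (V := V) 1
  | succ k ih => simpa only [pow_succ] using ih.mul hQ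

theorem sum {ι : Type*} {s : Finset ι} {Q : ι → V → ℝ} (h : ∀ i ∈ s, PolyBounded (Q i)) :
    PolyBounded fun v => ∑ i ∈ s, Q i v := by
  classical
  induction s using Finset.induction_on with
  | empty => simpa using const (V := V) 0
  | insert i s hi ih =>
    simp only [Finset.sum_insert hi]
    exact (h i (Finset.mem_insert_self i s)).add
      (ih fun j hj => h j (Finset.mem_insert_of_mem hj))

end PolyBounded

/-- `E t v` has for `t → 0+` the asymptotic expansion `∑ a_k(v) t^k`, with remainders on `(0, 1]`
of polynomial growth in `v`. -/
def HasPolyExpansion {V : Type*} [NormedAddCommGroup V] (E : ℝ → V → ℂ) (a : ℕ → V → ℂ) : Prop :=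
  ∀ N : ℕ, ∃ Q : V → ℝ, PolyBounded Q ∧ (∀ v, 0 ≤ Q v) ∧ ∀ v, ∀ t : ℝ, 0 < t → t ≤ 1 →
    ‖E t v - ∑ k ∈ Finset.range N, a k v * (t : ℂ) ^ k‖ ≤ Q v * t ^ N

namespace HasPolyExpansion

variable {V : Type*} [NormedAddCommGroup V] {E F : ℝ → V → ℂ} {a b : ℕ → V → ℂ}

/-- The remainder bounds hold up to `t = 1`, where `a k v` is the difference of two consecutive
remainders. -/
theorem polyBounded_coeff (h : HasPolyExpansion E a) (k : ℕ) :
    PolyBounded fun v => ‖a k v‖ := by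
  obtain ⟨Q, hQ, hQ0, hQb⟩ := h k
  obtain ⟨R, hR, hR0, hRb⟩ := h (k + 1)
  refine (hQ.add hR).mono fun v => ?_
  have h1 := hQb v 1 one_pos le_rfl
  have h2 := hRb v 1 one_pos le_rfl
  have h3 : a k v = (E 1 v - ∑ j ∈ Finset.range k, a j v * ((1 : ℝ) : ℂ) ^ j) -
      (E 1 v - ∑ j ∈ Finset.range (k + 1), a j v * ((1 : ℝ) : ℂ) ^ j) := by
    rw [Finset.sum_range_succ]; simp
  rw [abs_norm, h3]
  refine (norm_sub_le _ _).trans ?_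
  simp only [one_pow, mul_one] at h1 h2
  simpa using add_le_add h1 h2

theorem congr (h : HasPolyExpansion E a) (hEF : ∀ v, ∀ t : ℝ, 0 < t → t ≤ 1 → F t v = E t v) :
    HasPolyExpansion F a := fun N => by
  obtain ⟨Q, hQ, hQ0, hb⟩ := h N
  exact ⟨Q, hQ, hQ0, fun v t ht ht1 => by rw [hEF v t ht ht1]; exact hb v t ht ht1⟩

theorem one : HasPolyExpansion (fun _ (_ : V) => 1) (fun k _ => if k = 0 then 1 else 0) := by
  intro N
  refine ⟨fun _ => 1, PolyBounded.const 1, fun _ => zero_le_one, fun v t ht ht1 => ?_⟩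
  rcases N with _ | N
  · simp
  · rw [Finset.sum_range_succ']
    simp only [Nat.add_eq_zero_iff, one_ne_zero, and_false, if_false, zero_mul]
    simp only [Finset.sum_const_zero, if_true, pow_zero, mul_one, zero_add, sub_self, norm_zero]
    positivity

/-- Cauchy product. The product of the two partial sums also contains pairs of total degree at least
`N`; since `t ≤ 1`, these are absorbed into the remainder. -/
theorem mul (hE : HasPolyExpansion E a) (hF : HasPolyExpansion F b) :
    HasPolyExpansion (fun t v => E t v * F t v)
      (fun k v => ∑ p ∈ Finset.HasAntidiagonal.antidiagonal k, a p.1 v * b p.2 v) := by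
  classical
  intro N
  obtain ⟨Q, hQ, hQ0, hQb⟩ := hE N
  obtain ⟨R, hR, hR0, hRb⟩ := hF N
  obtain ⟨S, hS, hS0, hSb⟩ := hF 0
  let T : Finset (ℕ × ℕ) := Finset.range N ×ˢ Finset.range N
  have hreindex : ∀ (v : V) (t : ℂ),
      ∑ k ∈ Finset.range N, (∑ p ∈ Finset.HasAntidiagonal.antidiagonal k, a p.1 v * b p.2 v) * t ^ k =
      ∑ p ∈ T with p.1 + p.2 < N, (a p.1 v * t ^ p.1) * (b p.2 v * t ^ p.2) := by
    intro v t
    rw [← Finset.sum_fiberwise_of_maps_to (g := fun p : ℕ × ℕ => p.1 + p.2)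
      (t := Finset.range N) (fun p hp => by simpa using (Finset.mem_filter.1 hp).2)]
    refine Finset.sum_congr rfl fun k hk => ?_
    rw [Finset.sum_mul]
    refine Finset.sum_congr ?_ fun p hp => ?_
    · ext p
      simp only [Finset.HasAntidiagonal.mem_antidiagonal, Finset.mem_filter, T, Finset.mem_product,
        Finset.mem_range] at hk ⊢
      omega
    · rw [← (Finset.mem_filter.1 hp).2, pow_add]; ring
  refine ⟨fun v => Q v * S v + (∑ k ∈ Finset.range N, ‖a k v‖) * R v +
      ∑ p ∈ T with ¬ p.1 + p.2 < N, ‖a p.1 v‖ * ‖b p.2 v‖, ?_, ?_, ?_⟩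
  · exact ((hQ.mul hS).add ((PolyBounded.sum fun k _ => hE.polyBounded_coeff k).mul hR)).add
      (PolyBounded.sum fun p _ => (hE.polyBounded_coeff p.1).mul (hF.polyBounded_coeff p.2))
  · intro v
    have := hQ0 v; have := hR0 v; have := hS0 v
    positivity
  · intro v t ht ht1
    set P := ∑ k ∈ Finset.range N, a k v * (t : ℂ) ^ k with hP
    set P' := ∑ k ∈ Finset.range N, b k v * (t : ℂ) ^ k with hP'
    have hPP : P * P' = ∑ p ∈ T, (a p.1 v * (t : ℂ) ^ p.1) * (b p.2 v * (t : ℂ) ^ p.2) := by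
      rw [hP, hP', Finset.sum_mul_sum, Finset.sum_product]
    rw [hreindex]
    have hsplit := Finset.sum_filter_add_sum_filter_not T (fun p => p.1 + p.2 < N)
      (fun p => (a p.1 v * (t : ℂ) ^ p.1) * (b p.2 v * (t : ℂ) ^ p.2))
    rw [← hPP] at hsplit
    rw [← eq_sub_iff_add_eq] at hsplit
    rw [hsplit]
    have hid : ∀ X : ℂ, E t v * F t v - (P * P' - X) =
        (E t v - P) * F t v + P * (F t v - P') + X := fun X => by ring
    rw [hid]
    have hpow : ∀ k : ℕ, ‖(t : ℂ) ^ k‖ = t ^ k := fun k => by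
      rw [norm_pow, Complex.norm_real, Real.norm_of_nonneg ht.le]
    have hPn : ‖P‖ ≤ ∑ k ∈ Finset.range N, ‖a k v‖ := by
      refine norm_sum_le_of_le _ fun k _ => ?_
      rw [norm_mul, hpow]
      exact mul_le_of_le_one_right (norm_nonneg _) (pow_le_one₀ ht.le ht1)
    have hFn : ‖F t v‖ ≤ S v := by simpa using hSb v t ht ht1
    have h1 : ‖(E t v - P) * F t v‖ ≤ Q v * t ^ N * S v := by
      rw [norm_mul]
      have := hQ0 v
      exact mul_le_mul (hQb v t ht ht1) hFn (norm_nonneg _) (by positivity)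
    have h2 : ‖P * (F t v - P')‖ ≤ (∑ k ∈ Finset.range N, ‖a k v‖) * (R v * t ^ N) := by
      rw [norm_mul]
      exact mul_le_mul hPn (hRb v t ht ht1) (norm_nonneg _) (by positivity)
    have h3 : ‖∑ p ∈ T with ¬ p.1 + p.2 < N,
        (a p.1 v * (t : ℂ) ^ p.1) * (b p.2 v * (t : ℂ) ^ p.2)‖ ≤
        (∑ p ∈ T with ¬ p.1 + p.2 < N, ‖a p.1 v‖ * ‖b p.2 v‖) * t ^ N := by
      rw [Finset.sum_mul]
      refine norm_sum_le_of_le _ fun p hp => ?_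
      rw [norm_mul, norm_mul, norm_mul, hpow, hpow, mul_mul_mul_comm, ← pow_add]
      refine mul_le_mul_of_nonneg_left ?_ (by positivity)
      exact pow_le_pow_of_le_one ht.le ht1 (not_lt.1 (Finset.mem_filter.1 hp).2)
    refine (norm_add_le _ _).trans ((add_le_add ((norm_add_le _ _).trans (add_le_add h1 h2))
      h3).trans (le_of_eq (by ring)))

/-- Composition of an analytic function with `t ζ(v)`. -/
theorem of_analyticAt {φ : ℂ → ℂ} (hφ : AnalyticAt ℂ φ 0) {ζ s : V → ℂ}
    (hζ : PolyBounded fun v => ‖ζ v‖) (hs : PolyBounded fun v => ‖s v‖) {M : V → ℝ}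
    (hM : PolyBounded M) (hb : ∀ v, ∀ t : ℝ, 0 < t → t ≤ 1 → ‖s v * φ (t * ζ v)‖ ≤ M v) :
    ∃ p : ℕ → ℂ, HasPolyExpansion (fun t v => s v * φ (t * ζ v))
      (fun k v => p k * s v * ζ v ^ k) := by
  obtain ⟨p, hp⟩ := hφ
  refine ⟨p.coeff, fun N => ?_⟩
  obtain ⟨C, hC, hCb⟩ := (hp.isBigO_sub_partialSum_pow N).exists_pos
  obtain ⟨r, hr, hrb⟩ := Metric.eventually_nhds_iff.1 hCb.bound
  have hM0 : ∀ v, 0 ≤ M v := fun v => (norm_nonneg _).trans (hb v 1 one_pos le_rfl)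
  let P : V → ℝ := fun v => ∑ k ∈ Finset.range N, ‖p.coeff k‖ * ‖s v‖ * ‖ζ v‖ ^ k
  have hPb : PolyBounded P :=
    PolyBounded.sum fun k _ => ((PolyBounded.const _).mul hs).mul (hζ.pow k)
  have hP0 : ∀ v, 0 ≤ P v := fun v => by positivity
  -- The first summand is the Taylor remainder for `‖t ζ‖ < r`. If `‖t ζ‖ ≥ r`, then `(r⁻¹ ‖ζ‖ t) ^
  -- N ≥ 1`, so the crude bound `M + P` is already of order `t ^ N` at the price of a polynomial
  -- factor.
  refine ⟨fun v => ‖s v‖ * (C * ‖ζ v‖ ^ N) + (M v + P v) * (r⁻¹ * ‖ζ v‖) ^ N, ?_, ?_, ?_⟩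
  · exact (hs.mul ((PolyBounded.const C).mul (hζ.pow N))).add
      ((hM.add hPb).mul (((PolyBounded.const r⁻¹).mul hζ).pow N))
  · intro v
    have := hM0 v; have := hP0 v
    positivity
  intro v t ht ht1
  have hnt : ‖(t : ℂ)‖ = t := by rw [Complex.norm_real, Real.norm_of_nonneg ht.le]
  have hsum : ∑ k ∈ Finset.range N, p.coeff k * s v * ζ v ^ k * (t : ℂ) ^ k =
      s v * p.partialSum N (t * ζ v) := by
    rw [FormalMultilinearSeries.partialSum, Finset.mul_sum]
    refine Finset.sum_congr rfl fun k _ => ?_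
    rw [FormalMultilinearSeries.apply_eq_pow_smul_coeff, smul_eq_mul, mul_pow]
    ring
  rw [add_mul]
  rcases lt_or_ge ‖(t : ℂ) * ζ v‖ r with h | h
  · have h1 := hrb (y := t * ζ v) (by simpa using h)
    rw [zero_add, norm_pow, norm_norm] at h1
    rw [hsum, ← mul_sub, norm_mul]
    have h2 : ‖s v‖ * ‖φ (t * ζ v) - p.partialSum N (t * ζ v)‖ ≤
        ‖s v‖ * (C * ‖ζ v‖ ^ N) * t ^ N := by
      rw [mul_assoc, mul_assoc, ← mul_pow]
      refine mul_le_mul_of_nonneg_left (h1.trans (le_of_eq ?_)) (norm_nonneg _)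
      rw [norm_mul, hnt, mul_comm t]
    have := hM0 v; have := hP0 v
    have h3 : 0 ≤ (M v + P v) * (r⁻¹ * ‖ζ v‖) ^ N * t ^ N := by positivity
    linarith
  · have h1 : ‖s v * φ (t * ζ v) - ∑ k ∈ Finset.range N, p.coeff k * s v * ζ v ^ k * (t : ℂ) ^ k‖
        ≤ M v + P v := by
      refine (norm_sub_le _ _).trans (add_le_add (hb v t ht ht1) ?_)
      refine norm_sum_le_of_le _ fun k _ => ?_
      rw [norm_mul, norm_mul, norm_mul, norm_pow, norm_pow, hnt]
      exact mul_le_of_le_one_right (by positivity) (pow_le_one₀ ht.le ht1)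
    have h2 : 1 ≤ (r⁻¹ * ‖ζ v‖) ^ N * t ^ N := by
      rw [← mul_pow]
      refine one_le_pow₀ ?_
      rw [norm_mul, hnt] at h
      rw [mul_assoc, inv_mul_eq_div, le_div_iff₀ hr]
      linarith
    have := hM0 v; have := hP0 v
    have h3 : 0 ≤ ‖s v‖ * (C * ‖ζ v‖ ^ N) * t ^ N := by positivity
    have h4 : M v + P v ≤ (M v + P v) * (r⁻¹ * ‖ζ v‖) ^ N * t ^ N := by
      rw [mul_assoc]
      exact le_mul_of_one_le_right (by linarith) h2
    linarith

theorem prod {ι : Type*} {s : Finset ι} {E : ι → ℝ → V → ℂ}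
    (h : ∀ i ∈ s, ∃ a : ℕ → V → ℂ, (∀ k, Continuous (a k)) ∧ HasPolyExpansion (E i) a) :
    ∃ a : ℕ → V → ℂ, (∀ k, Continuous (a k)) ∧
      HasPolyExpansion (fun t v => ∏ i ∈ s, E i t v) a := by
  classical
  induction s using Finset.induction_on with
  | empty => exact ⟨_, fun k => continuous_const, by simpa using one⟩
  | insert i s hi ih =>
    obtain ⟨a, ha, hEa⟩ := h i (Finset.mem_insert_self i s)
    obtain ⟨b, hb, hEb⟩ := ih fun j hj => h j (Finset.mem_insert_of_mem hj)
    refine ⟨_, fun k => ?_, by simpa only [Finset.prod_insert hi] using hEa.mul hEb⟩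
    exact continuous_finsetSum _ fun p _ => (ha p.1).mul (hb p.2)

/-- Integration of an expansion against a rapidly decaying function. -/
theorem integral [MeasurableSpace V] [BorelSpace V] [SecondCountableTopology V] {μ : Measure V}
    {g : V → ℂ} (hg : Continuous g) (hgi : ∀ m : ℕ, Integrable (fun v => (1 + ‖v‖) ^ m * ‖g v‖) μ)
    (h : HasPolyExpansion E a) (hE : ∀ t, 0 < t → t ≤ 1 → Continuous (E t))
    (ha : ∀ k, Continuous (a k)) :
    ∀ N : ℕ, ∃ C : ℝ, ∀ t : ℝ, 0 < t → t ≤ 1 →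
      ‖∫ v, g v * E t v ∂μ - ∑ k ∈ Finset.range N, (∫ v, g v * a k v ∂μ) * (t : ℂ) ^ k‖ ≤
        C * t ^ N := by
  have hint : ∀ f : V → ℂ, Continuous f → PolyBounded (fun v => ‖f v‖) →
      Integrable (fun v => g v * f v) μ := by
    rintro f hf ⟨C, m, hC, hb⟩
    refine ((hgi m).const_mul C).mono' (hg.mul hf).aestronglyMeasurable (ae_of_all _ fun v => ?_)
    rw [norm_mul, ← mul_assoc, mul_comm ‖g v‖]
    exact mul_le_mul_of_nonneg_right ((le_abs_self _).trans (hb v)) (norm_nonneg _)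
  intro N
  obtain ⟨Q, ⟨C, m, hC, hQ⟩, hQ0, hQb⟩ := h N
  obtain ⟨S, hS, hS0, hSb⟩ := h 0
  refine ⟨C * ∫ v, (1 + ‖v‖) ^ m * ‖g v‖ ∂μ, fun t ht ht1 => ?_⟩
  have h1 : Integrable (fun v => g v * E t v) μ := by
    refine hint _ (hE t ht ht1) (hS.mono fun v => ?_)
    simpa using hSb v t ht ht1
  have h2 : ∀ k, Integrable (fun v => g v * a k v) μ := fun k =>
    hint _ (ha k) (h.polyBounded_coeff k)
  have h3 : ∑ k ∈ Finset.range N, (∫ v, g v * a k v ∂μ) * (t : ℂ) ^ k =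
      ∫ v, ∑ k ∈ Finset.range N, g v * a k v * (t : ℂ) ^ k ∂μ := by
    rw [integral_finsetSum _ fun k _ => (h2 k).mul_const _]
    exact Finset.sum_congr rfl fun k _ => (integral_mul_const _ _).symm
  rw [h3, ← integral_sub h1 (integrable_finsetSum _ fun k _ => (h2 k).mul_const _)]
  refine (norm_integral_le_of_norm_le (((hgi m).const_mul C).mul_const (t ^ N))
    (ae_of_all _ fun v => ?_)).trans (le_of_eq ?_)
  · have : g v * E t v - ∑ k ∈ Finset.range N, g v * a k v * (t : ℂ) ^ k =
        g v * (E t v - ∑ k ∈ Finset.range N, a k v * (t : ℂ) ^ k) := by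
      rw [mul_sub, Finset.mul_sum]
      simp only [mul_assoc]
    rw [this, norm_mul]
    calc _ ≤ ‖g v‖ * (C * (1 + ‖v‖) ^ m * t ^ N) := by
          refine mul_le_mul_of_nonneg_left ((hQb v t ht ht1).trans ?_) (norm_nonneg _)
          exact mul_le_mul_of_nonneg_right ((le_abs_self _).trans (hQ v)) (by positivity)
      _ = _ := by ring
  · rw [integral_mul_const, integral_const_mul]

end HasPolyExpansion

/-! ### The Gaussian sum over the corner and its expansion at `0+`. -/

/-- The denominator vanishes at `0` only for `w = 1`, and then to first order, so the factor `u`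
removes the singularity. One factor `t` per coordinate therefore suffices, whence the `t ^ d` in the
expansion of the Gaussian sum. -/
theorem exists_analyticAt_div_one_sub_mul_exp (w : ℂ) :
    ∃ φ : ℂ → ℂ, AnalyticAt ℂ φ 0 ∧
      ∀ u, u ≠ 0 → φ u = u / (1 - w * Complex.exp (2 * Real.pi * Complex.I * u)) := by
  let D : ℂ → ℂ := fun u => 1 - w * Complex.exp (2 * Real.pi * Complex.I * u)
  have hD : Differentiable ℂ D := by fun_prop
  by_cases hw : w = 1
  · have hd : HasDerivAt D (-(2 * Real.pi * Complex.I)) 0 := by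
      have h1 := (((hasDerivAt_id (0 : ℂ)).const_mul (2 * Real.pi * Complex.I)).cexp.const_mul
        w).const_sub 1
      simpa [D, hw] using h1
    -- As `D 0 = 0`, the divided difference is `D u / u` off `0`; at `0` it is `-2πi ≠ 0`, so its
    -- inverse is the desired extension.
    have hA : AnalyticAt ℂ (dslope D 0) 0 := by
      have : DifferentiableOn ℂ (dslope D 0) Set.univ :=
        (Complex.differentiableOn_dslope univ_mem).2 hD.differentiableOn
      exact this.analyticAt univ_mem
    refine ⟨fun u => (dslope D 0 u)⁻¹, hA.inv ?_, fun u hu => ?_⟩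
    · rw [dslope_same, hd.deriv]
      simp [Real.pi_ne_zero]
    · change (dslope D 0 u)⁻¹ = _
      rw [dslope_of_ne _ hu, slope_def_field]
      have : D 0 = 0 := by simp [D, hw]
      rw [this, sub_zero, sub_zero, inv_div]
  · refine ⟨fun u => u / D u, ?_, fun u _ => rfl⟩
    refine analyticAt_id.div (hD.analyticAt 0) ?_
    simpa [D, sub_eq_zero] using fun h => hw h.symm

/-- On `(0, 1]` one has `1 - exp(-2πt) ≥ t/2`. The bound is uniform in the real part of the contour
variable, where the Taylor expansion at `0` gives no control. -/
theorem norm_div_one_sub_le {t : ℝ} (ht : 0 < t) (ht1 : t ≤ 1) {e : ℂ}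
    (he : ‖e‖ = Real.exp (-(2 * Real.pi * t))) : ‖(t : ℂ) / (1 - e)‖ ≤ 2 := by
  have hp := Real.pi_gt_three
  have h1 : 1 - ‖e‖ ≤ ‖1 - e‖ := by simpa using norm_sub_norm_le (1 : ℂ) e
  have h2 : ‖e‖ ≤ (1 + 2 * Real.pi * t)⁻¹ := by
    rw [he, Real.exp_neg]
    exact inv_anti₀ (by positivity) (by linarith [Real.add_one_le_exp (2 * Real.pi * t)])
  have h3 : t / 2 ≤ 1 - (1 + 2 * Real.pi * t)⁻¹ := by
    rw [le_sub_iff_add_le, ← le_sub_iff_add_le', inv_le_iff_one_le_mul₀ (by positivity)]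
    nlinarith [mul_pos ht (by linarith : (0 : ℝ) < Real.pi)]
  have h4 : t / 2 ≤ ‖1 - e‖ := by linarith
  rw [norm_div, Complex.norm_real, Real.norm_of_nonneg ht.le, div_le_iff₀ (by linarith)]
  linarith

/-- The Gaussian as a superposition of plane waves along the shifted contour `ℝ^d + i η`. -/
theorem integral_shifted_gaussian {d : ℕ} (η z : Euc d) :
    ∫ ξ : Euc d, Complex.exp (-Real.pi * ‖ξ‖ ^ 2 - 2 * Real.pi * Complex.I * (inner ℝ ξ η : ℝ) +
        Real.pi * ‖η‖ ^ 2) *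
      Complex.exp (2 * Real.pi * Complex.I * ((inner ℝ ξ z : ℝ) + Complex.I * (inner ℝ η z : ℝ))) =
    Complex.exp (-Real.pi * ‖z‖ ^ 2) := by
  have h := GaussianFourier.integral_cexp_neg_mul_sq_norm_add (V := Euc d) (b := Real.pi)
    (by simpa using Real.pi_pos) (2 * Real.pi * Complex.I) (z - η)
  have hpi : (Real.pi : ℂ) ≠ 0 := by exact_mod_cast Real.pi_ne_zero
  rw [div_self hpi, Complex.one_cpow, one_mul] at h
  -- No contour integration is needed: up to the constant `exp(π|η|² - 2π η·z)`, the integrand is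
  -- that of the Fourier integral of the standard Gaussian at `z - η`.
  have h1 : ∀ ξ : Euc d, Complex.exp (-Real.pi * ‖ξ‖ ^ 2 -
        2 * Real.pi * Complex.I * (inner ℝ ξ η : ℝ) + Real.pi * ‖η‖ ^ 2) *
      Complex.exp (2 * Real.pi * Complex.I * ((inner ℝ ξ z : ℝ) + Complex.I * (inner ℝ η z : ℝ))) =
      Complex.exp (Real.pi * ‖η‖ ^ 2 - 2 * Real.pi * (inner ℝ η z : ℝ)) *
      Complex.exp (-Real.pi * ‖ξ‖ ^ 2 + 2 * Real.pi * Complex.I * (inner ℝ (z - η) ξ : ℝ)) := by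
    intro ξ
    rw [← Complex.exp_add, ← Complex.exp_add, inner_sub_left, real_inner_comm z ξ,
      real_inner_comm η ξ]
    congr 1
    push_cast
    linear_combination 2 * (Real.pi : ℂ) * (inner ℝ η z : ℝ) * Complex.I_sq
  simp only [h1]
  rw [integral_const_mul, h, ← Complex.exp_add]
  congr 1
  have h2 : ((‖z - η‖ : ℝ) : ℂ) ^ 2 = ‖z‖ ^ 2 - 2 * (inner ℝ η z : ℝ) + ‖η‖ ^ 2 := by
    have := norm_sub_sq_real z η
    rw [real_inner_comm] at this
    exact_mod_cast congrArg (fun r : ℝ => (r : ℂ)) this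
  rw [h2, mul_pow, mul_pow, Complex.I_sq]
  field_simp
  ring

theorem integrable_pow_mul_gaussian {d : ℕ} (m : ℕ) :
    Integrable fun ξ : Euc d => (1 + ‖ξ‖) ^ m * Real.exp (-Real.pi * ‖ξ‖ ^ 2) := by
  have h1 : Integrable fun ξ : Euc d => Real.exp (-1 * ‖ξ‖ ^ 2) := by
    have := (GaussianFourier.integrable_cexp_neg_mul_sq_norm_add (V := Euc d) (b := 1)
      (by simp) 0 0).norm
    refine this.congr (ae_of_all _ fun v => ?_)
    simp only [Complex.norm_exp]
    congr 1
    simp [← Complex.ofReal_pow]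
  obtain ⟨C, hC⟩ : ∃ C : ℝ, ∀ s : ℝ, 0 ≤ s →
      (1 + s) ^ m * Real.exp (-Real.pi * s ^ 2) ≤ C * Real.exp (-1 * s ^ 2) := by
    -- Combines `(1 + s)^m ≤ m! exp(1 + s)` with `1 + s ≤ 2 + (π - 1) s²`.
    refine ⟨m.factorial * Real.exp 2, fun s hs => ?_⟩
    have h2 := Real.pow_div_factorial_le_exp (x := 1 + s) (by positivity) m
    rw [div_le_iff₀ (by positivity)] at h2
    calc (1 + s) ^ m * Real.exp (-Real.pi * s ^ 2)
        ≤ (Real.exp (1 + s) * m.factorial) * Real.exp (-Real.pi * s ^ 2) := by gcongr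
      _ = m.factorial * Real.exp (1 + s - Real.pi * s ^ 2) := by
          rw [mul_comm (Real.exp _), mul_assoc, ← Real.exp_add]; ring_nf
      _ ≤ m.factorial * Real.exp (2 + -1 * s ^ 2) := by
          gcongr
          nlinarith [Real.pi_gt_three, sq_nonneg (s - 1), sq_nonneg s]
      _ = _ := by rw [Real.exp_add]; ring
  refine (h1.const_mul C).mono' (by fun_prop) (ae_of_all _ fun ξ => ?_)
  rw [Real.norm_of_nonneg (by positivity)]
  exact hC _ (norm_nonneg _)

/-- The Gaussian sum `∑_z exp (-2 π i y · z - π |z|² τ)` over the corner. -/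
noncomputable def cornerTheta {d : ℕ} (A : Matrix (Fin d) (Fin d) ℝ) (x y : Euc d) (τ : ℝ) : ℂ :=
  ∑' z : corner A x, planeWave y (z : Euc d) *
    (Real.exp (-Real.pi * ‖(z : Euc d)‖ ^ 2 * τ) : ℝ)

theorem hasSum_cornerTheta {d : ℕ} {A : Matrix (Fin d) (Fin d) ℝ} (hA : A.det ≠ 0)
    (x y : Euc d) {τ : ℝ} (hτ : 0 < τ) :
    HasSum (fun z : corner A x => planeWave y (z : Euc d) *
      (Real.exp (-Real.pi * ‖(z : Euc d)‖ ^ 2 * τ) : ℝ)) (cornerTheta A x y τ) := by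
  refine Summable.hasSum (Summable.of_norm ?_)
  refine (summable_corner_gaussian hA x (mul_pos Real.pi_pos hτ)).congr fun z => ?_
  rw [norm_mul, norm_planeWave, one_mul, Complex.norm_real, Real.norm_of_nonneg (Real.exp_pos _).le]
  congr 1
  ring

/-- This `η` satisfies `η · A n = ∑ n_i`, so plane waves with imaginary frequency part `η` decay in
every direction of the cone. Here it matters that the corner uses `ℕ₀` and not `ℤ`. -/
theorem exists_transpose_mulVec_eq_one {d : ℕ} {A : Matrix (Fin d) (Fin d) ℝ} (hA : A.det ≠ 0) :
    ∃ η : Euc d, ∀ i, (Aᵀ *ᵥ η.ofLp) i = 1 := by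
  refine ⟨WithLp.toLp 2 ((Aᵀ)⁻¹ *ᵥ 1), fun i => ?_⟩
  have hu : IsUnit (Aᵀ).det := by rw [Matrix.det_transpose]; exact isUnit_iff_ne_zero.2 hA
  simp only [Matrix.mulVec_mulVec, Matrix.mul_nonsing_inv _ hu, Matrix.one_mulVec, Pi.one_apply]

/-- Each Gaussian is expanded in plane waves on the shifted contour. The sum over `n` then has
ratios of modulus `exp(-2πt) < 1` and is evaluated under the integral. -/
theorem cornerTheta_sq_eq_integral {d : ℕ} {A : Matrix (Fin d) (Fin d) ℝ} (hA : A.det ≠ 0)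
    (x y : Euc d) {η : Euc d} (hη : ∀ i, (Aᵀ *ᵥ η.ofLp) i = 1) {t : ℝ} (ht : 0 < t) :
    cornerTheta A x y (t ^ 2) = planeWave y (-x) * ∫ ξ : Euc d,
      Complex.exp (-Real.pi * ‖ξ‖ ^ 2 - 2 * Real.pi * Complex.I * (inner ℝ ξ η : ℝ) +
        Real.pi * ‖η‖ ^ 2) *
      (Complex.exp (t * (-2 * Real.pi * Complex.I *
        ((inner ℝ ξ x : ℝ) + Complex.I * (inner ℝ η x : ℝ)))) *
      ∏ i, (1 - cornerPhase A y i * Complex.exp (2 * Real.pi * Complex.I *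
        (t * ((Aᵀ *ᵥ ξ.ofLp) i + Complex.I))))⁻¹) := by
  let g : Euc d → ℂ := fun ξ => Complex.exp (-Real.pi * ‖ξ‖ ^ 2 -
    2 * Real.pi * Complex.I * (inner ℝ ξ η : ℝ) + Real.pi * ‖η‖ ^ 2)
  let e : Euc d → ℂ := fun ξ => Complex.exp (t * (-2 * Real.pi * Complex.I *
        ((inner ℝ ξ x : ℝ) + Complex.I * (inner ℝ η x : ℝ))))
  let r : Euc d → Fin d → ℂ := fun ξ i => cornerPhase A y i * Complex.exp (2 * Real.pi * Complex.I *
        (t * ((Aᵀ *ᵥ ξ.ofLp) i + Complex.I)))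
  have hgn : ∀ ξ, ‖g ξ‖ = Real.exp (Real.pi * ‖η‖ ^ 2) * Real.exp (-Real.pi * ‖ξ‖ ^ 2) := by
    intro ξ
    rw [Complex.norm_exp, ← Real.exp_add]
    congr 1
    simp [← Complex.ofReal_pow]
    ring
  have hen : ∀ ξ, ‖e ξ‖ = Real.exp (2 * Real.pi * t * inner ℝ η x) := by
    intro ξ
    rw [Complex.norm_exp]
    congr 1
    simp
    ring
  have hrn : ∀ ξ i, ‖r ξ i‖ = Real.exp (-(2 * Real.pi * t)) := by
    intro ξ i
    rw [norm_mul, norm_cornerPhase, one_mul, Complex.norm_exp]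
    congr 1
    simp
  have hlt : Real.exp (-(2 * Real.pi * t)) < 1 := Real.exp_lt_one_iff.2 (by
    have := Real.pi_pos
    simp only [Left.neg_neg_iff]; positivity)
  let F : (Fin d → ℕ) → Euc d → ℂ := fun n ξ => g ξ * (e ξ * ∏ i, r ξ i ^ n i)
  have hq := (hasSum_pi_geometric (fun _ : Fin d => ((Real.exp (-(2 * Real.pi * t)) : ℝ) : ℂ))
    (fun i => by rwa [Complex.norm_real, Real.norm_of_nonneg (Real.exp_pos _).le])).1
  have hFn : ∀ n ξ, ‖F n ξ‖ = ‖∏ i : Fin d, ((Real.exp (-(2 * Real.pi * t)) : ℝ) : ℂ) ^ n i‖ *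
      (Real.exp (2 * Real.pi * t * inner ℝ η x) * (Real.exp (Real.pi * ‖η‖ ^ 2) *
        Real.exp (-Real.pi * ‖ξ‖ ^ 2))) := by
    intro n ξ
    simp only [F, norm_mul, hgn, hen, norm_prod, norm_pow, hrn, Complex.norm_real,
      Real.norm_of_nonneg (Real.exp_pos _).le]
    ring
  have hgauss : Integrable fun ξ : Euc d => Real.exp (2 * Real.pi * t * inner ℝ η x) *
      (Real.exp (Real.pi * ‖η‖ ^ 2) * Real.exp (-Real.pi * ‖ξ‖ ^ 2)) := by
    have := integrable_pow_mul_gaussian (d := d) 0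
    simp only [pow_zero, one_mul] at this
    exact (this.const_mul _).const_mul _
  have hgc : Continuous g := by fun_prop
  have hec : Continuous e := by fun_prop
  have hrc : ∀ i, Continuous fun ξ => r ξ i := fun i => by
    have := continuous_transpose_mulVec A i
    fun_prop
  have hFc : ∀ n, Continuous (F n) := fun n =>
    hgc.mul (hec.mul (continuous_finsetProd _ fun i _ => (hrc i).pow _))
  have hFi : ∀ n, Integrable (F n) := fun n =>
    (hgauss.const_mul _).mono' (hFc n).aestronglyMeasurable (ae_of_all _ fun ξ => (hFn n ξ).le)
  have key := hasSum_integral_of_summable_integral_norm hFi (by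
    simp only [hFn, integral_const_mul]
    exact hq.mul_right _)
  have hFint : ∀ n, ∫ ξ, F n ξ = Complex.exp (-Real.pi * ‖cornerPt A x n‖ ^ 2 * t ^ 2) *
      ∏ i, cornerPhase A y i ^ n i := by
    intro n
    have h1 := integral_shifted_gaussian η (t • cornerPt A x n)
    rw [norm_smul, Real.norm_of_nonneg ht.le] at h1
    push_cast at h1
    rw [mul_pow, mul_comm ((t : ℂ) ^ 2), ← mul_assoc] at h1
    rw [← h1, ← integral_mul_const]
    refine integral_congr_ae (ae_of_all _ fun ξ => ?_)
    have h3 : Complex.exp (2 * Real.pi * Complex.I * ((inner ℝ ξ (t • cornerPt A x n) : ℝ) +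
        Complex.I * (inner ℝ η (t • cornerPt A x n) : ℝ))) =
        e ξ * ∏ i, Complex.exp (2 * Real.pi * Complex.I *
          (t * ((Aᵀ *ᵥ ξ.ofLp) i + Complex.I))) ^ n i := by
      simp only [e, ← Complex.exp_nat_mul, ← Complex.exp_sum, ← Complex.exp_add]
      congr 1
      rw [inner_smul_right, inner_smul_right, inner_cornerPt, inner_cornerPt]
      simp only [hη, one_mul]
      push_cast
      have h2 : ∑ i, (n i : ℂ) * (2 * Real.pi * Complex.I *
          (t * (((Aᵀ *ᵥ ξ.ofLp) i : ℝ) + Complex.I))) = 2 * Real.pi * Complex.I * t *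
          (∑ i, ((Aᵀ *ᵥ ξ.ofLp) i : ℝ) * (n i : ℂ) + Complex.I * ∑ i, (n i : ℂ)) := by
        rw [Finset.mul_sum, ← Finset.sum_add_distrib, Finset.mul_sum]
        exact Finset.sum_congr rfl fun i _ => by ring
      rw [h2]
      ring
    change g ξ * (e ξ * ∏ i, r ξ i ^ n i) = g ξ * _ * _
    rw [h3]
    simp only [r, mul_pow, Finset.prod_mul_distrib]
    ring
  have hsum := (cornerEquiv hA x).hasSum_iff.2 (hasSum_cornerTheta hA x y (pow_pos ht 2))
  refine hsum.unique ?_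
  have key2 := key.mul_left (planeWave y (-x))
  convert! key2 using 1
  · funext n
    simp only [Function.comp_apply, cornerEquiv_coe, planeWave_cornerPt, hFint]
    push_cast
    ring
  · congr 1
    refine integral_congr_ae (ae_of_all _ fun ξ => ?_)
    have h1 := (hasSum_pi_geometric (r ξ) fun i => by rw [hrn]; exact hlt).2
    exact (((h1.mul_left (e ξ)).mul_left (g ξ)).tsum_eq).symm

/-- The asymptotic expansion of the Gaussian sum over the corner at `0+`. -/
theorem exists_expansion_cornerTheta {d : ℕ} {A : Matrix (Fin d) (Fin d) ℝ} (hA : A.det ≠ 0)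
    (x y : Euc d) : ∃ c : ℕ → ℂ, ∀ N : ℕ, ∃ C : ℝ, ∀ t : ℝ, 0 < t → t ≤ 1 →
      ‖(t : ℂ) ^ d * cornerTheta A x y (t ^ 2) - ∑ k ∈ Finset.range N, c k * (t : ℂ) ^ k‖ ≤
        C * t ^ N := by
  obtain ⟨η, hη⟩ := exists_transpose_mulVec_eq_one hA
  let g : Euc d → ℂ := fun ξ => Complex.exp (-Real.pi * ‖ξ‖ ^ 2 -
    2 * Real.pi * Complex.I * (inner ℝ ξ η : ℝ) + Real.pi * ‖η‖ ^ 2)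
  have hgc : Continuous g := by fun_prop
  have hgn : ∀ ξ, ‖g ξ‖ = Real.exp (Real.pi * ‖η‖ ^ 2) * Real.exp (-Real.pi * ‖ξ‖ ^ 2) := by
    intro ξ
    rw [Complex.norm_exp, ← Real.exp_add]
    congr 1
    simp [← Complex.ofReal_pow]
    ring
  have hgi : ∀ m : ℕ, Integrable fun ξ => (1 + ‖ξ‖) ^ m * ‖g ξ‖ := by
    intro m
    simp only [hgn]
    refine ((integrable_pow_mul_gaussian m).const_mul (Real.exp (Real.pi * ‖η‖ ^ 2))).congr
      (ae_of_all _ fun ξ => ?_)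
    simp only
    ring
  -- Since `Im ζ = 1`, `ζ` stays away from `0`; this allows the rewriting `t / (1 - …) = ζ⁻¹ · φ(t
  -- ζ)` with `φ` analytic at `0`.
  let ζ : Fin d → Euc d → ℂ := fun i ξ => (Aᵀ *ᵥ ξ.ofLp) i + Complex.I
  have hζc : ∀ i, Continuous (ζ i) := fun i => by
    have := continuous_transpose_mulVec A i
    fun_prop
  have hζ1 : ∀ i ξ, 1 ≤ ‖ζ i ξ‖ := fun i ξ => by
    have := Complex.abs_im_le_norm (ζ i ξ)
    simpa [ζ] using this
  have hζ0 : ∀ i ξ, ζ i ξ ≠ 0 := fun i ξ h => by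
    have := hζ1 i ξ
    rw [h, norm_zero] at this
    linarith
  have hζp : ∀ i, PolyBounded fun ξ => ‖ζ i ξ‖ := by
    intro i
    refine ⟨∑ j, |Aᵀ i j| + 1, 1, by positivity, fun ξ => ?_⟩
    rw [abs_norm, pow_one]
    refine (norm_add_le _ _).trans ?_
    rw [Complex.norm_I, Complex.norm_real]
    have h1 : ‖(Aᵀ *ᵥ ξ.ofLp) i‖ ≤ (∑ j, |Aᵀ i j|) * ‖ξ‖ := by
      rw [Finset.sum_mul]
      change ‖∑ j, Aᵀ i j * ξ.ofLp j‖ ≤ _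
      refine norm_sum_le_of_le _ fun j _ => ?_
      rw [norm_mul]
      exact mul_le_mul_of_nonneg_left (PiLp.norm_apply_le ξ j) (norm_nonneg _)
    have h2 : 0 ≤ ∑ j, |Aᵀ i j| := by positivity
    nlinarith [norm_nonneg ξ]
  let χ : Euc d → ℂ := fun ξ => -2 * Real.pi * Complex.I *
    ((inner ℝ ξ x : ℝ) + Complex.I * (inner ℝ η x : ℝ))
  have hχc : Continuous χ := by fun_prop
  have hχp : PolyBounded fun ξ => ‖χ ξ‖ := by
    refine ⟨2 * Real.pi * (‖x‖ + |inner ℝ η x|), 1, by positivity, fun ξ => ?_⟩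
    have h1 := norm_add_le ((inner ℝ ξ x : ℝ) : ℂ) (Complex.I * (inner ℝ η x : ℝ))
    rw [norm_mul, Complex.norm_I, one_mul, Complex.norm_real, Complex.norm_real] at h1
    have h2 := norm_inner_le_norm (𝕜 := ℝ) ξ x
    have h3 : ‖(-2 * Real.pi * Complex.I : ℂ)‖ = 2 * Real.pi := by
      simp [abs_of_pos Real.pi_pos]
    rw [abs_norm, pow_one, norm_mul, h3, mul_assoc (2 * Real.pi) (_ + _)]
    refine mul_le_mul_of_nonneg_left ?_ (by positivity)
    rw [Real.norm_eq_abs (inner ℝ η x : ℝ)] at h1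
    nlinarith [norm_nonneg ξ, norm_nonneg x, abs_nonneg (inner ℝ η x : ℝ)]
  obtain ⟨pe, hpe⟩ := HasPolyExpansion.of_analyticAt (φ := Complex.exp)
    (Complex.differentiable_exp.analyticAt 0) hχp (s := fun _ => 1)
    (by simpa using PolyBounded.const (V := Euc d) 1)
    (PolyBounded.const (Real.exp (2 * Real.pi * |inner ℝ η x|)))
    (fun ξ t ht ht1 => by
      rw [one_mul, Complex.norm_exp]
      refine Real.exp_le_exp.2 ?_
      have h1 : ((t : ℂ) * χ ξ).re = 2 * Real.pi * (t * inner ℝ η x) := by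
        simp [χ]; ring
      rw [h1]
      refine mul_le_mul_of_nonneg_left ?_ (by positivity)
      nlinarith [le_abs_self (inner ℝ η x : ℝ), abs_nonneg (inner ℝ η x : ℝ)])
  obtain ⟨a, ha, hEa⟩ := HasPolyExpansion.prod (V := Euc d) (s := Finset.univ)
    (E := fun (i : Fin d) t ξ => (t : ℂ) / (1 - cornerPhase A y i *
      Complex.exp (2 * Real.pi * Complex.I * (t * ζ i ξ)))) (fun i _ => by
    obtain ⟨φ, hφ, hφe⟩ := exists_analyticAt_div_one_sub_mul_exp (cornerPhase A y i)
    have hEφ : ∀ ξ, ∀ t : ℝ, 0 < t → t ≤ 1 → (t : ℂ) / (1 - cornerPhase A y i *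
        Complex.exp (2 * Real.pi * Complex.I * (t * ζ i ξ))) = (ζ i ξ)⁻¹ * φ (t * ζ i ξ) := by
      intro ξ t ht ht1
      have ht0 : (t : ℂ) ≠ 0 := by exact_mod_cast ht.ne'
      rw [hφe _ (mul_ne_zero ht0 (hζ0 i ξ)), mul_div_assoc', mul_comm (t : ℂ) (ζ i ξ),
        inv_mul_cancel_left₀ (hζ0 i ξ)]
    obtain ⟨p, hp⟩ := HasPolyExpansion.of_analyticAt hφ (hζp i) (s := fun ξ => (ζ i ξ)⁻¹)
      ((PolyBounded.const 1).mono fun ξ => by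
        rw [abs_norm, norm_inv]
        exact inv_le_one_of_one_le₀ (hζ1 i ξ))
      (PolyBounded.const 2) (fun ξ t ht ht1 => by
        rw [← hEφ ξ t ht ht1]
        refine norm_div_one_sub_le ht ht1 ?_
        rw [norm_mul, norm_cornerPhase, one_mul, Complex.norm_exp]
        congr 1
        simp [ζ])
    refine ⟨_, fun k => ?_, hp.congr hEφ⟩
    exact (continuous_const.mul ((hζc i).inv₀ (hζ0 i))).mul ((hζc i).pow k))
  have hall := hpe.mul hEa
  have hcont : ∀ t : ℝ, 0 < t → t ≤ 1 → Continuous fun ξ => 1 * Complex.exp (t * χ ξ) *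
      ∏ i, (t : ℂ) / (1 - cornerPhase A y i *
        Complex.exp (2 * Real.pi * Complex.I * (t * ζ i ξ))) := by
    intro t ht ht1
    refine (by fun_prop : Continuous fun ξ => 1 * Complex.exp (t * χ ξ)).mul
      (continuous_finsetProd _ fun i _ => ?_)
    have hζi := hζc i
    refine Continuous.div continuous_const (by fun_prop) fun ξ h => ?_
    have h1 := congrArg norm (sub_eq_zero.1 h)
    rw [norm_one, norm_mul, norm_cornerPhase, one_mul, Complex.norm_exp] at h1
    have h2 := (Real.exp_eq_one_iff _).1 h1.symm
    simp [ζ, Real.pi_ne_zero, ht.ne'] at h2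
  have hfin := hall.integral (μ := volume) hgc hgi hcont
    (fun k => continuous_finsetSum _ fun p _ =>
      ((continuous_const.mul continuous_const).mul (hχc.pow _)).mul (ha _))
  refine ⟨fun k => planeWave y (-x) * ∫ ξ, g ξ * ∑ p ∈ Finset.HasAntidiagonal.antidiagonal k,
    pe p.1 * 1 * χ ξ ^ p.1 * a p.2 ξ, fun N => ?_⟩
  · obtain ⟨C, hC⟩ := hfin N
    refine ⟨C, fun t ht ht1 => ?_⟩
    have h1 := hC t ht ht1
    have h2 : (t : ℂ) ^ d * cornerTheta A x y (t ^ 2) = planeWave y (-x) *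
        ∫ ξ, g ξ * (1 * Complex.exp (t * χ ξ) * ∏ i, (t : ℂ) / (1 - cornerPhase A y i *
          Complex.exp (2 * Real.pi * Complex.I * (t * ζ i ξ)))) := by
      rw [cornerTheta_sq_eq_integral hA x y hη ht, mul_left_comm, ← integral_const_mul]
      congr 1
      refine integral_congr_ae (ae_of_all _ fun ξ => ?_)
      simp only [div_eq_mul_inv, Finset.prod_mul_distrib, Finset.prod_const, Finset.card_univ,
        Fintype.card_fin, one_mul, g, χ, ζ]
      ring
    have h3 := norm_planeWave y (-x)
    have h4 : ∀ (S : ℂ) (b : ℕ → ℂ), planeWave y (-x) * S - ∑ k ∈ Finset.range N,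
        (planeWave y (-x) * b k) * (t : ℂ) ^ k =
        planeWave y (-x) * (S - ∑ k ∈ Finset.range N, b k * (t : ℂ) ^ k) := by
      intro S b
      rw [mul_sub, Finset.mul_sum]
      simp only [mul_assoc]
    rw [h2]
    refine le_trans (le_of_eq ?_) h1
    exact (congrArg norm (h4 _ _)).trans (by rw [norm_mul, h3, one_mul])

/-! ### Meromorphic continuation of a Mellin transform from an expansion at `0+`. -/

/-- `F` decays rapidly at infinity and has the asymptotic expansion `∑ c_k τ^((k-d)/2)` at `0+`. -/
structure HasMellinExpansion (F : ℝ → ℂ) (d : ℕ) (c : ℕ → ℂ) : Prop where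
  locallyIntegrableOn : LocallyIntegrableOn F (Set.Ioi 0)
  isBigO_atTop : ∀ a : ℝ, F =O[atTop] (· ^ (-a))
  isBigO_zero : ∀ N : ℕ, (fun τ : ℝ => F τ - ∑ k ∈ Finset.range N,
    c k * (τ : ℂ) ^ (((k : ℂ) - d) / 2)) =O[𝓝[>] 0] fun τ : ℝ => τ ^ (((N : ℝ) - d) / 2)

/-- `F` minus the first `N` terms `c_k τ^((k-d)/2)`, cut off to `(0, 1]`. -/
noncomputable def mellinRemainder (F : ℝ → ℂ) (d : ℕ) (c : ℕ → ℂ) (N : ℕ) (τ : ℝ) : ℂ :=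
  F τ - ∑ k ∈ Finset.range N,
    c k * (Set.Ioc (0 : ℝ) 1).indicator (fun t : ℝ => (t : ℂ) ^ (((k : ℂ) - d) / 2)) τ

/-- The Mellin transform of the remainder plus the explicit contributions of the first terms. -/
noncomputable def mellinPartial (F : ℝ → ℂ) (d : ℕ) (c : ℕ → ℂ) (N : ℕ) (s : ℂ) : ℂ :=
  mellin (mellinRemainder F d c N) s + ∑ k ∈ Finset.range N, c k * (1 / (s + ((k : ℂ) - d) / 2))

/-- The meromorphic continuation of the Mellin transform of `F`. -/
noncomputable def mellinContinuation (F : ℝ → ℂ) (d : ℕ) (c : ℕ → ℂ) (s : ℂ) : ℂ :=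
  mellinPartial F d c (⌈(d : ℝ) - 2 * s.re⌉₊ + 1) s

namespace HasMellinExpansion

variable {F : ℝ → ℂ} {d : ℕ} {c : ℕ → ℂ}

theorem locallyIntegrableOn_mellinRemainder (h : HasMellinExpansion F d c) (N : ℕ) :
    LocallyIntegrableOn (mellinRemainder F d c N) (Set.Ioi 0) := by
  rw [locallyIntegrableOn_iff (isOpen_Ioi.isLocallyClosed)]
  intro K hK hKc
  have h2 : ∀ k : ℕ, ContinuousOn (fun t : ℝ => (t : ℂ) ^ (((k : ℂ) - d) / 2)) K := fun k t ht =>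
    (Complex.continuousAt_ofReal_cpow_const t _ (Or.inr (ne_of_gt (hK ht)))).continuousWithinAt
  exact (h.locallyIntegrableOn.integrableOn_compact_subset hK hKc).sub
    (integrable_finsetSum _ fun k _ =>
      (((h2 k).integrableOn_compact hKc).indicator measurableSet_Ioc).const_mul (c k))

theorem mellinRemainder_isBigO_atTop (h : HasMellinExpansion F d c) (a : ℝ) (N : ℕ) :
    mellinRemainder F d c N =O[atTop] (· ^ (-a)) := by
  refine (h.isBigO_atTop a).congr' ?_ EventuallyEq.rfl
  filter_upwards [eventually_gt_atTop 1] with τ hτ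
  rw [mellinRemainder, Finset.sum_eq_zero fun k _ => ?_, sub_zero]
  rw [Set.indicator_of_notMem (fun h => not_lt.2 h.2 hτ), mul_zero]

theorem mellinRemainder_isBigO_zero (h : HasMellinExpansion F d c) (N : ℕ) :
    mellinRemainder F d c N =O[𝓝[>] 0] fun τ : ℝ => τ ^ (-(((d : ℝ) - N) / 2)) := by
  refine (h.isBigO_zero N).congr' ?_ (Eventually.of_forall fun τ => by rw [← neg_div, neg_sub])
  filter_upwards [Ioc_mem_nhdsGT (zero_lt_one' ℝ)] with τ hτ
  rw [mellinRemainder]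
  congr 1
  exact Finset.sum_congr rfl fun k _ => by rw [Set.indicator_of_mem hτ]

theorem mellinConvergent_mellinRemainder (h : HasMellinExpansion F d c) {N : ℕ} {s : ℂ}
    (hs : ((d : ℝ) - N) / 2 < s.re) : MellinConvergent (mellinRemainder F d c N) s :=
  mellinConvergent_of_isBigO_rpow (h.locallyIntegrableOn_mellinRemainder N)
    (h.mellinRemainder_isBigO_atTop _ N) (lt_add_one s.re) (h.mellinRemainder_isBigO_zero N) hs

theorem analyticAt_mellin_mellinRemainder (h : HasMellinExpansion F d c) {N : ℕ} {s : ℂ}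
    (hs : ((d : ℝ) - N) / 2 < s.re) : AnalyticAt ℂ (mellin (mellinRemainder F d c N)) s := by
  have ho : IsOpen {z : ℂ | ((d : ℝ) - N) / 2 < z.re} :=
    isOpen_lt continuous_const Complex.continuous_re
  refine DifferentiableOn.analyticAt (s := {z : ℂ | ((d : ℝ) - N) / 2 < z.re})
    (fun z hz => DifferentiableAt.differentiableWithinAt ?_) (ho.mem_nhds hs)
  exact mellin_differentiableAt_of_isBigO_rpow (h.locallyIntegrableOn_mellinRemainder N)
    (h.mellinRemainder_isBigO_atTop _ N) (lt_add_one z.re) (h.mellinRemainder_isBigO_zero N) hz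

/-- The power `τ^((N-d)/2)` cut off to `(0, 1]` has Mellin transform `1 / (s + (N-d)/2)`, so the
subtracted term and the added fraction cancel. -/
theorem mellinPartial_succ (h : HasMellinExpansion F d c) {N : ℕ} {s : ℂ}
    (hs : ((d : ℝ) - N) / 2 < s.re) : mellinPartial F d c (N + 1) s = mellinPartial F d c N s := by
  have h1 : 0 < s.re + (((N : ℂ) - d) / 2).re := by
    have : (((N : ℂ) - d) / 2).re = ((N : ℝ) - d) / 2 := by
      rw [Complex.div_ofNat_re]; simp
    rw [this]; linarith
  have h2 := hasMellin_cpow_Ioc (((N : ℂ) - d) / 2) h1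
  have h3 := (hasMellin_sub (h.mellinConvergent_mellinRemainder hs) (h2.1.const_smul (c N))).2
  have h4 : mellinRemainder F d c (N + 1) = fun τ => mellinRemainder F d c N τ -
      c N • (Set.Ioc (0 : ℝ) 1).indicator (fun t : ℝ => (t : ℂ) ^ (((N : ℂ) - d) / 2)) τ := by
    funext τ
    simp only [mellinRemainder, Finset.sum_range_succ, smul_eq_mul]
    ring
  rw [mellinPartial, mellinPartial, Finset.sum_range_succ, h4, h3, mellin_const_smul, h2.2,
    smul_eq_mul]
  ring

theorem mellinPartial_eq_of_le (h : HasMellinExpansion F d c) {N N' : ℕ} (hN : N ≤ N') {s : ℂ}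
    (hs : ((d : ℝ) - N) / 2 < s.re) : mellinPartial F d c N' s = mellinPartial F d c N s := by
  induction N', hN using Nat.le_induction with
  | base => rfl
  | succ n hn ih =>
    rw [← ih]
    refine h.mellinPartial_succ (lt_of_le_of_lt ?_ hs)
    have : (N : ℝ) ≤ n := by exact_mod_cast hn
    linarith

/-- The number of terms in the definition jumps with `s`. Independence of that number makes the
continuation locally equal to a single `mellinPartial`, from which analyticity and poles are read
off. -/
theorem mellinContinuation_eq_mellinPartial (h : HasMellinExpansion F d c) {N : ℕ} {s : ℂ}
    (hs : ((d : ℝ) - N) / 2 < s.re) : mellinContinuation F d c s = mellinPartial F d c N s := by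
  rw [mellinContinuation]
  -- The `+ 1` in the definition makes this inequality strict.
  have h1 : ((d : ℝ) - (⌈(d : ℝ) - 2 * s.re⌉₊ + 1 : ℕ)) / 2 < s.re := by
    have := Nat.le_ceil ((d : ℝ) - 2 * s.re)
    push_cast
    linarith
  rcases le_total N (⌈(d : ℝ) - 2 * s.re⌉₊ + 1) with hle | hle
  · exact h.mellinPartial_eq_of_le hle hs
  · exact (h.mellinPartial_eq_of_le hle h1).symm

theorem mellinContinuation_eq_mellin (h : HasMellinExpansion F d c) {s : ℂ}
    (hs : (d : ℝ) / 2 < s.re) : mellinContinuation F d c s = mellin F s := by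
  rw [h.mellinContinuation_eq_mellinPartial (N := 0) (by simpa using hs), mellinPartial]
  simp [show mellinRemainder F d c 0 = F from funext fun τ => by simp [mellinRemainder]]

theorem eventuallyEq_mellinPartial (h : HasMellinExpansion F d c) {N : ℕ} {s : ℂ}
    (hs : ((d : ℝ) - N) / 2 < s.re) :
    mellinContinuation F d c =ᶠ[𝓝 s] mellinPartial F d c N := by
  have ho : IsOpen {z : ℂ | ((d : ℝ) - N) / 2 < z.re} :=
    isOpen_lt continuous_const Complex.continuous_re
  filter_upwards [ho.mem_nhds hs] with z hz using h.mellinContinuation_eq_mellinPartial hz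

theorem analyticAt_mellinContinuation (h : HasMellinExpansion F d c) {s : ℂ}
    (hs : ∀ k : ℕ, s ≠ ((d : ℂ) - k) / 2) : AnalyticAt ℂ (mellinContinuation F d c) s := by
  obtain ⟨N, hN⟩ := exists_nat_gt ((d : ℝ) - 2 * s.re)
  have hN' : ((d : ℝ) - N) / 2 < s.re := by linarith
  refine AnalyticAt.congr ?_ (h.eventuallyEq_mellinPartial hN').symm
  refine (h.analyticAt_mellin_mellinRemainder hN').add
    (Finset.analyticAt_fun_sum _ fun k _ => ?_)
  refine analyticAt_const.mul (analyticAt_const.div (analyticAt_id.add analyticAt_const) ?_)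
  intro h0
  exact hs k (by linear_combination h0)

/-- The continued Mellin transform has at most a simple pole at `(d - k) / 2`. -/
theorem exists_eq_div_mellinContinuation (h : HasMellinExpansion F d c) (k : ℕ) :
    ∃ g : ℂ → ℂ, AnalyticAt ℂ g (((d : ℂ) - k) / 2) ∧
      ∀ᶠ s in 𝓝[≠] (((d : ℂ) - k) / 2),
        mellinContinuation F d c s = g s / (s - ((d : ℂ) - k) / 2) := by
  set s₀ : ℂ := ((d : ℂ) - k) / 2 with hs₀
  have hs₀re : s₀.re = ((d : ℝ) - k) / 2 := by
    rw [hs₀, Complex.div_ofNat_re]; simp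
  have hN' : ((d : ℝ) - (k + 1 : ℕ)) / 2 < s₀.re := by
    rw [hs₀re]; push_cast; linarith
  -- With `k + 1` terms the last fraction is the only one singular at `s₀`; its numerator `c k` is
  -- left after multiplication by `s - s₀`.
  refine ⟨fun s => (mellin (mellinRemainder F d c (k + 1)) s +
    ∑ j ∈ Finset.range k, c j * (1 / (s + ((j : ℂ) - d) / 2))) * (s - s₀) + c k, ?_, ?_⟩
  · refine (((h.analyticAt_mellin_mellinRemainder hN').add
      (Finset.analyticAt_fun_sum _ fun j hj => ?_)).mul
      (analyticAt_id.sub analyticAt_const)).add analyticAt_const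
    refine analyticAt_const.mul (analyticAt_const.div (analyticAt_id.add analyticAt_const) ?_)
    intro h0
    have h1 : (j : ℂ) = k := by
      simp only [hs₀] at h0
      linear_combination 2 * h0
    exact (Finset.mem_range.1 hj).ne (by exact_mod_cast h1)
  · filter_upwards [(h.eventuallyEq_mellinPartial hN').filter_mono nhdsWithin_le_nhds,
      self_mem_nhdsWithin] with s hs hne
    have hne' : s - s₀ ≠ 0 := sub_ne_zero.2 hne
    rw [hs, mellinPartial, Finset.sum_range_succ,
      show s + ((k : ℂ) - d) / 2 = s - s₀ by rw [hs₀]; ring,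
      ← add_assoc, add_div, mul_div_cancel_right₀ _ hne', mul_one_div]

end HasMellinExpansion

/-! ### The Crandall function as an incomplete Mellin transform. -/

section UpperMellin

theorem locallyIntegrableOn_indicator_Ioi_one {f : ℝ → ℂ}
    (hf : LocallyIntegrableOn f (Set.Ioi 0)) :
    LocallyIntegrableOn ((Set.Ioi (1 : ℝ)).indicator f) (Set.Ioi 0) := by
  rw [locallyIntegrableOn_iff (isOpen_Ioi.isLocallyClosed)]
  intro K hK hKc
  exact (hf.integrableOn_compact_subset hK hKc).indicator measurableSet_Ioi

theorem indicator_Ioi_one_isBigO_atTop {f : ℝ → ℂ} {a : ℝ} (hf : f =O[atTop] (· ^ (-a))) :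
    (Set.Ioi (1 : ℝ)).indicator f =O[atTop] (· ^ (-a)) := by
  refine hf.congr' ?_ EventuallyEq.rfl
  filter_upwards [eventually_gt_atTop 1] with τ hτ
  rw [Set.indicator_of_mem (show τ ∈ Set.Ioi (1 : ℝ) from hτ)]

theorem indicator_Ioi_one_isBigO_zero (f : ℝ → ℂ) (b : ℝ) :
    (Set.Ioi (1 : ℝ)).indicator f =O[𝓝[>] 0] (· ^ (-b)) := by
  refine (Asymptotics.isBigO_zero (fun τ : ℝ => τ ^ (-b)) (𝓝[>] 0)).congr' ?_ EventuallyEq.rfl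
  filter_upwards [Ioc_mem_nhdsGT (zero_lt_one' ℝ)] with τ hτ
  rw [Set.indicator_of_notMem (show τ ∉ Set.Ioi (1 : ℝ) from not_lt.2 hτ.2)]

/-- The part over `(1, ∞)` of the Mellin transform of a rapidly decaying function converges
everywhere. -/
theorem mellinConvergent_indicator_Ioi_one {f : ℝ → ℂ} (hf : LocallyIntegrableOn f (Set.Ioi 0))
    (hO : ∀ a : ℝ, f =O[atTop] (· ^ (-a))) (s : ℂ) :
    MellinConvergent ((Set.Ioi (1 : ℝ)).indicator f) s :=
  mellinConvergent_of_isBigO_rpow (locallyIntegrableOn_indicator_Ioi_one hf)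
    (indicator_Ioi_one_isBigO_atTop (hO _)) (lt_add_one s.re)
    (indicator_Ioi_one_isBigO_zero f (s.re - 1)) (sub_one_lt s.re)

theorem differentiable_mellin_indicator_Ioi_one {f : ℝ → ℂ}
    (hf : LocallyIntegrableOn f (Set.Ioi 0)) (hO : ∀ a : ℝ, f =O[atTop] (· ^ (-a))) :
    Differentiable ℂ (mellin ((Set.Ioi (1 : ℝ)).indicator f)) := fun s =>
  mellin_differentiableAt_of_isBigO_rpow (locallyIntegrableOn_indicator_Ioi_one hf)
    (indicator_Ioi_one_isBigO_atTop (hO _)) (lt_add_one s.re)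
    (indicator_Ioi_one_isBigO_zero f (s.re - 1)) (sub_one_lt s.re)

theorem isBigO_exp_neg_mul_atTop {b : ℝ} (hb : 0 < b) (a : ℝ) :
    (fun τ : ℝ => ((Real.exp (-b * τ) : ℝ) : ℂ)) =O[atTop] (· ^ (-a)) := by
  refine Asymptotics.IsBigO.of_norm_left ?_
  refine ((isLittleO_exp_neg_mul_rpow_atTop hb (-a)).isBigO.norm_left).congr_left fun τ => ?_
  rw [Complex.norm_real]

end UpperMellin

theorem locallyIntegrableOn_exp_neg_mul (b : ℝ) :
    LocallyIntegrableOn (fun τ : ℝ => ((Real.exp (-b * τ) : ℝ) : ℂ)) (Set.Ioi 0) :=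
  ((by fun_prop : Continuous fun τ : ℝ => ((Real.exp (-b * τ) : ℝ) : ℂ)).locallyIntegrable).locallyIntegrableOn _

theorem integral_neg_one_one_of_even {f : ℝ → ℂ} (heven : ∀ t, f (-t) = f t)
    (hf : IntegrableOn f (Set.Ioc 0 1)) :
    ∫ t in (-1 : ℝ)..1, f t = 2 * ∫ t in Set.Ioc (0 : ℝ) 1, f t := by
  have h1 : IntervalIntegrable f volume 0 1 :=
    (intervalIntegrable_iff_integrableOn_Ioc_of_le zero_le_one).2 hf
  have h2 : IntervalIntegrable f volume (-1) 0 := by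
    rw [IntervalIntegrable.iff_comp_neg]
    simpa [heven] using h1.symm
  rw [← intervalIntegral.integral_add_adjacent_intervals h2 h1]
  have h3 : ∫ t in (-1 : ℝ)..0, f t = ∫ t in (0 : ℝ)..1, f t := by
    have := intervalIntegral.integral_comp_neg (a := (0 : ℝ)) (b := 1) f
    rw [neg_zero] at this
    rw [← this]
    simp only [heven]
  rw [h3, intervalIntegral.integral_of_le zero_le_one]
  ring

/-- Substitution `τ = t⁻²`, carrying `(0, 1)` to `(1, ∞)`. Its Jacobian factor `1/2` is offset by
the `2` from folding `[-1, 1]` onto `(0, 1]`. -/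
theorem integrableOn_cpow_mul_exp_inv_sq (s : ℂ) {b : ℝ} (hb : 0 < b) :
    IntegrableOn (fun t : ℝ => (t : ℂ) ^ (-s - 1) * (Real.exp (-b * (t ^ 2)⁻¹) : ℝ))
      (Set.Ioc 0 1) ∧
    2 * ∫ t in Set.Ioc (0 : ℝ) 1, (t : ℂ) ^ (-s - 1) * (Real.exp (-b * (t ^ 2)⁻¹) : ℝ) =
      mellin ((Set.Ioi (1 : ℝ)).indicator fun τ : ℝ => ((Real.exp (-b * τ) : ℝ) : ℂ)) (s / 2) := by
  set f : ℝ → ℂ := (Set.Ioi (1 : ℝ)).indicator fun τ : ℝ => ((Real.exp (-b * τ) : ℝ) : ℂ) with hf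
  have h1 : MellinConvergent f (s / 2) := mellinConvergent_indicator_Ioi_one
    (locallyIntegrableOn_exp_neg_mul b) (isBigO_exp_neg_mul_atTop hb) _
  have h2 : (-s) / ((-2 : ℝ) : ℂ) = s / 2 := by push_cast; rw [neg_div_neg_eq]
  have h3 : MellinConvergent (fun t => f (t ^ (-2 : ℝ))) (-s) := by
    rw [MellinConvergent.comp_rpow (by norm_num), h2]; exact h1
  have h4 := mellin_comp_rpow f (-s) (-2)
  have h5 : ∀ t ∈ Set.Ioi (0 : ℝ), (t : ℂ) ^ (-s - 1) • f (t ^ (-2 : ℝ)) =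
      (Set.Ioo (0 : ℝ) 1).indicator (fun t : ℝ => (t : ℂ) ^ (-s - 1) *
        (Real.exp (-b * (t ^ 2)⁻¹) : ℝ)) t := by
    intro t ht
    have ht' : (0 : ℝ) < t := ht
    have h6 : t ^ (-2 : ℝ) = (t ^ 2)⁻¹ := by
      rw [Real.rpow_neg ht'.le]; norm_num
    rw [h6, smul_eq_mul, hf]
    have ht2 : (0 : ℝ) < t ^ 2 := pow_pos ht' 2
    by_cases h7 : t < 1
    · have h8 : (t ^ 2)⁻¹ ∈ Set.Ioi (1 : ℝ) := (one_lt_inv₀ ht2).2 (by nlinarith)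
      rw [Set.indicator_of_mem h8, Set.indicator_of_mem (show t ∈ Set.Ioo (0 : ℝ) 1 from ⟨ht', h7⟩)]
    · have h8 : (t ^ 2)⁻¹ ∉ Set.Ioi (1 : ℝ) := fun h => by
        have := (one_lt_inv₀ ht2).1 h
        nlinarith [not_lt.1 h7]
      have h9 : t ∉ Set.Ioo (0 : ℝ) 1 := fun h => h7 h.2
      rw [Set.indicator_of_notMem h8, Set.indicator_of_notMem h9, mul_zero]
  have hsub : Set.Ioo (0 : ℝ) 1 ⊆ Set.Ioi 0 := fun t ht => ht.1
  constructor
  · rw [integrableOn_Ioc_iff_integrableOn_Ioo]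
    have h6 := (integrableOn_congr_fun h5 measurableSet_Ioi).1 h3
    rw [integrableOn_indicator_iff measurableSet_Ioo] at h6
    exact (h6.mono_set (by intro t ht; exact ⟨ht, hsub ht⟩))
  · rw [h2, mellin, setIntegral_congr_fun measurableSet_Ioi h5,
      setIntegral_indicator measurableSet_Ioo, Set.inter_eq_self_of_subset_right hsub,
      ← integral_Ioc_eq_integral_Ioo] at h4
    rw [h4, Complex.real_smul]
    norm_num
    ring

theorem crandallG_of_ne_zero {d : ℕ} (ν : ℂ) {z : Euc d} (hz : z ≠ 0) :
    crandallG ν z = 2 * ∫ t in Set.Ioc (0 : ℝ) 1, (t : ℂ) ^ (-ν - 1) *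
      (Real.exp (-(Real.pi * ‖z‖ ^ 2) * (t ^ 2)⁻¹) : ℝ) := by
  rw [crandallG, if_neg hz]
  have hb : 0 < Real.pi * ‖z‖ ^ 2 := by
    have := norm_pos_iff.2 hz
    have := Real.pi_pos
    positivity
  have heq : ∀ t ∈ Set.Ioc (0 : ℝ) 1, (t : ℂ) ^ (-ν - 1) *
      (Real.exp (-(Real.pi * ‖z‖ ^ 2) * (t ^ 2)⁻¹) : ℝ) = ((|t| : ℝ) : ℂ) ^ (-ν) *
        Complex.exp (-Real.pi * (‖z‖ : ℂ) ^ 2 / (t : ℂ) ^ 2) / ((|t| : ℝ) : ℂ) := by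
    intro t ht
    rw [abs_of_pos ht.1, Complex.cpow_sub _ _ (by exact_mod_cast ht.1.ne'), Complex.cpow_one]
    push_cast
    rw [div_mul_eq_mul_div]
    congr 3
    ring
  rw [integral_neg_one_one_of_even (fun t => by simp only [abs_neg, Complex.ofReal_neg, neg_sq])]
  · rw [setIntegral_congr_fun measurableSet_Ioc heq]
  · exact (integrableOn_congr_fun heq measurableSet_Ioc).1 (integrableOn_cpow_mul_exp_inv_sq ν hb).1

theorem crandallG_eq_mellin {d : ℕ} (ν : ℂ) {z : Euc d} (hz : z ≠ 0) :
    crandallG ν z = mellin ((Set.Ioi (1 : ℝ)).indicator fun τ : ℝ =>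
      ((Real.exp (-(Real.pi * ‖z‖ ^ 2) * τ) : ℝ) : ℂ)) (ν / 2) := by
  have := norm_pos_iff.2 hz
  have := Real.pi_pos
  rw [crandallG_of_ne_zero ν hz, (integrableOn_cpow_mul_exp_inv_sq ν (by positivity)).2]

/-! ### The Gaussian sum over nonzero points and its Mellin transforms. -/

theorem planeWave_zero {d : ℕ} (y : Euc d) : planeWave y 0 = 1 := by
  simp [planeWave]

/-- The number of points of the corner at the origin (`0` or `1`). -/
noncomputable def cornerOrigin {d : ℕ} (A : Matrix (Fin d) (Fin d) ℝ) (x : Euc d) : ℂ :=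
  ∑' z : corner A x, if ‖(z : Euc d)‖ = 0 then 1 else 0

theorem hasSum_cornerOrigin {d : ℕ} (A : Matrix (Fin d) (Fin d) ℝ) (x : Euc d) :
    HasSum (fun z : corner A x => if ‖(z : Euc d)‖ = 0 then (1 : ℂ) else 0)
      (cornerOrigin A x) := by
  refine Summable.hasSum (summable_of_hasFiniteSupport ?_)
  refine Set.Finite.subset (Set.Finite.preimage Subtype.val_injective.injOn
    (Set.finite_singleton (0 : Euc d))) fun z hz => ?_
  by_contra h
  exact hz (if_neg fun h0 => h (norm_eq_zero.1 h0))

/-- The Gaussian sum over the nonzero points of the corner. -/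
noncomputable def puncturedTheta {d : ℕ} (A : Matrix (Fin d) (Fin d) ℝ) (x y : Euc d) (τ : ℝ) :
    ℂ :=
  cornerTheta A x y τ - cornerOrigin A x

/-- The origin contributes a constant, which would spoil the decay at infinity. The condition `‖z‖ =
0` has the form in which `hasSum_mellin_pi_mul_sq` expects its terms. -/
theorem hasSum_puncturedTheta {d : ℕ} {A : Matrix (Fin d) (Fin d) ℝ} (hA : A.det ≠ 0)
    (x y : Euc d) {τ : ℝ} (hτ : 0 < τ) :
    HasSum (fun z : corner A x => if ‖(z : Euc d)‖ = 0 then 0 else planeWave y (z : Euc d) *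
      (Real.exp (-Real.pi * ‖(z : Euc d)‖ ^ 2 * τ) : ℝ)) (puncturedTheta A x y τ) := by
  refine ((hasSum_cornerTheta hA x y hτ).sub (hasSum_cornerOrigin A x)).congr_fun fun z => ?_
  by_cases hz : ‖(z : Euc d)‖ = 0
  · have hz' : (z : Euc d) = 0 := norm_eq_zero.1 hz
    simp [hz', planeWave_zero]
  · simp [hz]

theorem continuousOn_puncturedTheta {d : ℕ} {A : Matrix (Fin d) (Fin d) ℝ} (hA : A.det ≠ 0)
    (x y : Euc d) : ContinuousOn (puncturedTheta A x y) (Set.Ioi 0) := by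
  refine ContinuousOn.sub ?_ continuousOn_const
  intro τ₀ hτ₀
  have hτ₀' : (0 : ℝ) < τ₀ := hτ₀
  have h : ContinuousOn (cornerTheta A x y) (Set.Ioi (τ₀ / 2)) := by
    refine continuousOn_tsum (u := fun z : corner A x =>
      Real.exp (-(Real.pi * (τ₀ / 2)) * ‖(z : Euc d)‖ ^ 2)) (fun z => by fun_prop)
      (summable_corner_gaussian hA x (by have := Real.pi_pos; positivity)) fun z τ hτ => ?_
    rw [norm_mul, norm_planeWave, one_mul, Complex.norm_real,
      Real.norm_of_nonneg (Real.exp_pos _).le]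
    refine Real.exp_le_exp.2 ?_
    have h1 : (0 : ℝ) ≤ Real.pi * ‖(z : Euc d)‖ ^ 2 := by have := Real.pi_pos; positivity
    have h2 : τ₀ / 2 ≤ τ := le_of_lt hτ
    nlinarith
  exact (h.continuousAt (Ioi_mem_nhds (by linarith))).continuousWithinAt

/-- For `τ ≥ 1` and `‖z‖ ≥ ρ`, writing `τ = 1 + (τ - 1)` gives `exp(-π‖z‖²τ) ≤ exp(-π‖z‖²)
exp(-πρ²(τ - 1))`, and the first factor is summable. -/
theorem puncturedTheta_isBigO_atTop {d : ℕ} {A : Matrix (Fin d) (Fin d) ℝ} (hA : A.det ≠ 0)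
    (x y : Euc d) (a : ℝ) : puncturedTheta A x y =O[atTop] (· ^ (-a)) := by
  obtain ⟨ρ, hρ, hρb⟩ := exists_norm_lower_bound_corner hA x
  have hpi := Real.pi_pos
  have h1 : puncturedTheta A x y =O[atTop] fun τ => Real.exp (-(Real.pi * ρ ^ 2) * τ) := by
    refine Asymptotics.IsBigO.of_bound ((∑' z : corner A x, Real.exp (-Real.pi *
      ‖(z : Euc d)‖ ^ 2)) * Real.exp (Real.pi * ρ ^ 2)) ?_
    filter_upwards [eventually_ge_atTop 1] with τ hτ
    have hsum := (hasSum_puncturedTheta hA x y (one_pos.trans_le hτ)).tsum_eq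
    rw [← hsum, Real.norm_of_nonneg (Real.exp_pos _).le]
    refine tsum_of_norm_bounded
      (((summable_corner_gaussian hA x hpi).hasSum.mul_right _).mul_right _) fun z => ?_
    split_ifs with hz
    · rw [norm_zero]; positivity
    · have hz' := hρb z fun h => hz (by rw [h, norm_zero])
      rw [norm_mul, norm_planeWave, one_mul, Complex.norm_real,
        Real.norm_of_nonneg (Real.exp_pos _).le, ← Real.exp_add, ← Real.exp_add]
      refine Real.exp_le_exp.2 ?_
      have h2 : ρ ^ 2 ≤ ‖(z : Euc d)‖ ^ 2 := by gcongr
      have h3 : 0 ≤ Real.pi * ((‖(z : Euc d)‖ ^ 2 - ρ ^ 2) * (τ - 1)) :=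
        mul_nonneg hpi.le (mul_nonneg (by linarith) (by linarith))
      linarith
  exact h1.trans (isLittleO_exp_neg_mul_rpow_atTop (by positivity) (-a)).isBigO

theorem sq_cpow_half {t : ℝ} (ht : 0 < t) (k d : ℕ) :
    ((t ^ 2 : ℝ) : ℂ) ^ (((k : ℂ) - d) / 2) = (t : ℂ) ^ k / (t : ℂ) ^ d := by
  have ht0 : (t : ℂ) ≠ 0 := by exact_mod_cast ht.ne'
  have h1 : ((t ^ 2 : ℝ) : ℂ) ^ (((k : ℂ) - d) / 2) = (t : ℂ) ^ ((k : ℂ) - d) := by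
    rw [Complex.cpow_def_of_ne_zero (by exact_mod_cast (pow_pos ht 2).ne'),
      Complex.cpow_def_of_ne_zero ht0, ← Complex.ofReal_log (by positivity),
      ← Complex.ofReal_log ht.le, Real.log_pow]
    congr 1
    push_cast
    ring
  rw [h1, Complex.cpow_sub _ _ ht0, Complex.cpow_natCast, Complex.cpow_natCast]

theorem sq_rpow_half {t : ℝ} (ht : 0 < t) (k d : ℕ) :
    (t ^ 2) ^ (((k : ℝ) - d) / 2) = t ^ k / t ^ d := by
  rw [← Real.rpow_natCast t 2, ← Real.rpow_mul ht.le, show ((2 : ℕ) : ℝ) * (((k : ℝ) - d) / 2) =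
    k - d by push_cast; ring, Real.rpow_sub ht, Real.rpow_natCast, Real.rpow_natCast]

theorem exists_hasMellinExpansion_puncturedTheta {d : ℕ} {A : Matrix (Fin d) (Fin d) ℝ}
    (hA : A.det ≠ 0) (x y : Euc d) :
    ∃ c : ℕ → ℂ, HasMellinExpansion (puncturedTheta A x y) d c := by
  obtain ⟨c, hc⟩ := exists_expansion_cornerTheta hA x y
  -- The expansion is that of the full sum under `τ = t²`; removing the origin changes only the
  -- coefficient of `τ^0`, that is `k = d`.
  refine ⟨fun k => c k - if k = d then cornerOrigin A x else 0, ?_,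
    puncturedTheta_isBigO_atTop hA x y, fun N => ?_⟩
  · exact (continuousOn_puncturedTheta hA x y).locallyIntegrableOn measurableSet_Ioi
  obtain ⟨C, hC⟩ := hc N
  refine Asymptotics.IsBigO.of_bound (C + ‖cornerOrigin A x‖) ?_
  filter_upwards [Ioc_mem_nhdsGT (zero_lt_one' ℝ)] with τ hτ
  obtain ⟨t, ht, ht1, rfl⟩ : ∃ t : ℝ, 0 < t ∧ t ≤ 1 ∧ τ = t ^ 2 :=
    ⟨√τ, Real.sqrt_pos.2 hτ.1, Real.sqrt_le_one.2 hτ.2, (Real.sq_sqrt hτ.1.le).symm⟩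
  have ht0 : (t : ℂ) ^ d ≠ 0 := pow_ne_zero _ (by exact_mod_cast ht.ne')
  have h1 := hC t ht ht1
  simp only [sq_cpow_half ht, sq_rpow_half ht]
  set S := ∑ k ∈ Finset.range N, c k * (t : ℂ) ^ k with hS
  have h2 : ∑ k ∈ Finset.range N, (c k - if k = d then cornerOrigin A x else 0) *
      ((t : ℂ) ^ k / (t : ℂ) ^ d) = S / (t : ℂ) ^ d -
        if d < N then cornerOrigin A x else 0 := by
    simp only [sub_mul, Finset.sum_sub_distrib, hS, Finset.sum_div, mul_div_assoc]
    congr 1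
    simp only [ite_mul, zero_mul, Finset.sum_ite_eq', Finset.mem_range, div_self ht0, mul_one]
  have h3 : puncturedTheta A x y (t ^ 2) - (S / (t : ℂ) ^ d -
      if d < N then cornerOrigin A x else 0) =
      ((t : ℂ) ^ d * cornerTheta A x y (t ^ 2) - S) / (t : ℂ) ^ d -
        (if d < N then 0 else cornerOrigin A x) := by
    rw [puncturedTheta, sub_div, mul_div_cancel_left₀ _ ht0]
    split_ifs <;> ring
  rw [h2, h3, Real.norm_of_nonneg (by positivity), add_mul]
  refine (norm_sub_le _ _).trans (add_le_add ?_ ?_)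
  · rw [norm_div, norm_pow, Complex.norm_real, Real.norm_of_nonneg ht.le, mul_div_assoc']
    gcongr
  -- If `N ≤ d`, the constant is not among the subtracted terms, but it is then within the error
  -- because `t ^ N / t ^ d ≥ 1`.
  · split_ifs with hd
    · rw [norm_zero]; positivity
    · refine le_mul_of_one_le_right (norm_nonneg _) ?_
      rw [one_le_div (by positivity)]
      exact pow_le_pow_of_le_one ht.le ht1 (not_lt.1 hd)

/-- The series may run over the whole corner: since `ν ≠ 0`, the term at the origin has denominator
`0 ^ ν = 0` and its value is `0` by default. -/
theorem hasSum_mellin_puncturedTheta {d : ℕ} {A : Matrix (Fin d) (Fin d) ℝ} (hA : A.det ≠ 0)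
    (x y : Euc d) {ν : ℂ} (hν : (d : ℝ) < ν.re) :
    HasSum (fun z : corner A x => Complex.Gammaℝ ν * zetaTerm ν y (z : Euc d))
      (mellin (puncturedTheta A x y) (ν / 2)) := by
  have h0 : 0 < ν.re := lt_of_le_of_lt (Nat.cast_nonneg d) hν
  have h := hasSum_mellin_pi_mul_sq (a := fun z : corner A x => planeWave y (z : Euc d))
    (r := fun z : corner A x => ‖(z : Euc d)‖) (F := puncturedTheta A x y) h0
    (fun τ hτ => hasSum_puncturedTheta hA x y hτ) (by
      refine (summable_corner_rpow hA x hν).congr fun z => ?_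
      rw [norm_planeWave, abs_norm, Real.rpow_neg (norm_nonneg _), one_div])
  refine h.congr_fun fun z => ?_
  rw [zetaTerm, mul_div_assoc, abs_norm]

/-- Summation of the Crandall function over the nonzero points of the corner. -/
theorem hasSum_crandallG_puncturedTheta {d : ℕ} {A : Matrix (Fin d) (Fin d) ℝ} (hA : A.det ≠ 0)
    (x y : Euc d) {l : ℝ} (hl : 0 < l) (ν : ℂ) :
    HasSum (fun z : corner A x => if ‖(z : Euc d)‖ = 0 then 0 else
      planeWave y (z : Euc d) * crandallG ν (l⁻¹ • (z : Euc d)))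
      (mellin ((Set.Ioi (1 : ℝ)).indicator fun τ => puncturedTheta A x y (l⁻¹ ^ 2 * τ))
        (ν / 2)) := by
  obtain ⟨ρ, hρ, hρb⟩ := exists_norm_lower_bound_corner hA x
  have hpi := Real.pi_pos
  set κ : ℝ := l⁻¹ ^ 2 with hκ
  have hκ0 : 0 < κ := by positivity
  let s : ℂ := ν / 2
  let G : corner A x → ℝ → ℂ := fun z => (Set.Ioi (1 : ℝ)).indicator fun τ : ℝ =>
    if ‖(z : Euc d)‖ = 0 then 0 else planeWave y (z : Euc d) *
      (Real.exp (-Real.pi * ‖(z : Euc d)‖ ^ 2 * (κ * τ)) : ℝ)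
  -- Half of the Gaussian exponent is kept for summing over `z`, using `τ > 1`; the other half gives
  -- decay in `τ`, using `‖z‖ ≥ ρ`.
  let b : ℝ := Real.pi * ρ ^ 2 * κ / 2
  have hb : 0 < b := by positivity
  let B : ℝ → ℂ := (Set.Ioi (1 : ℝ)).indicator fun τ : ℝ => ((Real.exp (-b * τ) : ℝ) : ℂ)
  have hB : MellinConvergent B s := mellinConvergent_indicator_Ioi_one
    (locallyIntegrableOn_exp_neg_mul b) (isBigO_exp_neg_mul_atTop hb) s
  have hGB : ∀ z τ, ‖G z τ‖ ≤
      Real.exp (-(Real.pi * κ / 2) * ‖(z : Euc d)‖ ^ 2) * ‖B τ‖ := by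
    intro z τ
    by_cases hτ : τ ∈ Set.Ioi (1 : ℝ)
    · have hτ1 : (1 : ℝ) < τ := hτ
      simp only [G, B, Set.indicator_of_mem hτ]
      split_ifs with hz
      · rw [norm_zero]; positivity
      · have hz' := hρb z fun h => hz (by rw [h, norm_zero])
        rw [norm_mul, norm_planeWave, one_mul, Complex.norm_real, Complex.norm_real,
          Real.norm_of_nonneg (Real.exp_pos _).le, Real.norm_of_nonneg (Real.exp_pos _).le,
          ← Real.exp_add]
        refine Real.exp_le_exp.2 ?_
        have h2 : ρ ^ 2 ≤ ‖(z : Euc d)‖ ^ 2 := by gcongr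
        have h3 : 0 ≤ Real.pi * κ / 2 * ((‖(z : Euc d)‖ ^ 2 - ρ ^ 2) * τ) :=
          mul_nonneg (by positivity) (mul_nonneg (by linarith) (by linarith))
        have h4 : 0 ≤ Real.pi * κ / 2 * (‖(z : Euc d)‖ ^ 2 * (τ - 1)) :=
          mul_nonneg (by positivity) (mul_nonneg (by positivity) (by linarith))
        simp only [b]
        linarith
    · simp only [G, Set.indicator_of_notMem hτ, norm_zero]
      positivity
  have hGm : ∀ z, AEStronglyMeasurable (fun τ : ℝ => (τ : ℂ) ^ (s - 1) • G z τ)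
      (volume.restrict (Set.Ioi 0)) := by
    intro z
    have hc : ContinuousOn (fun t : ℝ => (t : ℂ) ^ (s - 1)) (Set.Ioi 0) := fun t ht =>
      (Complex.continuousAt_ofReal_cpow_const t _
        (Or.inr (show (0 : ℝ) < t from ht).ne')).continuousWithinAt
    refine (hc.aestronglyMeasurable measurableSet_Ioi).smul ?_
    · refine AEStronglyMeasurable.indicator (Continuous.aestronglyMeasurable ?_) measurableSet_Ioi
      split_ifs
      · exact continuous_const
      · fun_prop
  have hGn : ∀ z, ∀ τ : ℝ, ‖(τ : ℂ) ^ (s - 1) • G z τ‖ ≤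
      Real.exp (-(Real.pi * κ / 2) * ‖(z : Euc d)‖ ^ 2) * ‖(τ : ℂ) ^ (s - 1) • B τ‖ := by
    intro z τ
    rw [norm_smul, norm_smul, mul_left_comm]
    exact mul_le_mul_of_nonneg_left (hGB z τ) (norm_nonneg _)
  have hGi : ∀ z, Integrable (fun τ : ℝ => (τ : ℂ) ^ (s - 1) • G z τ)
      (volume.restrict (Set.Ioi 0)) := fun z =>
    (hB.norm.const_mul _).mono' (hGm z) (ae_of_all _ (hGn z))
  have key := hasSum_integral_of_summable_integral_norm hGi (by
    refine Summable.of_nonneg_of_le (fun z => integral_nonneg fun τ => norm_nonneg _)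
      (fun z => ?_) ((summable_corner_gaussian hA x (c := Real.pi * κ / 2)
        (by positivity)).mul_right
        (∫ τ in Set.Ioi (0 : ℝ), ‖(τ : ℂ) ^ (s - 1) • B τ‖))
    rw [← integral_const_mul]
    exact integral_mono (hGi z).norm (hB.norm.const_mul _) (hGn z))
  convert! key using 1
  · funext z
    change _ = mellin (G z) (ν / 2)
    split_ifs with hz
    · have : G z = fun _ => 0 := by
        funext τ
        simp only [G, if_pos hz, Set.indicator_zero]
      rw [this]
      simp [mellin]
    · have hz0 : (z : Euc d) ≠ 0 := fun h => hz (by rw [h, norm_zero])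
      have : G z = fun τ => planeWave y (z : Euc d) • (Set.Ioi (1 : ℝ)).indicator (fun τ : ℝ =>
          ((Real.exp (-(Real.pi * ‖l⁻¹ • (z : Euc d)‖ ^ 2) * τ) : ℝ) : ℂ)) τ := by
        funext τ
        simp only [G, if_neg hz]
        by_cases hτ : τ ∈ Set.Ioi (1 : ℝ)
        · rw [Set.indicator_of_mem hτ, Set.indicator_of_mem hτ, smul_eq_mul, norm_smul,
            Real.norm_of_nonneg (by positivity : (0 : ℝ) ≤ l⁻¹), mul_pow, ← hκ]
          rw [show -Real.pi * ‖(z : Euc d)‖ ^ 2 * (κ * τ) =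
            -(Real.pi * (κ * ‖(z : Euc d)‖ ^ 2)) * τ by ring]
        · rw [Set.indicator_of_notMem hτ, Set.indicator_of_notMem hτ, smul_zero]
      rw [this, mellin_const_smul, smul_eq_mul,
        crandallG_eq_mellin ν (smul_ne_zero (by positivity) hz0)]
  · rw [mellin]
    refine setIntegral_congr_fun measurableSet_Ioi fun τ hτ => ?_
    have hτ' : (0 : ℝ) < τ := hτ
    simp only [smul_eq_mul]
    rw [tsum_mul_left]
    congr 1
    by_cases hτ1 : τ ∈ Set.Ioi (1 : ℝ)
    · simp only [G, Set.indicator_of_mem hτ1]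
      exact (hasSum_puncturedTheta hA x y (by positivity)).tsum_eq.symm
    · simp only [G, Set.indicator_of_notMem hτ1, tsum_zero]

/-- At `ν = 0` the term at the origin is `-2 / 0 = 0`, so the series there is the one with `z = 0`
omitted. -/
theorem hasSum_crandallG_corner {d : ℕ} {A : Matrix (Fin d) (Fin d) ℝ} (hA : A.det ≠ 0)
    (x y : Euc d) {l : ℝ} (hl : 0 < l) (ν : ℂ) :
    HasSum (fun z : corner A x => planeWave y (z : Euc d) * crandallG ν (l⁻¹ • (z : Euc d)))
      (mellin ((Set.Ioi (1 : ℝ)).indicator fun τ => puncturedTheta A x y (l⁻¹ ^ 2 * τ)) (ν / 2) +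
        cornerOrigin A x * (-2 / ν)) := by
  refine ((hasSum_crandallG_puncturedTheta hA x y hl ν).add
    ((hasSum_cornerOrigin A x).mul_right (-2 / ν))).congr_fun fun z => ?_
  by_cases hz : ‖(z : Euc d)‖ = 0
  · have hz' : (z : Euc d) = 0 := norm_eq_zero.1 hz
    simp [hz', planeWave_zero, crandallG]
  · simp [hz]

theorem differentiable_mellin_puncturedTheta_upper {d : ℕ} {A : Matrix (Fin d) (Fin d) ℝ}
    (hA : A.det ≠ 0) (x y : Euc d) {κ : ℝ} (hκ : 0 < κ) :
    Differentiable ℂ (mellin ((Set.Ioi (1 : ℝ)).indicator fun τ =>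
      puncturedTheta A x y (κ * τ))) := by
  refine differentiable_mellin_indicator_Ioi_one ?_ fun a => ?_
  · refine ContinuousOn.locallyIntegrableOn ?_ measurableSet_Ioi
    exact (continuousOn_puncturedTheta hA x y).comp (by fun_prop) fun τ hτ => mul_pos hκ hτ
  · have h1 := (puncturedTheta_isBigO_atTop hA x y a).comp_tendsto
      (tendsto_id.const_mul_atTop hκ)
    refine h1.trans (Asymptotics.IsBigO.of_bound (κ ^ (-a)) ?_)
    filter_upwards [eventually_gt_atTop 0] with τ hτ
    simp only [Function.comp_apply, id]
    rw [Real.mul_rpow hκ.le hτ.le, norm_mul, Real.norm_of_nonneg (by positivity : 0 ≤ κ ^ (-a))]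

/-! ### Mixtures of dilated Schwartz functions and their approximation in `𝓢^k`. -/

theorem gaussian_iteratedFDeriv_decay {V : Type*} [NormedAddCommGroup V] [InnerProductSpace ℝ V]
    {c : ℝ} (hc : 0 < c) (k n : ℕ) : ∃ C : ℝ, ∀ z : V,
      ‖z‖ ^ k * ‖iteratedFDeriv ℝ n (fun z : V => Real.exp (-c * ‖z‖ ^ 2)) z‖ ≤ C := by
  have htg : (fun z : V => -c * ‖z‖ ^ 2).HasTemperateGrowth :=
    (Function.HasTemperateGrowth.const (-c)).mul (Function.hasTemperateGrowth_norm_sq V)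
  obtain ⟨m, K, hK, hb⟩ := htg.norm_iteratedFDeriv_le_uniform n
  obtain ⟨C, hC0, hC⟩ : ∃ C : ℝ, 0 ≤ C ∧ ∀ s : ℝ, 0 ≤ s →
      (1 + s) ^ (k + m * n) * Real.exp (-c * s ^ 2) ≤ C := by
    set N := k + m * n
    -- From `(1 + s)^N ≤ N! exp(1 + s)` and, completing the square, `s - c s² ≤ 1/(4c)`.
    refine ⟨N.factorial * Real.exp (1 + 1 / (4 * c)), by positivity, fun s hs => ?_⟩
    have h2 := Real.pow_div_factorial_le_exp (x := 1 + s) (by positivity) N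
    rw [div_le_iff₀ (by positivity)] at h2
    calc (1 + s) ^ N * Real.exp (-c * s ^ 2)
        ≤ (Real.exp (1 + s) * N.factorial) * Real.exp (-c * s ^ 2) := by gcongr
      _ = N.factorial * Real.exp (1 + s - c * s ^ 2) := by
          rw [mul_comm (Real.exp _), mul_assoc, ← Real.exp_add]; ring_nf
      _ ≤ _ := by
          gcongr
          have h3 : 0 ≤ c * (s - 1 / (2 * c)) ^ 2 := by positivity
          have h4 : c * (s - 1 / (2 * c)) ^ 2 = c * s ^ 2 - s + 1 / (4 * c) := by
            field_simp
            ring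
          linarith
  refine ⟨n.factorial * (K + 1) ^ n * C, fun z => ?_⟩
  have h1 := norm_iteratedFDeriv_comp_le (n := n) (N := ∞) Real.contDiff_exp htg.1
    (by exact_mod_cast le_top) z (C := Real.exp (-c * ‖z‖ ^ 2)) (D := (K + 1) * (1 + ‖z‖) ^ m)
    (fun i _ => by
      rw [norm_iteratedFDeriv_eq_norm_iteratedDeriv, iteratedDeriv_eq_iterate, Real.iter_deriv_exp,
        Real.norm_of_nonneg (Real.exp_pos _).le])
    (fun i hi hin => by
      refine (hb i hin z).trans ?_
      have h2 : (1 : ℝ) ≤ (1 + ‖z‖) ^ m := one_le_pow₀ (by linarith [norm_nonneg z])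
      have h3 : (1 : ℝ) ≤ (K + 1) * (1 + ‖z‖) ^ m := by nlinarith
      refine le_trans ?_ (le_self_pow₀ h3 (by omega))
      nlinarith)
  calc ‖z‖ ^ k * ‖iteratedFDeriv ℝ n (fun z : V => Real.exp (-c * ‖z‖ ^ 2)) z‖
      ≤ (1 + ‖z‖) ^ k * (n.factorial * Real.exp (-c * ‖z‖ ^ 2) *
          ((K + 1) * (1 + ‖z‖) ^ m) ^ n) := by
        gcongr
        · linarith
        · exact h1
    _ = n.factorial * (K + 1) ^ n * ((1 + ‖z‖) ^ (k + m * n) * Real.exp (-c * ‖z‖ ^ 2)) := by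
        rw [mul_pow, pow_add, pow_mul]; ring
    _ ≤ _ := by
        gcongr
        exact hC _ (norm_nonneg z)

/-- The Gaussian `exp (-c |z|²)` as a Schwartz function. -/
noncomputable def gaussianSchwartz (V : Type*) [NormedAddCommGroup V] [InnerProductSpace ℝ V]
    {c : ℝ} (hc : 0 < c) : 𝓢(V, ℂ) where
  toFun z := ((Real.exp (-c * ‖z‖ ^ 2) : ℝ) : ℂ)
  smooth' := Complex.ofRealCLM.contDiff.comp
    (f := fun z : V => Real.exp (-c * ‖z‖ ^ 2)) (contDiff_const.mul (contDiff_norm_sq ℝ)).exp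
  decay' k n := by
    obtain ⟨C, hC⟩ := gaussian_iteratedFDeriv_decay (V := V) hc k n
    refine ⟨C, fun z => ?_⟩
    have h := Complex.ofRealLI.norm_iteratedFDeriv_comp_left (n := ∞) (i := n)
      (f := fun z : V => Real.exp (-c * ‖z‖ ^ 2)) (x := z)
      (contDiff_const.mul (contDiff_norm_sq ℝ)).exp.contDiffAt (by exact_mod_cast le_top)
    exact (congrArg (‖z‖ ^ k * ·) h).trans_le (hC z)

theorem gaussianSchwartz_apply {V : Type*} [NormedAddCommGroup V] [InnerProductSpace ℝ V]
    {c : ℝ} (hc : 0 < c) (z : V) :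
    gaussianSchwartz V hc z = ((Real.exp (-c * ‖z‖ ^ 2) : ℝ) : ℂ) := rfl

section Mixture

variable {V : Type*} [NormedAddCommGroup V] [NormedSpace ℝ V]

/-- The mixture `∫_0^1 w(t) γ((z - y) / t) dt` of dilations of a Schwartz function. -/
noncomputable def dilationMixture (γ : 𝓢(V, ℂ)) (y : V) (w : ℝ → ℂ) (z : V) : ℂ :=
  ∫ t in Set.Ioc (0 : ℝ) 1, w t * γ (t⁻¹ • (z - y))

/-- The weight `w` on `(0, 1]` is integrable against `t^(-k)`. -/
structure IsDilationWeight (k : ℕ) (w : ℝ → ℂ) : Prop where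
  aestronglyMeasurable : AEStronglyMeasurable w (volume.restrict (Set.Ioc 0 1))
  integrableOn : IntegrableOn (fun t => ‖w t‖ * t⁻¹ ^ k) (Set.Ioc 0 1)

theorem IsDilationWeight.of_le {k n : ℕ} {w : ℝ → ℂ} (hw : IsDilationWeight k w) (hn : n ≤ k) :
    IsDilationWeight n w := by
  refine ⟨hw.aestronglyMeasurable, hw.integrableOn.mono' ?_ ?_⟩
  · exact hw.aestronglyMeasurable.norm.mul (by fun_prop)
  · refine (ae_restrict_mem measurableSet_Ioc).mono fun t ht => ?_
    have ht0 : 0 < t⁻¹ := inv_pos.2 ht.1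
    rw [norm_mul, norm_norm, norm_pow, Real.norm_of_nonneg ht0.le]
    exact mul_le_mul_of_nonneg_left (pow_le_pow_right₀ ((one_le_inv₀ ht.1).2 ht.2) hn)
      (norm_nonneg _)

theorem aestronglyMeasurable_dilation_term {k : ℕ} {w : ℝ → ℂ} (hw : IsDilationWeight k w)
    (γ : 𝓢(V, ℂ)) (y z : V) (n : ℕ) :
    AEStronglyMeasurable (fun t : ℝ => (w t * ((t⁻¹ ^ n : ℝ) : ℂ)) •
      iteratedFDeriv ℝ n γ (t⁻¹ • (z - y))) (volume.restrict (Set.Ioc 0 1)) := by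
  have hinv : ContinuousOn (fun t : ℝ => t⁻¹) (Set.Ioc 0 1) :=
    continuousOn_inv₀.mono fun t ht => ht.1.ne'
  refine (hw.aestronglyMeasurable.mul ?_).smul ?_
  · exact (Complex.continuous_ofReal.comp_continuousOn (hinv.pow n)).aestronglyMeasurable
      measurableSet_Ioc
  · exact ((γ.smooth'.continuous_iteratedFDeriv (by exact_mod_cast le_top)).comp_continuousOn
      (hinv.smul continuousOn_const)).aestronglyMeasurable measurableSet_Ioc

/-- A bound for `|z|^m |D^n γ ((z - y) / t)|`. -/
noncomputable def dilationBound (γ : 𝓢(V, ℂ)) (y : V) (m n : ℕ) : ℝ :=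
  2 ^ m * (‖y‖ ^ m * SchwartzMap.seminorm ℝ 0 n γ + SchwartzMap.seminorm ℝ m n γ)

/-- Because `t ≤ 1`, one has `‖z‖ ≤ ‖y‖ + ‖(z - y)/t‖`, so Schwartz seminorms of `γ` control the
left side uniformly in `t`. -/
theorem norm_pow_mul_iteratedFDeriv_dilation_le (γ : 𝓢(V, ℂ)) (y z : V) (m n : ℕ) {t : ℝ}
    (ht : t ∈ Set.Ioc (0 : ℝ) 1) :
    ‖z‖ ^ m * ‖iteratedFDeriv ℝ n γ (t⁻¹ • (z - y))‖ ≤ dilationBound γ y m n := by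
  have h0 := SchwartzMap.le_seminorm ℝ 0 n γ (t⁻¹ • (z - y))
  have hm := SchwartzMap.le_seminorm ℝ m n γ (t⁻¹ • (z - y))
  rw [pow_zero, one_mul] at h0
  set D := ‖iteratedFDeriv ℝ n γ (t⁻¹ • (z - y))‖
  have hD : 0 ≤ D := norm_nonneg _
  have ht1 : 1 ≤ t⁻¹ := (one_le_inv₀ ht.1).2 ht.2
  have h1 : ‖z - y‖ ≤ ‖t⁻¹ • (z - y)‖ := by
    rw [norm_smul, Real.norm_of_nonneg (by linarith)]
    exact le_mul_of_one_le_left (norm_nonneg _) ht1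
  have h2 : ‖z‖ ^ m ≤ 2 ^ m * (‖y‖ ^ m + ‖t⁻¹ • (z - y)‖ ^ m) := by
    have h3 : ‖z‖ ≤ ‖y‖ + ‖t⁻¹ • (z - y)‖ := by
      have := norm_add_le y (z - y)
      rw [add_sub_cancel] at this
      linarith
    have h4 : ‖y‖ + ‖t⁻¹ • (z - y)‖ ≤ 2 * max ‖y‖ ‖t⁻¹ • (z - y)‖ := by
      linarith [le_max_left ‖y‖ ‖t⁻¹ • (z - y)‖, le_max_right ‖y‖ ‖t⁻¹ • (z - y)‖]
    calc ‖z‖ ^ m ≤ (2 * max ‖y‖ ‖t⁻¹ • (z - y)‖) ^ m := by gcongr; exact h3.trans h4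
      _ = 2 ^ m * (max ‖y‖ ‖t⁻¹ • (z - y)‖) ^ m := mul_pow _ _ _
      _ ≤ _ := by
        refine mul_le_mul_of_nonneg_left ?_ (by positivity)
        rcases max_cases ‖y‖ ‖t⁻¹ • (z - y)‖ with h | h <;> rw [h.1]
        · linarith [pow_nonneg (norm_nonneg (t⁻¹ • (z - y))) m]
        · linarith [pow_nonneg (norm_nonneg y) m]
  calc ‖z‖ ^ m * D ≤ 2 ^ m * (‖y‖ ^ m + ‖t⁻¹ • (z - y)‖ ^ m) * D := by gcongr
    _ = 2 ^ m * (‖y‖ ^ m * D + ‖t⁻¹ • (z - y)‖ ^ m * D) := by ring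
    _ ≤ _ := by
      unfold dilationBound
      gcongr

theorem norm_dilation_term_le (γ : 𝓢(V, ℂ)) (w : ℝ → ℂ) (y z : V) (m n : ℕ) {t : ℝ}
    (ht : t ∈ Set.Ioc (0 : ℝ) 1) :
    ‖z‖ ^ m * ‖(w t * ((t⁻¹ ^ n : ℝ) : ℂ)) • iteratedFDeriv ℝ n γ (t⁻¹ • (z - y))‖ ≤
      dilationBound γ y m n * (‖w t‖ * t⁻¹ ^ n) := by
  have ht0 : 0 < t⁻¹ := inv_pos.2 ht.1
  rw [norm_smul, norm_mul, Complex.norm_real, Real.norm_of_nonneg (by positivity), mul_left_comm,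
    mul_comm (dilationBound γ y m n)]
  exact mul_le_mul_of_nonneg_left (norm_pow_mul_iteratedFDeriv_dilation_le γ y z m n ht)
    (by positivity)

theorem norm_dilation_term_le_zero (γ : 𝓢(V, ℂ)) (w : ℝ → ℂ) (y z : V) (n : ℕ) {t : ℝ}
    (ht : t ∈ Set.Ioc (0 : ℝ) 1) :
    ‖(w t * ((t⁻¹ ^ n : ℝ) : ℂ)) • iteratedFDeriv ℝ n γ (t⁻¹ • (z - y))‖ ≤
      dilationBound γ y 0 n * (‖w t‖ * t⁻¹ ^ n) := by
  simpa only [pow_zero, one_mul] using norm_dilation_term_le γ w y z 0 n ht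

theorem integrable_dilation_term {n : ℕ} {w : ℝ → ℂ} (hw : IsDilationWeight n w)
    (γ : 𝓢(V, ℂ)) (y z : V) :
    Integrable (fun t : ℝ => (w t * ((t⁻¹ ^ n : ℝ) : ℂ)) •
      iteratedFDeriv ℝ n γ (t⁻¹ • (z - y))) (volume.restrict (Set.Ioc 0 1)) :=
  (hw.integrableOn.const_mul (dilationBound γ y 0 n)).mono'
    (aestronglyMeasurable_dilation_term hw γ y z n)
    ((ae_restrict_mem measurableSet_Ioc).mono fun _ ht => norm_dilation_term_le_zero γ w y z n ht)

/-- The Taylor series of a mixture of dilations, obtained by differentiating the integrand. -/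
theorem hasFTaylorSeriesUpTo_dilationMixture {k : ℕ} {w : ℝ → ℂ} (hw : IsDilationWeight k w)
    (γ : 𝓢(V, ℂ)) (y : V) :
    HasFTaylorSeriesUpTo k (dilationMixture γ y w) fun z n =>
      ∫ t in Set.Ioc (0 : ℝ) 1, (w t * ((t⁻¹ ^ n : ℝ) : ℂ)) •
        iteratedFDeriv ℝ n γ (t⁻¹ • (z - y)) := by
  constructor
  · intro z
    have h := (continuousMultilinearCurryFin0 ℝ V ℂ).toContinuousLinearEquiv.integral_comp_comm
      (μ := volume.restrict (Set.Ioc (0 : ℝ) 1)) (fun t : ℝ => (w t * ((t⁻¹ ^ 0 : ℝ) : ℂ)) •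
        iteratedFDeriv ℝ 0 γ (t⁻¹ • (z - y)))
    refine (Eq.trans h.symm ?_)
    refine integral_congr_ae (ae_of_all _ fun t => ?_)
    simp
  · intro m hm z
    have hm' : m + 1 ≤ k := by exact_mod_cast hm
    -- Each derivative in `z` costs one factor `t⁻¹`; the dominating function is integrable as long
    -- as `m + 1 ≤ k`.
    have h1 := hasFDerivAt_integral_of_dominated_of_fderiv_le (𝕜 := ℝ)
      (μ := volume.restrict (Set.Ioc (0 : ℝ) 1)) (x₀ := z) (s := Set.univ)
      (F := fun z t => (w t * ((t⁻¹ ^ m : ℝ) : ℂ)) • iteratedFDeriv ℝ m γ (t⁻¹ • (z - y)))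
      (F' := fun z t => ((w t * ((t⁻¹ ^ (m + 1) : ℝ) : ℂ)) •
        iteratedFDeriv ℝ (m + 1) γ (t⁻¹ • (z - y))).curryLeft)
      (bound := fun t => dilationBound γ y 0 (m + 1) * (‖w t‖ * t⁻¹ ^ (m + 1)))
      univ_mem (Eventually.of_forall fun z =>
        aestronglyMeasurable_dilation_term hw γ y z m)
      (integrable_dilation_term (hw.of_le (by omega)) γ y z)
      ((continuousMultilinearCurryLeftEquiv ℝ (fun _ : Fin (m + 1) => V) ℂ).continuous.comp_aestronglyMeasurable
        (aestronglyMeasurable_dilation_term hw γ y z (m + 1)))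
      ((ae_restrict_mem measurableSet_Ioc).mono fun t ht z _ => by
        rw [ContinuousMultilinearMap.curryLeft_norm]
        exact norm_dilation_term_le_zero γ w y z (m + 1) ht)
      ((hw.of_le hm').integrableOn.const_mul _)
      ((ae_restrict_mem measurableSet_Ioc).mono fun t ht z _ => by
        have h2 : HasFDerivAt (iteratedFDeriv ℝ m γ)
            (iteratedFDeriv ℝ (m + 1) γ (t⁻¹ • (z - y))).curryLeft (t⁻¹ • (z - y)) :=
          (γ.smooth'.ftaylorSeries (𝕜 := ℝ)).fderiv m
            (by exact_mod_cast ENat.natCast_lt_top m) (t⁻¹ • (z - y))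
        have h3 : HasFDerivAt (fun z : V => t⁻¹ • (z - y)) (t⁻¹ • ContinuousLinearMap.id ℝ V) z :=
          ((hasFDerivAt_id z).sub_const y).const_smul t⁻¹
        have h4 := (h2.comp z h3).const_smul (w t * ((t⁻¹ ^ m : ℝ) : ℂ))
        refine h4.congr_fderiv ?_
        ext v u
        simp [pow_succ]
        ring)
    refine h1.congr_fderiv ?_
    let L : (V [×(m + 1)]→L[ℝ] ℂ) →L[ℝ] (V →L[ℝ] V [×m]→L[ℝ] ℂ) :=
      (continuousMultilinearCurryLeftEquiv ℝ (fun _ : Fin (m + 1) => V)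
        ℂ).toContinuousLinearEquiv.toContinuousLinearMap
    exact ContinuousLinearMap.integral_comp_comm (𝕜 := ℝ) (Fₗ := V →L[ℝ] V [×m]→L[ℝ] ℂ) L
      (integrable_dilation_term (hw.of_le hm') γ y z)
  · intro m hm
    have hm' : m ≤ k := by exact_mod_cast hm
    refine continuous_of_dominated (bound := fun t => dilationBound γ y 0 m * (‖w t‖ * t⁻¹ ^ m))
      (fun z => aestronglyMeasurable_dilation_term hw γ y z m)
      (fun z => (ae_restrict_mem measurableSet_Ioc).mono fun t ht =>
        norm_dilation_term_le_zero γ w y z m ht)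
      ((hw.of_le hm').integrableOn.const_mul _)
      (ae_of_all _ fun t => ?_)
    have hc : Continuous (iteratedFDeriv ℝ m γ) :=
      γ.smooth'.continuous_iteratedFDeriv (by exact_mod_cast le_top)
    exact (hc.comp (by fun_prop : Continuous fun z : V => t⁻¹ • (z - y))).const_smul
      (w t * ((t⁻¹ ^ m : ℝ) : ℂ))

theorem contDiff_dilationMixture {k : ℕ} {w : ℝ → ℂ} (hw : IsDilationWeight k w)
    (γ : 𝓢(V, ℂ)) (y : V) : ContDiff ℝ k (dilationMixture γ y w) :=
  (hasFTaylorSeriesUpTo_dilationMixture hw γ y).contDiff (n := k)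

theorem norm_pow_mul_iteratedFDeriv_dilationMixture_le {n : ℕ} {w : ℝ → ℂ}
    (hw : IsDilationWeight n w) (γ : 𝓢(V, ℂ)) (y z : V) (m : ℕ) :
    ‖z‖ ^ m * ‖iteratedFDeriv ℝ n (dilationMixture γ y w) z‖ ≤
      dilationBound γ y m n * ∫ t in Set.Ioc (0 : ℝ) 1, ‖w t‖ * t⁻¹ ^ n := by
  rw [← (hasFTaylorSeriesUpTo_dilationMixture hw γ y).eq_iteratedFDeriv le_rfl z,
    ← integral_const_mul]
  calc _ ≤ ‖z‖ ^ m * ∫ t in Set.Ioc (0 : ℝ) 1, ‖(w t * ((t⁻¹ ^ n : ℝ) : ℂ)) •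
        iteratedFDeriv ℝ n γ (t⁻¹ • (z - y))‖ :=
      mul_le_mul_of_nonneg_left (norm_integral_le_integral_norm _) (by positivity)
    _ ≤ _ := by
      rw [← integral_const_mul]
      refine integral_mono_ae ((integrable_dilation_term hw γ y z).norm.const_mul _)
        (hw.integrableOn.const_mul _) ?_
      exact (ae_restrict_mem measurableSet_Ioc).mono fun t ht =>
        norm_dilation_term_le γ w y z m n ht

/-- A mixture of dilations is a Schwartz function if the weight vanishes rapidly at `0`. -/
noncomputable def dilationMixtureSchwartz {w : ℝ → ℂ} (hw : ∀ k, IsDilationWeight k w)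
    (γ : 𝓢(V, ℂ)) (y : V) : 𝓢(V, ℂ) where
  toFun := dilationMixture γ y w
  smooth' := contDiff_infty.2 fun k => contDiff_dilationMixture (hw k) γ y
  decay' m n := ⟨_, fun z => norm_pow_mul_iteratedFDeriv_dilationMixture_le (hw n) γ y z m⟩

end Mixture

section Truncation

variable {V : Type*} [NormedAddCommGroup V] [NormedSpace ℝ V]

theorem IsDilationWeight.sub {k : ℕ} {w w' : ℝ → ℂ} (hw : IsDilationWeight k w)
    (hw' : IsDilationWeight k w') : IsDilationWeight k fun t => w t - w' t := by
  refine ⟨hw.aestronglyMeasurable.sub hw'.aestronglyMeasurable,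
    (hw.integrableOn.add hw'.integrableOn).mono' ?_ ?_⟩
  · exact (hw.aestronglyMeasurable.sub hw'.aestronglyMeasurable).norm.mul (by fun_prop)
  · refine (ae_restrict_mem measurableSet_Ioc).mono fun t ht => ?_
    have ht0 : 0 < t⁻¹ := inv_pos.2 ht.1
    rw [norm_mul, norm_norm, norm_pow, Real.norm_of_nonneg ht0.le, Pi.add_apply, ← add_mul]
    exact mul_le_mul_of_nonneg_right (norm_sub_le _ _) (by positivity)

/-- The weight `w` cut off near `0`. -/
noncomputable def truncatedWeight (w : ℝ → ℂ) (j : ℕ) : ℝ → ℂ :=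
  (Set.Ici (1 / ((j : ℝ) + 1))).indicator w

theorem norm_truncatedWeight_le (w : ℝ → ℂ) (j : ℕ) (t : ℝ) : ‖truncatedWeight w j t‖ ≤ ‖w t‖ :=
  norm_indicator_le_norm_self _ _

theorem eventually_truncatedWeight_eq (w : ℝ → ℂ) {t : ℝ} (ht : 0 < t) :
    ∀ᶠ j in atTop, truncatedWeight w j t = w t := by
  filter_upwards [tendsto_one_div_add_atTop_nhds_zero_nat.eventually (gt_mem_nhds ht)] with j hj
  exact Set.indicator_of_mem (show t ∈ Set.Ici (1 / ((j : ℝ) + 1)) from le_of_lt hj) w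

/-- On the support of the cut-off weight `t⁻¹ ≤ j + 1`, so every negative power of `t` costs only a
constant and the truncated mixtures are Schwartz functions. -/
theorem IsDilationWeight.truncated {w : ℝ → ℂ} (hw : IsDilationWeight 0 w) (j k : ℕ) :
    IsDilationWeight k (truncatedWeight w j) := by
  have hm : AEStronglyMeasurable (truncatedWeight w j) (volume.restrict (Set.Ioc 0 1)) :=
    hw.aestronglyMeasurable.indicator measurableSet_Ici
  refine ⟨hm, (hw.integrableOn.const_mul (((j : ℝ) + 1) ^ k)).mono' ?_ ?_⟩
  · exact hm.norm.mul (by fun_prop)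
  · refine (ae_restrict_mem measurableSet_Ioc).mono fun t ht => ?_
    have ht0 : 0 < t⁻¹ := inv_pos.2 ht.1
    rw [norm_mul, norm_norm, norm_pow, Real.norm_of_nonneg ht0.le, pow_zero, mul_one,
      mul_comm (_ ^ k)]
    by_cases h : t ∈ Set.Ici (1 / ((j : ℝ) + 1))
    · have h1 : t⁻¹ ≤ (j : ℝ) + 1 := by
        have h2 : 1 / ((j : ℝ) + 1) ≤ t := h
        rw [inv_le_comm₀ ht.1 (by positivity)]
        simpa using h2
      exact mul_le_mul (norm_truncatedWeight_le w j t) (by gcongr) (by positivity) (norm_nonneg _)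
    · rw [truncatedWeight, Set.indicator_of_notMem h, norm_zero, zero_mul]
      positivity

theorem tendsto_integral_truncatedWeight_sub {n : ℕ} {w : ℝ → ℂ} (hw : IsDilationWeight n w) :
    Tendsto (fun j => ∫ t in Set.Ioc (0 : ℝ) 1, ‖truncatedWeight w j t - w t‖ * t⁻¹ ^ n) atTop
      (𝓝 0) := by
  have h := tendsto_integral_of_dominated_convergence
    (μ := volume.restrict (Set.Ioc (0 : ℝ) 1)) (f := fun _ => (0 : ℝ))
    (F := fun j t => ‖truncatedWeight w j t - w t‖ * t⁻¹ ^ n)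
    (fun t => ‖w t‖ * t⁻¹ ^ n)
    (fun j => (((hw.aestronglyMeasurable.indicator measurableSet_Ici).sub
      hw.aestronglyMeasurable).norm).mul (by fun_prop))
    hw.integrableOn
    (fun j => (ae_restrict_mem measurableSet_Ioc).mono fun t ht => by
      have ht0 : 0 < t⁻¹ := inv_pos.2 ht.1
      rw [norm_mul, norm_norm, norm_pow, Real.norm_of_nonneg ht0.le]
      refine mul_le_mul_of_nonneg_right ?_ (by positivity)
      by_cases h : t ∈ Set.Ici (1 / ((j : ℝ) + 1))
      · rw [truncatedWeight, Set.indicator_of_mem h, sub_self, norm_zero]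
        exact norm_nonneg _
      · rw [truncatedWeight, Set.indicator_of_notMem h, zero_sub, norm_neg])
    ((ae_restrict_mem measurableSet_Ioc).mono fun t ht => by
      refine tendsto_const_nhds.congr' ?_
      filter_upwards [eventually_truncatedWeight_eq w ht.1] with j hj
      rw [hj, sub_self, norm_zero, zero_mul])
  simpa using h

theorem integrable_dilationMixture_integrand {w : ℝ → ℂ} (hw : IsDilationWeight 0 w)
    (γ : 𝓢(V, ℂ)) (y z : V) :
    Integrable (fun t : ℝ => w t * γ (t⁻¹ • (z - y))) (volume.restrict (Set.Ioc 0 1)) := by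
  have hm : AEStronglyMeasurable (fun t : ℝ => w t * γ (t⁻¹ • (z - y)))
      (volume.restrict (Set.Ioc 0 1)) := by
    have hinv : ContinuousOn (fun t : ℝ => t⁻¹) (Set.Ioc 0 1) :=
      continuousOn_inv₀.mono fun t ht => ht.1.ne'
    exact hw.aestronglyMeasurable.mul ((γ.continuous.comp_continuousOn
      (hinv.smul continuousOn_const)).aestronglyMeasurable measurableSet_Ioc)
  refine (hw.integrableOn.const_mul (SchwartzMap.seminorm ℝ 0 0 γ)).mono' hm
    (ae_of_all _ fun t => ?_)
  rw [norm_mul, pow_zero, mul_one, mul_comm]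
  exact mul_le_mul_of_nonneg_right (SchwartzMap.norm_le_seminorm ℝ γ _) (norm_nonneg _)

theorem dilationMixture_sub {w w' : ℝ → ℂ} (hw : IsDilationWeight 0 w)
    (hw' : IsDilationWeight 0 w') (γ : 𝓢(V, ℂ)) (y z : V) :
    dilationMixture γ y w z - dilationMixture γ y w' z =
      dilationMixture γ y (fun t => w t - w' t) z := by
  rw [dilationMixture, dilationMixture, dilationMixture,
    ← integral_sub (integrable_dilationMixture_integrand hw γ y z)
      (integrable_dilationMixture_integrand hw' γ y z)]
  simp only [sub_mul]

end Truncation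

theorem memSk_dilationMixture {d k : ℕ} {w : ℝ → ℂ} (hw : IsDilationWeight k w)
    (γ : 𝓢(Euc d, ℂ)) (y : Euc d) : MemSk k (dilationMixture γ y w) :=
  ⟨contDiff_dilationMixture hw γ y, fun m _ hn =>
    ⟨_, fun z => norm_pow_mul_iteratedFDeriv_dilationMixture_le (hw.of_le hn) γ y z m⟩⟩

/-- Truncating the weight approximates a mixture of dilations in `𝓢^k`. -/
theorem tendstoSk_truncated {d k : ℕ} {w : ℝ → ℂ} (hw : IsDilationWeight k w)
    (γ : 𝓢(Euc d, ℂ)) (y : Euc d) :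
    TendstoSk k (fun j => dilationMixtureSchwartz
      (fun n => (hw.of_le (Nat.zero_le k)).truncated j n) γ y) (dilationMixture γ y w) := by
  intro m n hn ε hε
  have hw0 := hw.of_le (Nat.zero_le k)
  have h := (tendsto_integral_truncatedWeight_sub (hw.of_le hn)).const_mul (dilationBound γ y m n)
  rw [mul_zero] at h
  filter_upwards [h.eventually (gt_mem_nhds hε)] with j hj z
  have heq : (fun z => dilationMixtureSchwartz (fun n => hw0.truncated j n) γ y z -
      dilationMixture γ y w z) = dilationMixture γ y fun t => truncatedWeight w j t - w t := by
    funext z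
    exact dilationMixture_sub (hw0.truncated j 0) hw0 γ y z
  rw [heq]
  exact (norm_pow_mul_iteratedFDeriv_dilationMixture_le
    ((hw0.truncated j n).sub (hw.of_le hn)) γ y z m).trans hj.le

/-- With `s = ν - d` this is the origin of the condition `Re ν > d + k`. -/
theorem isDilationWeight_cpow {k : ℕ} {s : ℂ} (hs : (k : ℝ) < s.re) :
    IsDilationWeight k fun t : ℝ => 2 * (t : ℂ) ^ (s - 1) := by
  have hc : ContinuousOn (fun t : ℝ => 2 * (t : ℂ) ^ (s - 1)) (Set.Ioc 0 1) := fun t ht =>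
    (continuousAt_const.mul (Complex.continuousAt_ofReal_cpow_const t _
      (Or.inr ht.1.ne'))).continuousWithinAt
  refine ⟨hc.aestronglyMeasurable measurableSet_Ioc, ?_⟩
  have h : IntegrableOn (fun t : ℝ => t ^ (s.re - 1 - k)) (Set.Ioc 0 1) :=
    (intervalIntegrable_iff_integrableOn_Ioc_of_le zero_le_one).1
      (intervalIntegral.intervalIntegrable_rpow' (by linarith))
  refine (integrableOn_congr_fun (fun t ht => ?_) measurableSet_Ioc).1 (h.const_mul 2)
  rw [norm_mul, Complex.norm_cpow_eq_rpow_re_of_pos ht.1, Complex.norm_ofNat,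
    Real.rpow_sub ht.1, Real.rpow_natCast, Complex.sub_re, Complex.one_re, inv_pow]
  ring

/-! ### The convolution of the form factor with a Crandall function. -/

theorem pi_mul_sq_pos {l : ℝ} (hl : 0 < l) : 0 < Real.pi * l ^ 2 := by
  have := Real.pi_pos
  positivity

/-- The Crandall function as a mixture of Gaussians. -/
theorem crandallG_eq_dilationMixture {d : ℕ} {l : ℝ} (hl : 0 < l) {s : ℂ} (hs : 0 < s.re)
    (y z : Euc d) : crandallG (-s) (l • (y - z)) =
      dilationMixture (gaussianSchwartz (Euc d) (pi_mul_sq_pos hl)) y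
        (fun t => 2 * (t : ℂ) ^ (s - 1)) z := by
  rw [dilationMixture]
  simp only [gaussianSchwartz_apply, mul_assoc]
  rw [integral_const_mul]
  -- At `z = y` the integral is `2 ∫ t^(s-1) dt = 2/s`, which is the prescribed value `-2/(-s)` of
  -- the Crandall function at the origin.
  by_cases hz : z = y
  · have hs0 : s ≠ 0 := fun h => by simp [h] at hs
    simp only [hz, sub_self, smul_zero, norm_zero, crandallG, if_true]
    have h := integral_cpow (a := 0) (b := 1) (r := s - 1) (Or.inl (by simpa using hs))
    rw [intervalIntegral.integral_of_le zero_le_one] at h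
    simp only [ne_eq, OfNat.ofNat_ne_zero, not_false_eq_true, zero_pow, mul_zero, Real.exp_zero,
      Complex.ofReal_one, mul_one]
    rw [h]
    simp [hs0, div_eq_mul_inv]
  · rw [crandallG_of_ne_zero _ (smul_ne_zero hl.ne' (sub_ne_zero.2 (Ne.symm hz))), neg_neg]
    congr 1
    refine setIntegral_congr_fun measurableSet_Ioc fun t ht => ?_
    simp only [norm_smul, norm_inv, Real.norm_of_nonneg hl.le, Real.norm_of_nonneg ht.1.le,
      norm_sub_rev y z]
    congr 3
    have := ht.1.ne'
    field_simp

theorem planeWave_add_left {d : ℕ} (v y z : Euc d) :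
    planeWave (v + y) z = planeWave v z * planeWave y z := by
  rw [planeWave, planeWave, planeWave, ← Complex.exp_add, inner_add_left]
  push_cast
  ring_nf

/-- The factor `t ^ d` produced by the dilation turns the weight `t^(ν-d-1)` of the mixture for
`G_{d-ν}` into `t^(ν-1)`, the weight of the lower part of the Mellin integral. -/
theorem integral_planeWave_mul_gaussian {d : ℕ} {l : ℝ} (hl : 0 < l) (y z : Euc d) {t : ℝ}
    (ht : 0 < t) :
    ∫ v : Euc d, planeWave v z * gaussianSchwartz (Euc d) (pi_mul_sq_pos hl) (t⁻¹ • (v - y)) =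
      planeWave y z * ((l : ℂ) ^ d)⁻¹ * ((t : ℂ) ^ d *
        (Real.exp (-(Real.pi * ‖l⁻¹ • z‖ ^ 2) * t ^ 2) : ℝ)) := by
  have hpi := Real.pi_pos
  have hb : 0 < Real.pi * l ^ 2 * t⁻¹ ^ 2 := by positivity
  have h1 : ∀ v : Euc d, planeWave v z *
      gaussianSchwartz (Euc d) (pi_mul_sq_pos hl) (t⁻¹ • (v - y)) =
      (fun v => planeWave y z * (planeWave v z *
        Complex.exp (-((Real.pi * l ^ 2 * t⁻¹ ^ 2 : ℝ) : ℂ) * (‖v‖ : ℂ) ^ 2))) (v - y) := by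
    intro v
    simp only [gaussianSchwartz_apply]
    nth_rewrite 1 [← sub_add_cancel v y]
    rw [planeWave_add_left, norm_smul, norm_inv, Real.norm_of_nonneg ht.le]
    push_cast
    rw [mul_comm (planeWave (v - y) z), mul_assoc]
    congr 3
    ring
  refine (integral_congr_ae (ae_of_all _ h1)).trans
    ((integral_sub_right_eq_self (fun v : Euc d => planeWave y z * (planeWave v z *
      Complex.exp (-((Real.pi * l ^ 2 * t⁻¹ ^ 2 : ℝ) : ℂ) * (‖v‖ : ℂ) ^ 2))) y).trans ?_)
  rw [integral_const_mul, ← fourier_eq_integral_planeWave,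
    fourier_gaussian_innerProductSpace (by rwa [Complex.ofReal_re]),
    finrank_euclideanSpace_fin, mul_assoc (planeWave y z)]
  congr 1
  have h2 : (Real.pi : ℂ) / ((Real.pi * l ^ 2 * t⁻¹ ^ 2 : ℝ) : ℂ) = ((t / l) ^ 2 : ℝ) := by
    push_cast
    have : (l : ℂ) ≠ 0 := by exact_mod_cast hl.ne'
    have : (t : ℂ) ≠ 0 := by exact_mod_cast ht.ne'
    have : (Real.pi : ℂ) ≠ 0 := by exact_mod_cast hpi.ne'
    field_simp
  have h3 : (((t / l) ^ 2 : ℝ) : ℂ) ^ ((d : ℂ) / 2) = (t : ℂ) ^ d / (l : ℂ) ^ d := by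
    have h := sq_cpow_half (div_pos ht hl) d 0
    simp only [Nat.cast_zero, sub_zero, pow_zero, div_one] at h
    rw [h]
    push_cast
    rw [div_pow]
  rw [h2, h3, norm_smul, norm_inv, Real.norm_of_nonneg hl.le]
  have h4 : -(Real.pi : ℂ) ^ 2 * (‖z‖ : ℂ) ^ 2 / ((Real.pi * l ^ 2 * t⁻¹ ^ 2 : ℝ) : ℂ) =
      ((-(Real.pi * (l⁻¹ * ‖z‖) ^ 2) * t ^ 2 : ℝ) : ℂ) := by
    push_cast
    have : (l : ℂ) ≠ 0 := by exact_mod_cast hl.ne'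
    have : (t : ℂ) ≠ 0 := by exact_mod_cast ht.ne'
    have : (Real.pi : ℂ) ≠ 0 := by exact_mod_cast hpi.ne'
    field_simp
  rw [h4, Complex.ofReal_exp]
  ring

/-- The Fourier transform of a mixture of Gaussians. -/
theorem fourier_dilationMixture_gaussian {d : ℕ} {l : ℝ} (hl : 0 < l) {w : ℝ → ℂ}
    (hw : IsDilationWeight 0 w) (y z : Euc d) :
    𝓕 (dilationMixture (gaussianSchwartz (Euc d) (pi_mul_sq_pos hl)) y w) z =
      planeWave y z * ((l : ℂ) ^ d)⁻¹ * ∫ t in Set.Ioc (0 : ℝ) 1, w t * ((t : ℂ) ^ d *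
        (Real.exp (-(Real.pi * ‖l⁻¹ • z‖ ^ 2) * t ^ 2) : ℝ)) := by
  set γ := gaussianSchwartz (Euc d) (pi_mul_sq_pos hl) with hγ
  have hint : Integrable (Function.uncurry fun (v : Euc d) (t : ℝ) =>
      planeWave v z * (w t * γ (t⁻¹ • (v - y))))
      ((volume : Measure (Euc d)).prod (volume.restrict (Set.Ioc (0 : ℝ) 1))) := by
    have h1 : Integrable (fun v : Euc d => ‖γ (v - y)‖) :=
      (γ.integrable (μ := volume)).norm.comp_sub_right y
    have h2 : Integrable (fun t : ℝ => ‖w t‖) (volume.restrict (Set.Ioc (0 : ℝ) 1)) :=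
      hw.integrableOn.congr (ae_of_all _ fun t => by simp)
    -- The Gaussian decreases radially and `t ≤ 1`, so `γ((v - y)/t) ≤ γ(v - y)`; a product function
    -- dominates.
    refine (h1.mul_prod h2).mono' ?_ ?_
    · have h3 : Measurable fun p : Euc d × ℝ => γ (p.2⁻¹ • (p.1 - y)) :=
        γ.continuous.measurable.comp
          (measurable_snd.inv.smul (measurable_fst.sub_const y))
      have h4 : Measurable fun p : Euc d × ℝ => planeWave p.1 z :=
        (contDiff_planeWave z).continuous.measurable.comp measurable_fst
      exact h4.aestronglyMeasurable.mul ((hw.aestronglyMeasurable.comp_snd).mul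
        h3.aestronglyMeasurable)
    · have h5 : ∀ᵐ p : Euc d × ℝ ∂((volume : Measure (Euc d)).prod
          (volume.restrict (Set.Ioc (0 : ℝ) 1))), p.2 ∈ Set.Ioc (0 : ℝ) 1 :=
        Measure.quasiMeasurePreserving_snd.ae (ae_restrict_mem measurableSet_Ioc)
      refine h5.mono fun p hp => ?_
      simp only [Function.uncurry]
      rw [norm_mul, norm_planeWave, one_mul, norm_mul, mul_comm]
      refine mul_le_mul_of_nonneg_right ?_ (norm_nonneg _)
      rw [hγ, gaussianSchwartz_apply, gaussianSchwartz_apply, Complex.norm_real, Complex.norm_real,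
        Real.norm_of_nonneg (Real.exp_pos _).le, Real.norm_of_nonneg (Real.exp_pos _).le,
        norm_smul, norm_inv, Real.norm_of_nonneg hp.1.le]
      refine Real.exp_le_exp.2 ?_
      have h6 : 1 ≤ p.2⁻¹ := (one_le_inv₀ hp.1).2 hp.2
      have h7 : ‖p.1 - y‖ ^ 2 ≤ (p.2⁻¹ * ‖p.1 - y‖) ^ 2 := by
        gcongr
        exact le_mul_of_one_le_left (norm_nonneg _) h6
      nlinarith [pi_mul_sq_pos hl]
  rw [fourier_eq_integral_planeWave]
  simp only [dilationMixture, ← integral_const_mul]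
  rw [integral_integral_swap hint]
  refine setIntegral_congr_fun measurableSet_Ioc fun t ht => ?_
  simp only [mul_left_comm _ (w t)]
  rw [integral_const_mul, integral_planeWave_mul_gaussian hl y z ht.1]

/-- With `τ = t²`, the integral over `τ ≤ 1` is the complete gamma integral minus its part over `τ >
1`. -/
theorem two_mul_integral_Ioc_cpow_mul_exp_neg_mul_sq {ν : ℂ} (hν : 0 < ν.re) {b : ℝ}
    (hb : 0 < b) :
    2 * ∫ t in Set.Ioc (0 : ℝ) 1, (t : ℂ) ^ (ν - 1) * (Real.exp (-b * t ^ 2) : ℝ) =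
      (1 / (b : ℂ)) ^ (ν / 2) * Complex.Gamma (ν / 2) -
        mellin ((Set.Ioi (1 : ℝ)).indicator fun τ : ℝ => ((Real.exp (-b * τ) : ℝ) : ℂ))
          (ν / 2) := by
  set f : ℝ → ℂ := fun τ : ℝ => ((Real.exp (-b * τ) : ℝ) : ℂ) with hf
  have hν2 : 0 < (ν / 2).re := by
    rw [Complex.div_ofNat_re]
    positivity
  have h1 : MellinConvergent ((Set.Ioi (1 : ℝ)).indicator f) (ν / 2) :=
    mellinConvergent_indicator_Ioi_one
      (locallyIntegrableOn_exp_neg_mul b) (isBigO_exp_neg_mul_atTop hb) _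
  have h2 : MellinConvergent f (ν / 2) := by
    refine mellinConvergent_of_isBigO_rpow (locallyIntegrableOn_exp_neg_mul b)
      (isBigO_exp_neg_mul_atTop hb _) (lt_add_one (ν / 2).re) (b := 0) ?_ hν2
    refine Asymptotics.IsBigO.of_bound 1 ?_
    filter_upwards [self_mem_nhdsWithin] with τ hτ
    have hτ0 : (0 : ℝ) < τ := hτ
    rw [hf, neg_zero, Real.rpow_zero, norm_one, mul_one, Complex.norm_real,
      Real.norm_of_nonneg (Real.exp_pos _).le, Real.exp_le_one_iff]
    nlinarith
  have h3 : mellin f (ν / 2) = (1 / (b : ℂ)) ^ (ν / 2) * Complex.Gamma (ν / 2) := by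
    rw [← Complex.integral_cpow_mul_exp_neg_mul_Ioi hν2 hb, mellin]
    refine setIntegral_congr_fun measurableSet_Ioi fun t _ => ?_
    simp only [hf, smul_eq_mul]
    push_cast
    rw [neg_mul]
  have h4 := mellin_comp_rpow (fun τ => f τ - (Set.Ioi (1 : ℝ)).indicator f τ) ν 2
  have h5 := (hasMellin_sub h2 h1).2
  have h6 : ν / ((2 : ℝ) : ℂ) = ν / 2 := by norm_num
  have h7 : mellin (fun t : ℝ => f (t ^ (2 : ℝ)) - (Set.Ioi (1 : ℝ)).indicator f (t ^ (2 : ℝ))) ν =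
      ∫ t in Set.Ioc (0 : ℝ) 1, (t : ℂ) ^ (ν - 1) * (Real.exp (-b * t ^ 2) : ℝ) := by
    have h8 : ∀ t ∈ Set.Ioi (0 : ℝ), (t : ℂ) ^ (ν - 1) •
        (f (t ^ (2 : ℝ)) - (Set.Ioi (1 : ℝ)).indicator f (t ^ (2 : ℝ))) =
        (Set.Ioc (0 : ℝ) 1).indicator (fun t : ℝ => (t : ℂ) ^ (ν - 1) *
          (Real.exp (-b * t ^ 2) : ℝ)) t := by
      intro t ht
      have ht0 : (0 : ℝ) < t := ht
      rw [Real.rpow_two, smul_eq_mul]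
      by_cases h : t ≤ 1
      · rw [Set.indicator_of_mem (show t ∈ Set.Ioc (0 : ℝ) 1 from ⟨ht0, h⟩),
          Set.indicator_of_notMem (show t ^ 2 ∉ Set.Ioi (1 : ℝ) from fun h' => by
            have : 1 < t ^ 2 := h'
            nlinarith), sub_zero]
      · rw [Set.indicator_of_notMem (show t ∉ Set.Ioc (0 : ℝ) 1 from fun h' => h h'.2),
          Set.indicator_of_mem (show t ^ 2 ∈ Set.Ioi (1 : ℝ) from by
            show 1 < t ^ 2
            nlinarith [not_le.1 h]), sub_self, mul_zero]
    rw [mellin, setIntegral_congr_fun measurableSet_Ioi h8, setIntegral_indicator measurableSet_Ioc,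
      Set.inter_eq_self_of_subset_right (fun t ht => ht.1)]
  rw [h7, h6, h5, h3, Complex.real_smul] at h4
  rw [h4, abs_of_pos two_pos]
  push_cast
  ring

/-- The part over `(1, ∞)` in Riemann's splitting is a Crandall function. -/
theorem crandallG_add_integral_Ioc {d : ℕ} {ν : ℂ} (hν : 0 < ν.re) {l : ℝ} (hl : 0 < l)
    (y z : Euc d) :
    planeWave y z * crandallG ν (l⁻¹ • z) + planeWave y z * (2 * ∫ t in Set.Ioc (0 : ℝ) 1,
      (t : ℂ) ^ (ν - 1) * (Real.exp (-(Real.pi * ‖l⁻¹ • z‖ ^ 2) * t ^ 2) : ℝ)) =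
      (l : ℂ) ^ ν * (Complex.Gammaℝ ν * zetaTerm ν y z) := by
  have hν0 : ν ≠ 0 := fun h => by simp [h] at hν
  -- At the origin `G_ν(0) = -2/ν` cancels `2 ∫ t^(ν-1) dt`, matching the default value `0` of the
  -- zeta term.
  by_cases hz : z = 0
  · have h := integral_cpow (a := 0) (b := 1) (r := ν - 1) (Or.inl (by simpa using hν))
    rw [intervalIntegral.integral_of_le zero_le_one] at h
    have h2 : (fun t : ℝ => (t : ℂ) ^ (ν - 1) *
        ((Real.exp (-(Real.pi * ‖l⁻¹ • z‖ ^ 2) * t ^ 2) : ℝ) : ℂ)) =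
        fun t : ℝ => (t : ℂ) ^ (ν - 1) := by
      funext t
      simp [hz]
    rw [h2, h]
    simp only [hz, smul_zero, crandallG, if_true, zetaTerm, norm_zero, Complex.ofReal_zero,
      Complex.zero_cpow hν0, div_zero, mul_zero]
    simp only [sub_add_cancel, Complex.ofReal_one, Complex.one_cpow, Complex.zero_cpow hν0]
    ring
  · have hn : 0 < ‖z‖ := norm_pos_iff.2 hz
    have hpi := Real.pi_pos
    have hb : 0 < Real.pi * ‖l⁻¹ • z‖ ^ 2 := by
      have := norm_pos_iff.2 (smul_ne_zero (inv_ne_zero hl.ne') hz)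
      positivity
    rw [crandallG_eq_mellin ν (smul_ne_zero (inv_ne_zero hl.ne') hz),
      two_mul_integral_Ioc_cpow_mul_exp_neg_mul_sq hν hb, zetaTerm, Complex.Gammaℝ_def]
    have h1 : (1 / ((Real.pi * ‖l⁻¹ • z‖ ^ 2 : ℝ) : ℂ)) ^ (ν / 2) =
        (Real.pi : ℂ) ^ (-ν / 2) * ((l : ℂ) ^ ν / (‖z‖ : ℂ) ^ ν) := by
      rw [norm_smul, norm_inv, Real.norm_of_nonneg hl.le, ← Complex.ofReal_one,
        ← Complex.ofReal_div]
      have e1 : 1 / (Real.pi * (l⁻¹ * ‖z‖) ^ 2) =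
          Real.exp (-Real.log Real.pi + 2 * (Real.log l - Real.log ‖z‖)) := by
        rw [two_mul, Real.exp_add, Real.exp_add, Real.exp_sub, Real.exp_neg, Real.exp_log hpi,
          Real.exp_log hl, Real.exp_log hn]
        field_simp
      rw [e1, Complex.cpow_def_of_ne_zero (by exact_mod_cast (Real.exp_pos _).ne'),
        Complex.cpow_def_of_ne_zero (by exact_mod_cast hpi.ne'),
        Complex.cpow_def_of_ne_zero (by exact_mod_cast hl.ne'),
        Complex.cpow_def_of_ne_zero (by exact_mod_cast hn.ne'), ← Complex.exp_sub,
        ← Complex.exp_add, ← Complex.ofReal_log (Real.exp_pos _).le, Real.log_exp,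
        ← Complex.ofReal_log hpi.le, ← Complex.ofReal_log hl.le, ← Complex.ofReal_log hn.le]
      congr 1
      push_cast
      ring
    rw [h1]
    ring

/-- Enlarging the range to `(0, ∞)` exhibits the decay `‖z‖^(-Re ν)` when `b` is a multiple of
`‖z‖²`; this is the summable majorant for the truncated convolutions. -/
theorem two_mul_integral_Ioc_rpow_mul_exp_le {σ : ℝ} (hσ : 0 < σ) {b : ℝ} (hb : 0 < b) :
    ∫ t in Set.Ioc (0 : ℝ) 1, 2 * t ^ (σ - 1) * Real.exp (-b * t ^ 2) ≤
      b ^ (-(σ / 2)) * Real.Gamma (σ / 2) := by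
  have h := integral_rpow_mul_exp_neg_mul_rpow (p := 2) (q := σ - 1) two_pos (by linarith) hb
  have hi := integrableOn_rpow_mul_exp_neg_mul_rpow (p := 2) (s := σ - 1) (by linarith)
    two_pos hb
  simp only [Real.rpow_two] at h hi
  calc ∫ t in Set.Ioc (0 : ℝ) 1, 2 * t ^ (σ - 1) * Real.exp (-b * t ^ 2)
      ≤ ∫ t in Set.Ioi (0 : ℝ), 2 * t ^ (σ - 1) * Real.exp (-b * t ^ 2) := by
        simp only [mul_assoc]
        refine setIntegral_mono_set (hi.const_mul 2) ?_ (Eventually.of_forall fun t ht => ht.1)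
        refine (ae_restrict_mem measurableSet_Ioi).mono fun t ht => ?_
        have : (0 : ℝ) < t := ht
        simp only [Pi.zero_apply]
        positivity
    _ = _ := by
        simp only [mul_assoc]
        rw [integral_const_mul, h, sub_add_cancel, neg_div]
        ring

/-- The value of the convolution of the form factor with a Crandall function. -/
theorem hasConvolutionAt_formFactor_corner {d : ℕ} {A : Matrix (Fin d) (Fin d) ℝ} (hA : A.det ≠ 0)
    (x y : Euc d) {l : ℝ} (hl : 0 < l) {k : ℕ} (hk : HasOrderLE (formFactor (corner A x)) k)
    {ν : ℂ} (hν : (d : ℝ) + k < ν.re) :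
    HasConvolutionAt k (formFactor (corner A x)) (fun z => crandallG (d - ν) (l • z)) y
      (∑' z : corner A x, planeWave y (z : Euc d) * ((l : ℂ) ^ d)⁻¹ *
        (2 * ∫ t in Set.Ioc (0 : ℝ) 1, (t : ℂ) ^ (ν - 1) *
          (Real.exp (-(Real.pi * ‖l⁻¹ • (z : Euc d)‖ ^ 2) * t ^ 2) : ℝ))) := by
  have hpi := Real.pi_pos
  have hs : (k : ℝ) < (ν - d).re := by
    rw [Complex.sub_re, Complex.natCast_re]
    linarith
  have hs0 : 0 < (ν - d).re := lt_of_le_of_lt (Nat.cast_nonneg k) hs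
  have hdν : (d : ℝ) < ν.re := lt_of_le_of_lt (le_add_of_nonneg_right (Nat.cast_nonneg k)) hν
  have hν0 : 0 < ν.re := lt_of_le_of_lt (Nat.cast_nonneg d) hdν
  set γ := gaussianSchwartz (Euc d) (pi_mul_sq_pos hl)
  set w : ℝ → ℂ := fun t => 2 * (t : ℂ) ^ (ν - d - 1) with hwdef
  have hw : IsDilationWeight k w := isDilationWeight_cpow hs
  have hw0 := hw.of_le (Nat.zero_le k)
  have hG : ∀ y z : Euc d, crandallG (d - ν) (l • (y - z)) = dilationMixture γ y w z :=
    fun y z => by rw [← crandallG_eq_dilationMixture hl hs0 y z, neg_sub]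
  have hwt : ∀ t ∈ Set.Ioc (0 : ℝ) 1, w t * (t : ℂ) ^ d = 2 * (t : ℂ) ^ (ν - 1) := by
    intro t ht
    rw [hwdef, mul_assoc, ← Complex.cpow_natCast, ← Complex.cpow_add _ _
      (by exact_mod_cast ht.1.ne')]
    ring_nf
  refine ⟨hk, ?_, fun j => dilationMixtureSchwartz (fun n => hw0.truncated j n) γ y, ?_, ?_⟩
  · have h := memSk_dilationMixture hw γ 0
    convert! h using 1
    funext z
    rw [← hG 0 z, zero_sub]
    simp only [crandallG, smul_neg, neg_eq_zero, norm_neg]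
  · simp only [hG]
    exact tendstoSk_truncated hw γ y
  · set E : Euc d → ℝ → ℝ := fun z t => Real.exp (-(Real.pi * ‖l⁻¹ • z‖ ^ 2) * t ^ 2) with hE
    have hE0 : ∀ z t, 0 < E z t := fun z t => Real.exp_pos _
    have hEle : ∀ z t, E z t ≤ 1 := fun z t => by
      rw [hE, Real.exp_le_one_iff, neg_mul]
      exact neg_nonpos.2 (by positivity)
    have hform : ∀ j, formFactor (corner A x)
        (dilationMixtureSchwartz (fun n => hw0.truncated j n) γ y) =
        ∑' z : corner A x, planeWave y (z : Euc d) * ((l : ℂ) ^ d)⁻¹ *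
          ∫ t in Set.Ioc (0 : ℝ) 1, truncatedWeight w j t * ((t : ℂ) ^ d * (E z t : ℝ)) := by
      intro j
      rw [← (hasSum_formFactor_corner hA x _).tsum_eq]
      exact tsum_congr fun z => fourier_dilationMixture_gaussian hl (hw0.truncated j 0) y z
    have hlim : ∀ z : corner A x, (2 * ∫ t in Set.Ioc (0 : ℝ) 1, (t : ℂ) ^ (ν - 1) *
        (E z t : ℝ)) = ∫ t in Set.Ioc (0 : ℝ) 1, w t * ((t : ℂ) ^ d * (E z t : ℝ)) := by
      intro z
      rw [← integral_const_mul]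
      refine setIntegral_congr_fun measurableSet_Ioc fun t ht => ?_
      rw [← mul_assoc, ← hwt t ht, mul_assoc]
    have hnorm : ∀ t ∈ Set.Ioc (0 : ℝ) 1, ∀ z : Euc d, ∀ j,
        ‖truncatedWeight w j t * ((t : ℂ) ^ d * (E z t : ℝ))‖ ≤
          2 * t ^ (ν.re - 1) * E z t := by
      intro t ht z j
      rw [norm_mul, norm_mul, Complex.norm_real, Real.norm_of_nonneg (hE0 z t).le, ← mul_assoc]
      refine mul_le_mul_of_nonneg_right ?_ (hE0 z t).le
      refine (mul_le_mul_of_nonneg_right (norm_truncatedWeight_le w j t) (norm_nonneg _)).trans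
        (le_of_eq ?_)
      rw [← norm_mul, hwt t ht, norm_mul, Complex.norm_cpow_eq_rpow_re_of_pos ht.1,
        Complex.norm_ofNat, Complex.sub_re, Complex.one_re]
    have hint1 : IntegrableOn (fun t : ℝ => 2 * t ^ (ν.re - 1)) (Set.Ioc 0 1) :=
      ((intervalIntegrable_iff_integrableOn_Ioc_of_le zero_le_one).1
        (intervalIntegral.intervalIntegrable_rpow' (by linarith))).const_mul 2
    have hint : ∀ z : Euc d, IntegrableOn (fun t : ℝ => 2 * t ^ (ν.re - 1) * E z t)
        (Set.Ioc 0 1) := by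
      intro z
      refine hint1.mono' (hint1.aestronglyMeasurable.mul (by fun_prop)) ?_
      refine (ae_restrict_mem measurableSet_Ioc).mono fun t ht => ?_
      have h1 : 0 ≤ 2 * t ^ (ν.re - 1) := mul_nonneg two_pos.le (Real.rpow_nonneg ht.1.le _)
      rw [norm_mul, Real.norm_of_nonneg (hE0 z t).le, Real.norm_of_nonneg h1]
      exact mul_le_of_le_one_right h1 (hEle z t)
    have hpl : ∀ z : Euc d, ∀ I : ℂ, ‖planeWave y z * ((l : ℂ) ^ d)⁻¹ * I‖ = (l ^ d)⁻¹ * ‖I‖ := by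
      intro z I
      rw [norm_mul, norm_mul, norm_planeWave, one_mul, norm_inv, norm_pow, Complex.norm_real,
        Real.norm_of_nonneg hl.le]
    simp only [hform]
    -- The truncated weights are bounded by `w`, so one majorant, summable because `Re ν > d`,
    -- serves for all `j`.
    refine tendsto_tsum_of_dominated_convergence (bound := fun z : corner A x => (l ^ d)⁻¹ *
      ∫ t in Set.Ioc (0 : ℝ) 1, 2 * t ^ (ν.re - 1) * E z t) ?_ (fun z => ?_)
      (Eventually.of_forall fun j z => ?_)
    · refine Summable.mul_left _ (summable_corner_of_le hA x hdν
        (C := (Real.pi * l⁻¹ ^ 2) ^ (-(ν.re / 2)) * Real.Gamma (ν.re / 2)) fun z hz => ?_)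
      have hn : 0 < ‖(z : Euc d)‖ := norm_pos_iff.2 hz
      have hnl : ‖l⁻¹ • (z : Euc d)‖ = l⁻¹ * ‖(z : Euc d)‖ := by
        rw [norm_smul, norm_inv, Real.norm_of_nonneg hl.le]
      rw [Real.norm_of_nonneg (setIntegral_nonneg measurableSet_Ioc fun t ht => mul_nonneg
        (mul_nonneg two_pos.le (Real.rpow_nonneg ht.1.le _)) (hE0 z t).le)]
      refine (two_mul_integral_Ioc_rpow_mul_exp_le hν0 (b := Real.pi * ‖l⁻¹ • (z : Euc d)‖ ^ 2)
        (by rw [hnl]; positivity)).trans (le_of_eq ?_)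
      rw [hnl, mul_pow, ← mul_assoc, Real.mul_rpow (by positivity) (by positivity),
        ← Real.rpow_natCast ‖(z : Euc d)‖ 2, ← Real.rpow_mul hn.le,
        show ((2 : ℕ) : ℝ) * -(ν.re / 2) = -ν.re by push_cast; ring]
      ring
    · refine Tendsto.const_mul _ ?_
      rw [hlim z]
      refine tendsto_integral_of_dominated_convergence (fun t => 2 * t ^ (ν.re - 1) * E z t)
        (fun j => ?_) (hint z) (fun j => (ae_restrict_mem measurableSet_Ioc).mono fun t ht =>
          hnorm t ht z j) ?_
      · exact (hw0.truncated j 0).aestronglyMeasurable.mul (by fun_prop)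
      · refine (ae_restrict_mem measurableSet_Ioc).mono fun t ht => tendsto_const_nhds.congr' ?_
        filter_upwards [eventually_truncatedWeight_eq w ht.1] with j hj
        rw [hj]
    · rw [hpl]
      refine mul_le_mul_of_nonneg_left ?_ (by positivity)
      exact norm_integral_le_of_norm_le (hint z)
        ((ae_restrict_mem measurableSet_Ioc).mono fun t ht => hnorm t ht z j)

/-! ### Continuation of the zeta function and the Crandall representation. -/

/-- The order of a meromorphic function with an explicit denominator. -/
theorem meromorphicAt_of_eq_div_sub {f h : ℂ → ℂ} {a : ℂ} (hh : AnalyticAt ℂ h a)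
    (hf : ∀ᶠ ν in 𝓝[≠] a, f ν = h ν / (ν - a)) :
    MeromorphicAt f a ∧ (-1 : WithTop ℤ) ≤ meromorphicOrderAt f a ∧
      (h a = 0 → 0 ≤ meromorphicOrderAt f a) := by
  have hsub : MeromorphicAt (fun ν : ℂ => ν - a) a := by fun_prop
  have heq : f =ᶠ[𝓝[≠] a] h * (fun ν => ν - a)⁻¹ := hf.mono fun ν hν => by
    rw [hν, Pi.mul_apply, Pi.inv_apply, div_eq_mul_inv]
  refine ⟨(hh.meromorphicAt.mul hsub.inv).congr heq.symm, ?_, fun h0 => ?_⟩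
  · rw [meromorphicOrderAt_congr heq, meromorphicOrderAt_mul hh.meromorphicAt hsub.inv,
      meromorphicOrderAt_inv]
    have h1 : meromorphicOrderAt (fun ν : ℂ => ν - a) a = 1 := meromorphicOrderAt_id_sub_const
    rw [h1]
    exact le_add_of_nonneg_left hh.meromorphicOrderAt_nonneg
  · obtain ⟨p, hp⟩ := hh
    have hd : AnalyticAt ℂ (dslope h a) a := ⟨_, hp.has_fpower_series_dslope_fslope⟩
    have heq' : f =ᶠ[𝓝[≠] a] dslope h a := by
      filter_upwards [hf, self_mem_nhdsWithin] with ν hν hne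
      rw [hν, dslope_of_ne _ hne, slope_def_field, h0, sub_zero]
    rw [meromorphicOrderAt_congr heq']
    exact hd.meromorphicOrderAt_nonneg

/-- The analytic continuation of the set zeta function of a corner. -/
theorem exists_continuation_zeta_corner {d : ℕ} {A : Matrix (Fin d) (Fin d) ℝ} (hA : A.det ≠ 0)
    (x y : Euc d) : ∃ Z : ℂ → ℂ,
      (∀ ν : ℂ, (d : ℝ) < ν.re →
        mellin (puncturedTheta A x y) (ν / 2) = Complex.Gammaℝ ν * Z ν) ∧
      (∀ ν ∉ zetaPoles d, AnalyticAt ℂ Z ν) ∧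
      (∀ ν ∈ zetaPoles d, MeromorphicAt Z ν ∧ (-1 : WithTop ℤ) ≤ meromorphicOrderAt Z ν) := by
  obtain ⟨c, hc⟩ := exists_hasMellinExpansion_puncturedTheta hA x y
  set f : ℂ → ℂ := fun ν =>
    mellinContinuation (puncturedTheta A x y) d c (ν / 2) * (Complex.Gammaℝ ν)⁻¹ with hf
  have hGan : ∀ ν, AnalyticAt ℂ (fun s => (Complex.Gammaℝ s)⁻¹) ν := fun ν =>
    Complex.differentiable_Gammaℝ_inv.analyticAt ν
  have han : ∀ ν ∉ hadamardPoles d, AnalyticAt ℂ f ν := by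
    intro ν hν
    refine AnalyticAt.mul ?_ (hGan ν)
    refine AnalyticAt.fun_comp (hc.analyticAt_mellinContinuation fun k hk => hν ⟨k, ?_⟩)
      (by fun_prop)
    exact (div_left_inj' two_ne_zero).1 hk
  have hpole : ∀ k : ℕ, MeromorphicAt f ((d : ℂ) - k) ∧
      (-1 : WithTop ℤ) ≤ meromorphicOrderAt f ((d : ℂ) - k) ∧
      (Complex.Gammaℝ ((d : ℂ) - k) = 0 → 0 ≤ meromorphicOrderAt f ((d : ℂ) - k)) := by
    intro k
    obtain ⟨g, hg, hge⟩ := hc.exists_eq_div_mellinContinuation k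
    set a : ℂ := (d : ℂ) - k
    have hh : AnalyticAt ℂ (fun ν => 2 * g (ν / 2) * (Complex.Gammaℝ ν)⁻¹) a :=
      (analyticAt_const.mul (AnalyticAt.fun_comp (f := fun ν : ℂ => ν / 2) hg (by fun_prop))).mul (hGan a)
    have ht : Tendsto (fun ν : ℂ => ν / 2) (𝓝[≠] a) (𝓝[≠] (a / 2)) := by
      refine tendsto_nhdsWithin_iff.2 ⟨?_, ?_⟩
      · exact ((continuous_id.div_const 2).tendsto a).mono_left nhdsWithin_le_nhds
      · filter_upwards [self_mem_nhdsWithin] with ν hν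
        exact fun h => hν ((div_left_inj' two_ne_zero).1 h)
    have h := meromorphicAt_of_eq_div_sub (f := f) hh (by
      filter_upwards [ht.eventually hge, self_mem_nhdsWithin] with ν hν hne
      have : ν - a ≠ 0 := sub_ne_zero.2 hne
      simp only [hf]
      rw [hν, ← sub_div]
      field_simp)
    exact ⟨h.1, h.2.1, fun h0 => h.2.2 (by simp only [h0, inv_zero, mul_zero])⟩
  have hmero : MeromorphicOn f Set.univ := by
    intro ν _
    by_cases hν : ν ∈ hadamardPoles d
    · obtain ⟨k, rfl⟩ := hν
      exact (hpole k).1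
    · exact (han ν hν).meromorphicAt
  have hval : ∀ ν ∉ hadamardPoles d, toMeromorphicNFOn f Set.univ ν = f ν := by
    intro ν hν
    rw [toMeromorphicNFOn_eq_toMeromorphicNFAt hmero (Set.mem_univ ν),
      toMeromorphicNFAt_eq_self.2 (han ν hν).meromorphicNFAt]
  have hord : ∀ ν, meromorphicOrderAt (toMeromorphicNFOn f Set.univ) ν =
      meromorphicOrderAt f ν := fun ν =>
    meromorphicOrderAt_toMeromorphicNFOn hmero (Set.mem_univ ν)
  -- On `d - ℕ₀` the values of `f` involve division by zero. The normal form replaces them by limits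
  -- where the singularity is removable, so that nonnegative order gives analyticity.
  refine ⟨toMeromorphicNFOn f Set.univ, fun ν hν => ?_, fun ν hν => ?_, fun ν hν => ?_⟩
  · have hnp : ν ∉ hadamardPoles d := by
      rintro ⟨k, rfl⟩
      rw [Complex.sub_re, Complex.natCast_re, Complex.natCast_re] at hν
      linarith [(Nat.cast_nonneg k : (0 : ℝ) ≤ k)]
    have hG : Complex.Gammaℝ ν ≠ 0 :=
      Complex.Gammaℝ_ne_zero_of_re_pos (lt_of_le_of_lt (Nat.cast_nonneg d) hν)
    rw [hval ν hnp, hf]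
    simp only
    rw [hc.mellinContinuation_eq_mellin (by rw [Complex.div_ofNat_re]; linarith)]
    field_simp
  · refine (meromorphicNFOn_toMeromorphicNFOn f Set.univ
      (Set.mem_univ ν)).meromorphicOrderAt_nonneg_iff_analyticAt.1 ?_
    rw [hord]
    by_cases h : ν ∈ hadamardPoles d
    · have hm : ∃ m : ℕ, ν = -2 * (m : ℂ) := by
        by_contra hm
        exact hν ⟨h, hm⟩
      obtain ⟨m, hm⟩ := hm
      obtain ⟨k, rfl⟩ := h
      -- At `-2m` the pole of the gamma factor is recorded by the default value `0`; its reciprocal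
      -- is also `0`, the correct value of the entire function `1/Γℝ`, and cancels the simple pole.
      refine (hpole k).2.2 (Complex.Gammaℝ_eq_zero_iff.2 ⟨m, ?_⟩)
      rw [hm]
      ring
    · exact (han ν h).meromorphicOrderAt_nonneg
  · obtain ⟨k, rfl⟩ := hν.1
    exact ⟨(meromorphicNFOn_toMeromorphicNFOn f Set.univ (Set.mem_univ _)).meromorphicAt,
      (hord _).symm ▸ (hpole k).2.1⟩

theorem theorem3p7 (d : ℕ) (A : Matrix (Fin d) (Fin d) ℝ) (hA : A.det ≠ 0) (x : Euc d) :
    singularSupport (formFactor (corner A x)) ⊆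
        {y : Euc d | ∃ (i : Fin d) (n : ℤ), (Aᵀ *ᵥ y.ofLp) i = n} ∧
      ∀ y : Euc d, ∃ Z : ℂ → ℂ,
        (∀ ν : ℂ, (d : ℝ) < ν.re →
          HasSum (fun z : ↥(corner A x \ {0}) => zetaTerm ν y (z : Euc d)) (Z ν)) ∧
        (∀ ν ∉ zetaPoles d, AnalyticAt ℂ Z ν) ∧
        (∀ ν ∈ zetaPoles d, MeromorphicAt Z ν ∧ (-1 : WithTop ℤ) ≤ meromorphicOrderAt Z ν) ∧
        ∀ l : ℝ, 0 < l →
          (∀ ν : ℂ, Summable fun z : ↥(corner A x) =>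
            planeWave y (z : Euc d) * crandallG ν (l⁻¹ • (z : Euc d))) ∧
          ∃ C : ℂ → ℂ, IsContinuedConvolution (formFactor (corner A x)) l y C ∧
            ∀ ν ∉ hadamardPoles d,
              Z ν = (Real.pi : ℂ) ^ (ν / 2) / ((l : ℂ) ^ ν * Complex.Gamma (ν / 2)) *
                ((∑' z : ↥(corner A x),
                    planeWave y (z : Euc d) * crandallG ν (l⁻¹ • (z : Euc d))) +
                  (l : ℂ) ^ d * C ν) := by
  refine ⟨singularSupport_formFactor_corner hA x, fun y => ?_⟩
  obtain ⟨Z, hZ, hZan, hZpole⟩ := exists_continuation_zeta_corner hA x y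
  have hZmero : MeromorphicOn Z Set.univ := fun ν _ => by
    by_cases hν : ν ∈ zetaPoles d
    · exact (hZpole ν hν).1
    · exact (hZan ν hν).meromorphicAt
  have hre : ∀ {ν : ℂ}, (d : ℝ) < ν.re → 0 < ν.re := fun h =>
    lt_of_le_of_lt (Nat.cast_nonneg d) h
  have hGZ : ∀ ν : ℂ, (d : ℝ) < ν.re → HasSum (fun z : corner A x =>
      Complex.Gammaℝ ν * zetaTerm ν y (z : Euc d)) (Complex.Gammaℝ ν * Z ν) := fun ν hν =>
    hZ ν hν ▸ hasSum_mellin_puncturedTheta hA x y hν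
  refine ⟨Z, fun ν hν => ?_, hZan, hZpole, fun l hl => ?_⟩
  · have hG : Complex.Gammaℝ ν ≠ 0 := Complex.Gammaℝ_ne_zero_of_re_pos (hre hν)
    have h := (hasSum_mul_left_iff hG).1 (hGZ ν hν)
    have h0 : zetaTerm ν y (0 : Euc d) = 0 := by
      have hν0 : ν ≠ 0 := fun h => by simpa [h] using hre hν
      rw [zetaTerm, norm_zero, Complex.ofReal_zero, Complex.zero_cpow hν0, div_zero]
    have h1 := hasSum_subtype_iff_indicator (f := zetaTerm ν y).1 h
    refine hasSum_subtype_iff_indicator (f := zetaTerm ν y).2 ?_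
    convert! h1 using 1
    funext z
    by_cases hz : z = 0
    · rw [hz, Set.indicator_apply_eq_zero.2 fun _ => h0, Set.indicator_apply_eq_zero.2 fun _ => h0]
    · exact Set.indicator_eq_indicator ⟨fun h => h.1, fun h => ⟨h, hz⟩⟩ rfl
  have hS := hasSum_crandallG_corner hA x y hl
  -- The continued convolution is the claimed formula solved for `C`. What remains is that it is
  -- meromorphic and has the right values for `Re ν > d + k`.
  refine ⟨fun ν => (hS ν).summable, fun ν => ((l : ℂ) ^ d)⁻¹ *
    ((l : ℂ) ^ ν * (Complex.Gammaℝ ν * Z ν) -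
      (mellin ((Set.Ioi (1 : ℝ)).indicator fun τ => puncturedTheta A x y (l⁻¹ ^ 2 * τ)) (ν / 2) +
        cornerOrigin A x * (-2 / ν))), ⟨fun ν _ => ?_, fun k hk ν hν => ?_⟩, fun ν hν => ?_⟩
  · have hl0 : (l : ℂ) ≠ 0 := by exact_mod_cast hl.ne'
    have h1 : MeromorphicAt (fun ν : ℂ => (l : ℂ) ^ ν) ν :=
      (Differentiable.analyticAt (f := fun ν : ℂ => (l : ℂ) ^ ν)
        (fun s => (differentiableAt_id.const_cpow (Or.inl hl0))) ν).meromorphicAt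
    have h2 : MeromorphicAt Complex.Gammaℝ ν := by
      have := (Complex.differentiable_Gammaℝ_inv.analyticAt ν).meromorphicAt.inv
      refine this.congr (Eventually.of_forall fun s => ?_)
      simp
    have h3 : MeromorphicAt (fun ν : ℂ => mellin ((Set.Ioi (1 : ℝ)).indicator fun τ =>
        puncturedTheta A x y (l⁻¹ ^ 2 * τ)) (ν / 2)) ν :=
      (Differentiable.analyticAt ((differentiable_mellin_puncturedTheta_upper hA x y
        (by positivity : 0 < l⁻¹ ^ 2)).comp (differentiable_id.div_const 2)) ν).meromorphicAt
    have h4 : MeromorphicAt (fun ν : ℂ => cornerOrigin A x * (-2 / ν)) ν := by fun_prop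
    exact (MeromorphicAt.const _ ν).mul
      ((h1.mul (h2.mul (hZmero ν (Set.mem_univ ν)))).sub (h3.add h4))
  · have hdν : (d : ℝ) < ν.re := lt_of_le_of_lt (le_add_of_nonneg_right (Nat.cast_nonneg k)) hν
    have h := hasConvolutionAt_formFactor_corner hA x y hl hk hν
    -- All series converge here, so the values can be compared term by term through
    -- `crandallG_add_integral_Ioc`.
    have hs := ((((hGZ ν hdν).mul_left ((l : ℂ) ^ ν)).sub (hS ν)).mul_left ((l : ℂ) ^ d)⁻¹).tsum_eq
    beta_reduce
    rw [← hs]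
    convert! h using 1
    refine tsum_congr fun z => ?_
    rw [← crandallG_add_integral_Ioc (hre hdν) hl y z]
    ring
  · have hG : Complex.Gamma (ν / 2) ≠ 0 := by
      -- The poles `ν = -2m = d - (d + 2m)` of `Γ(ν/2)` lie in the excluded set.
      refine Complex.Gamma_ne_zero fun m hm => hν ⟨d + 2 * m, ?_⟩
      rw [div_eq_iff two_ne_zero] at hm
      rw [hm]
      push_cast
      ring
    have hl0 : (l : ℂ) ≠ 0 := by exact_mod_cast hl.ne'
    have hlν : (l : ℂ) ^ ν ≠ 0 := by simp [Complex.cpow_eq_zero_iff, hl0]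
    have hpi : (Real.pi : ℂ) ≠ 0 := by exact_mod_cast Real.pi_ne_zero
    have hpiν : (Real.pi : ℂ) ^ (ν / 2) ≠ 0 := by simp [Complex.cpow_eq_zero_iff, hpi]
    have hld : (l : ℂ) ^ d ≠ 0 := pow_ne_zero _ hl0
    rw [(hS ν).tsum_eq, mul_inv_cancel_left₀ hld, add_sub_cancel, Complex.Gammaℝ_def, neg_div,
      Complex.cpow_neg]
    field_simp
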